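/- Let $r,n\ge 1$, let $q\in\mathbb{C}^*$ be not a root of unity, and let $\zeta$ be a primitive $r$-th root of unity, $\zeta_k:=\zeta^{k-1}$ for $1\le k\le r$. The affine Yokonuma–Hecke algebra $\widehat{Y}_{r,n}=\widehat{Y}_{r,n}(q)$ is the associative $\mathbb{C}$-algebra generated by $t_1,\dots,t_n,g_1,\dots,g_{n-1},X_1^{\pm1}$ with the relations $X_1X_1^{-1}=X_1^{-1}X_1=1$; $g_ig_j=g_jg_i$ if $|i-j|\ge 2$; $g_ig_{i+1}g_i=g_{i+1}g_ig_{i+1}$; $t_it_j=t_jt_i$; $g_it_j=t_{s_i(j)}g_i$, where $s_i=(i,i+1)$; $t_i^r=1$; $g_i^2=1+(q-q^{-1})e_ig_i$, where $e_i=\frac1r\sum_{s=0}^{r-1}t_i^st_{i+1}^{-s}$; $g_1X_1g_1X_1=X_1g_1X_1g_1$; $g_iX_1=X_1g_i$ for $i\ge2$; $t_jX_1=X_1t_j$. Put $X_{i+1}:=g_iX_ig_i$ for $1\le i\le n-1$. A finite dimensional $\widehat{Y}_{r,n}$-module is calibrated if it has a basis each of whose members is an eigenvector of every $X_j$, with nonzero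 eigenvalue, and of every $t_j$, with eigenvalue in $\{\zeta_1,\dots,\zeta_r\}$. Put $q^{2x}:=e^{\ln(q^2)x}$ for $x\in\mathbb{C}$, with the principal logarithm, and fix a set $D\subseteq\mathbb{C}$ with $D+1=D$ which $x\mapsto q^{2x}$ maps bijectively onto $\mathbb{C}^*$ (for real $q>1$ one can take $D=\mathbb{R}+i[0,2\pi/\ln(q^2))$). An $r$-skew shape $\bm{\lambda}/\bm{\mu}$ with $n$ boxes is given by $r$-tuples of partitions $\mu^{(s)}\subseteq\lambda^{(s)}$, $1\le s\le r$, such that $\sum_s|\lambda^{(s)}/\mu^{(s)}|=n$. For a box $b$ of $\bm{\lambda}/\bm{\mu}$ let $\mathrm{p}(b)\in\{1,\dots,r\}$ be the index of its component $\lambda^{(s)}/\mu^{(s)}$, and let $d(b)$ be its column number minus its row number. A placed $r$-skew shape $(\mathrm{c},\bm{\lambda}/\bm{\mu})$ consists of an $r$-skew shape and a function $\mathrm{c}$ from its boxes to $D$ such that for any two boxes $b,b'$ in the same component: if $d(b')\ge d(b)$ and $\mathrm{c}(b')-\mathrm{c}(b)\in\mathbb{Z}$, then $\mathrm{c}(b')-\mathrm{c}(b)\ge0$;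 $\mathrm{c}(b')=\mathrm{c}(b)+1$ if and only if $d(b')=d(b)+1$; $\mathrm{c}(b')=\mathrm{c}(b)$ if and only if $d(b')=d(b)$. Two placed $r$-skew shapes with $n$ boxes are regarded as the same if there is a bijection between their boxes which preserves the component index, the content $\mathrm{c}$, and the relations "is immediately to the right of" and "is immediately below" (in the same component), in both directions. A standard tableau $\mathcal{T}$ of shape $\bm{\lambda}/\bm{\mu}$ is a bijective labelling of the boxes by $1,\dots,n$ that increases from left to right along the rows and from top to bottom down the columns of each component; $\mathcal{T}|j$ is the box containing $j$, and $s_i\mathcal{T}$ is obtained by exchanging $i$ and $i+1$. **Theorem.** For a placed $r$-skew shape $(\mathrm{c},\bm{\lambda}/\bm{\mu})$ with $n$ boxes let $\widehat{Y}^{(\mathrm{c},\bm{\lambda}/\bm{\mu})}$ be the $\mathbb{C}$-vector space with basis $w_{\mathcal{T}}$, $\mathcal{T}\in\mathrm{Std}(\bm{\lambda}/\bm{\mu})$, and put $w_{\mathcal{T}}:=0$ if a labelling $\mathcal{T}$ is not standard. There is exactly one action of $\widehat{Y}_{r,n}$ on this space such that for all standard $\mathcal{T}$, with $\nu_j:=q^{2\mathrm{c}(\mathcal{T}|j)}$,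 $$t_jw_{\mathcal{T}}=\zeta_{\mathrm{p}(\mathcal{T}|j)}w_{\mathcal{T}},\qquad X_jw_{\mathcal{T}}=\nu_jw_{\mathcal{T}}\qquad(1\le j\le n),$$ and for $1\le i\le n-1$ $$g_iw_{\mathcal{T}}=w_{s_i\mathcal{T}}\quad\text{if }\mathrm{p}(\mathcal{T}|i)\ne\mathrm{p}(\mathcal{T}|i+1),$$ $$g_iw_{\mathcal{T}}=\frac{(q-q^{-1})\nu_{i+1}}{\nu_{i+1}-\nu_i}w_{\mathcal{T}}+\frac{q\nu_{i+1}-q^{-1}\nu_i}{\nu_{i+1}-\nu_i}w_{s_i\mathcal{T}}\quad\text{if }\mathrm{p}(\mathcal{T}|i)=\mathrm{p}(\mathcal{T}|i+1).$$ Moreover: (a) $\widehat{Y}^{(\mathrm{c},\bm{\lambda}/\bm{\mu})}$ is an irreducible calibrated $\widehat{Y}_{r,n}$-module. (b) $\widehat{Y}^{(\mathrm{c},\bm{\lambda}/\bm{\mu})}$ and $\widehat{Y}^{(\mathrm{c}',\bm{\lambda}'/\bm{\mu}')}$ are isomorphic if and only if the two placed $r$-skew shapes are the same in the above sense. (c)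 Every irreducible calibrated $\widehat{Y}_{r,n}$-module is isomorphic to $\widehat{Y}^{(\mathrm{c},\bm{\lambda}/\bm{\mu})}$ for some placed $r$-skew shape $(\mathrm{c},\bm{\lambda}/\bm{\mu})$ with $n$ boxes. -/

import Mathlib

noncomputable section

namespace YokonumaHecke

/-! ## The affine Yokonuma–Hecke algebra

Indices are shifted by one throughout: the index `j : Fin n` stands for `j + 1 ∈ {1, …, n}` and
`i : Fin (n - 1)` stands for `i + 1 ∈ {1, …, n - 1}`. -/

/-- The index `i`, as an element of `{1, …, n}`, of a number `i ∈ {1, …, n - 1}`. -/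
def lo {n : ℕ} (i : Fin (n - 1)) : Fin n := ⟨i.1, by omega⟩

/-- The index `i + 1`, as an element of `{1, …, n}`, of a number `i ∈ {1, …, n - 1}`. -/
def hi {n : ℕ} (i : Fin (n - 1)) : Fin n := ⟨i.1 + 1, by omega⟩

/-- The generators `t_1, …, t_n`, `g_1, …, g_{n-1}`, `X_1` and `X_1⁻¹`. -/
inductive Gen (n : ℕ) : Type
  | t : Fin n → Gen n
  | g : Fin (n - 1) → Gen n
  | X₁ : Gen n
  | X₁inv : Gen n

/-- The free algebra on the generators. -/
abbrev Free (n : ℕ) : Type := FreeAlgebra ℂ (Gen n)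

/-- A generator as an element of the free algebra. -/
def gen {n : ℕ} (x : Gen n) : Free n := FreeAlgebra.ι ℂ x

/-- `e_i = (1/r) ∑_{s=0}^{r-1} t_i^s t_{i+1}^{-s}`, where `t_{i+1}^{-s}` is written `t_{i+1}^{r-s}`
(the algebra has the relation `t_{i+1}^r = 1`). -/
def freeE (r : ℕ) {n : ℕ} (i : Fin (n - 1)) : Free n :=
  (1 / (r : ℂ)) •
    ∑ s ∈ Finset.range r, gen (Gen.t (lo i)) ^ s * gen (Gen.t (hi i)) ^ (r - s)

open Gen in
/-- The defining relations of the affine Yokonuma–Hecke algebra. -/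
inductive Rel (r n : ℕ) (q : ℂ) : Free n → Free n → Prop
  | g_comm (i j : Fin (n - 1)) (h : i.1 + 2 ≤ j.1 ∨ j.1 + 2 ≤ i.1) :
      Rel r n q (gen (g i) * gen (g j)) (gen (g j) * gen (g i))
  | g_braid (i j : Fin (n - 1)) (h : j.1 = i.1 + 1) :
      Rel r n q (gen (g i) * gen (g j) * gen (g i)) (gen (g j) * gen (g i) * gen (g j))
  | t_comm (i j : Fin n) : Rel r n q (gen (t i) * gen (t j)) (gen (t j) * gen (t i))
  | g_t (i : Fin (n - 1)) (j : Fin n) :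
      Rel r n q (gen (g i) * gen (t j)) (gen (t (Equiv.swap (lo i) (hi i) j)) * gen (g i))
  | t_pow (i : Fin n) : Rel r n q (gen (t i) ^ r) 1
  | g_sq (i : Fin (n - 1)) :
      Rel r n q (gen (g i) ^ 2) (1 + (q - q⁻¹) • (freeE r i * gen (g i)))
  | X_inv : Rel r n q (gen X₁ * gen X₁inv) 1
  | inv_X : Rel r n q (gen X₁inv * gen X₁) 1
  | g_X (i : Fin (n - 1)) (h : i.1 = 0) :
      Rel r n q (gen (g i) * gen X₁ * gen (g i) * gen X₁) (gen X₁ * gen (g i) * gen X₁ * gen (g i))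
  | g_X_comm (i : Fin (n - 1)) (h : 1 ≤ i.1) :
      Rel r n q (gen (g i) * gen X₁) (gen X₁ * gen (g i))
  | t_X_comm (j : Fin n) : Rel r n q (gen (t j) * gen X₁) (gen X₁ * gen (t j))

/-- The affine Yokonuma–Hecke algebra, by generators and relations over `ℂ`. -/
abbrev YHat (r n : ℕ) (q : ℂ) : Type := RingQuot (Rel r n q)

section Elements

variable (r n : ℕ) (q : ℂ)

/-- The image of a generator in the algebra. -/
def YHat.ofGen (x : Gen n) : YHat r n q := RingQuot.mkAlgHom ℂ (Rel r n q) (gen x)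

/-- The element `t_j`. -/
def YHat.t (j : Fin n) : YHat r n q := YHat.ofGen r n q (Gen.t j)

/-- The element `g_i`. -/
def YHat.g (i : Fin (n - 1)) : YHat r n q := YHat.ofGen r n q (Gen.g i)

/-- The recursion `X_{i+1} = g_i X_i g_i`, starting with the generator `X_1`. -/
def YHat.XAux : (k : ℕ) → k < n → YHat r n q
  | 0, _ => YHat.ofGen r n q Gen.X₁
  | k + 1, h =>
      YHat.g r n q ⟨k, by omega⟩ * YHat.XAux k (by omega) * YHat.g r n q ⟨k, by omega⟩

/-- The element `X_j`. -/
def YHat.X (j : Fin n) : YHat r n q := YHat.XAux r n q j.1 j.2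

end Elements

/-! ## Modules -/

/-- The module over a `ℂ`-algebra `A` that a representation `ρ : A → End(V)` defines on `V`. -/
@[nolint unusedArguments]
def RepModule {A : Type*} [Ring A] [Algebra ℂ A] {V : Type*} [AddCommGroup V] [Module ℂ V]
    (_ρ : A →ₐ[ℂ] Module.End ℂ V) : Type _ := V

section RepModule

variable {A : Type*} [Ring A] [Algebra ℂ A] {V : Type*} [AddCommGroup V] [Module ℂ V]
  (ρ : A →ₐ[ℂ] Module.End ℂ V)

instance : AddCommGroup (RepModule ρ) := inferInstanceAs (AddCommGroup V)

instance : Module ℂ (RepModule ρ) := inferInstanceAs (Module ℂ V)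

instance : Module A (RepModule ρ) :=
  letI : Module (Module.End ℂ V) (RepModule ρ) := inferInstanceAs (Module (Module.End ℂ V) V)
  Module.compHom (RepModule ρ) ρ.toRingHom

theorem RepModule.smul_def (a : A) (v : V) :
    (a • (show RepModule ρ from v) : RepModule ρ) = ρ a v := rfl

instance : IsScalarTower ℂ A (RepModule ρ) where
  smul_assoc z a v := by
    have h := congrArg (fun f : Module.End ℂ V => f v) (map_smul ρ z a)
    exact h

end RepModule

/-- A module is calibrated if it is finite dimensional and has a basis of simultaneous eigenvectors
of all `X_j`, with nonzero eigenvalues, and all `t_j`, with eigenvalues `ζ_k = ζ^{k-1}`,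
`1 ≤ k ≤ r`. -/
def IsCalibrated (r n : ℕ) (q ζ : ℂ) (M : Type*) [AddCommGroup M] [Module ℂ M]
    [Module (YHat r n q) M] : Prop :=
  Module.Finite ℂ M ∧
    ∃ b : Module.Basis (Fin (Module.finrank ℂ M)) ℂ M, ∀ k, ∀ j : Fin n,
      (∃ ν : ℂ, ν ≠ 0 ∧ YHat.X r n q j • b k = ν • b k) ∧
      (∃ a : Fin r, YHat.t r n q j • b k = ζ ^ (a : ℕ) • b k)

/-! ## Skew shapes and tableaux -/

/-- An `r`-skew shape `λ/μ` with `n` boxes. -/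
structure SkewShape (r n : ℕ) where
  /-- the `r`-partition `λ` -/
  lam : Fin r → YoungDiagram
  /-- the `r`-partition `μ` -/
  mu : Fin r → YoungDiagram
  mu_le_lam : ∀ s, mu s ≤ lam s
  card_boxes : ∑ s, ((lam s).cells \ (mu s).cells).card = n

variable {r n : ℕ}

/-- The boxes of `λ/μ`: triples (component, (row, column)). Rows are numbered from top to bottom
and columns from left to right. -/
def SkewShape.Box (S : SkewShape r n) : Type :=
  {b : Fin r × (ℕ × ℕ) // b.2 ∈ S.lam b.1 ∧ b.2 ∉ S.mu b.1}

namespace SkewShape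

variable {S : SkewShape r n}

/-- The index `p(b)` of the component that contains the box `b`. -/
def Box.p (b : S.Box) : Fin r := b.1.1

/-- The row of a box. -/
def Box.row (b : S.Box) : ℕ := b.1.2.1

/-- The column of a box. -/
def Box.col (b : S.Box) : ℕ := b.1.2.2

/-- The index of the major diagonal of a box; it grows from southwest to northeast. -/
def Box.diag (b : S.Box) : ℤ := (b.col : ℤ) - (b.row : ℤ)

/-- For two boxes of the same component: `b` comes before `b'` in the labelling of the boxes along
the major diagonals from southwest to northeast. -/
def Box.Before (b b' : S.Box) : Prop :=
  b.p = b'.p ∧ (b.diag < b'.diag ∨ (b.diag = b'.diag ∧ b.row < b'.row))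

/-- `b'` is the box immediately to the right of `b`. -/
def Box.IsLeftOf (b b' : S.Box) : Prop := b.p = b'.p ∧ b'.row = b.row ∧ b'.col = b.col + 1

/-- `b'` is the box immediately below `b`. -/
def Box.IsAbove (b b' : S.Box) : Prop := b.p = b'.p ∧ b'.row = b.row + 1 ∧ b'.col = b.col

/-- A labelling of the boxes by `1, …, n` is standard if the numbers strictly increase from left to
right along each row and from top to bottom down each column (of each component). -/
def IsStandard (S : SkewShape r n) (T : S.Box ≃ Fin n) : Prop :=
  (∀ b b' : S.Box, b.p = b'.p → b.row = b'.row → b.col < b'.col → T b < T b') ∧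
  (∀ b b' : S.Box, b.p = b'.p → b.col = b'.col → b.row < b'.row → T b < T b')

/-- The standard tableaux of shape `λ/μ`. -/
def Std (S : SkewShape r n) : Type := {T : S.Box ≃ Fin n // S.IsStandard T}

/-- The box `T|j` that contains the number `j`. -/
def Std.at (T : S.Std) (j : Fin n) : S.Box := T.1.symm j

/-- The labelling `s_i T`: the numbers `i` and `i + 1` in `T` are exchanged. -/
def Std.swap (T : S.Std) (i : Fin (n - 1)) : S.Box ≃ Fin n :=
  T.1.trans (Equiv.swap (lo i) (hi i))

/-- The vector space with basis `w_T`, for `T` a standard tableau of shape `λ/μ`. -/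
abbrev Space (S : SkewShape r n) : Type := S.Std →₀ ℂ

open Classical in
/-- The vector `w_T` for an arbitrary labelling `T`: the basis vector if `T` is standard, and `0`
otherwise. -/
def w (S : SkewShape r n) (T : S.Box ≃ Fin n) : S.Space :=
  if h : S.IsStandard T then Finsupp.single ⟨T, h⟩ 1 else 0

end SkewShape

/-! ## Placed shapes -/

/-- The function `x ↦ q^{2x} = e^{ln(q²) x}`. -/
def qpow (q x : ℂ) : ℂ := Complex.exp (Complex.log (q ^ 2) * x)

/-- A set of contents for `q`: it is stable under `x ↦ x + 1` and `x ↦ x - 1`, and `x ↦ q^{2x}` maps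
it bijectively onto `ℂ^*`. For real `q > 1` the strip `ℝ + i[0, 2π/ln(q²))` is such a set. -/
def IsContentDomain (q : ℂ) (D : Set ℂ) : Prop :=
  (∀ x, x + 1 ∈ D ↔ x ∈ D) ∧ Set.BijOn (qpow q) D {z | z ≠ 0}

/-- A placed `r`-skew shape with `n` boxes and contents in `D`. The conditions on the content
function concern pairs of boxes in the same component `λ^(s)/μ^(s)`. -/
structure PlacedShape (r n : ℕ) (D : Set ℂ) extends SkewShape r n where
  /-- the content function -/
  c : toSkewShape.Box → ℂ
  c_mem : ∀ b, c b ∈ D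
  c_mono : ∀ b b' : toSkewShape.Box, b.Before b' → ∀ k : ℤ, c b' - c b = k → 0 ≤ k
  c_adjacent : ∀ b b' : toSkewShape.Box, b.p = b'.p → (c b' = c b + 1 ↔ b'.diag = b.diag + 1)
  c_same : ∀ b b' : toSkewShape.Box, b.p = b'.p → (c b' = c b ↔ b'.diag = b.diag)

namespace PlacedShape

variable {D : Set ℂ}

/-- Two placed shapes are the same up to the position of their pieces in the plane: the boxes
correspond to each other with equal component indices, equal contents and the same adjacencies, so
that one shape is obtained from the other by translating connected components. -/
def Equivalent (P P' : PlacedShape r n D) : Prop :=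
  ∃ φ : P.Box ≃ P'.Box,
    (∀ b, (φ b).p = b.p) ∧ (∀ b, P'.c (φ b) = P.c b) ∧
    (∀ b b', (φ b).IsLeftOf (φ b') ↔ b.IsLeftOf b') ∧
    (∀ b b', (φ b).IsAbove (φ b') ↔ b.IsAbove b')

/-- `ν_j(T) = q^{2c(T|j)}`. -/
def weight (P : PlacedShape r n D) (q : ℂ) (T : P.Std) (j : Fin n) : ℂ := qpow q (P.c (T.at j))

/-- The explicit formulas for the action of `t_j`, `X_j` and `g_i` on the vectors `w_T`. -/
structure IsTableauAction (P : PlacedShape r n D) (q ζ : ℂ)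
    (ρ : YHat r n q →ₐ[ℂ] Module.End ℂ P.Space) : Prop where
  t_apply : ∀ (T : P.Std) (j : Fin n),
    ρ (YHat.t r n q j) (P.w T.1) = ζ ^ ((T.at j).p : ℕ) • P.w T.1
  X_apply : ∀ (T : P.Std) (j : Fin n),
    ρ (YHat.X r n q j) (P.w T.1) = P.weight q T j • P.w T.1
  g_apply_of_ne : ∀ (T : P.Std) (i : Fin (n - 1)), (T.at (lo i)).p ≠ (T.at (hi i)).p →
    ρ (YHat.g r n q i) (P.w T.1) = P.w (T.swap i)
  g_apply_of_eq : ∀ (T : P.Std) (i : Fin (n - 1)), (T.at (lo i)).p = (T.at (hi i)).p →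
    ρ (YHat.g r n q i) (P.w T.1) =
      (P.weight q T (hi i) * (q - q⁻¹) / (P.weight q T (hi i) - P.weight q T (lo i))) • P.w T.1 +
      ((P.weight q T (hi i) * q - P.weight q T (lo i) * q⁻¹) /
        (P.weight q T (hi i) - P.weight q T (lo i))) • P.w (T.swap i)

end PlacedShape

end YokonumaHecke

end

/-!
Everything is expressed by *words*: a weight of a module is a function `a : Fin n → Fin r × ℂ`,
whose letter `a j` records the eigenvalues of `t_j` (as an exponent of `ζ`) and of `X_j`. A
tableau `T` of a placed shape has the word `P.word q T`, which lists the components and the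
exponentiated contents of the boxes `T|1, …, T|n`. The coefficients of `g_i` on `w_T` are functions
`diagCoeff` and `swapCoeff` of the letters at the places `i` and `i + 1`.

*The action.* Two consecutive numbers in a standard tableau never lie on the same diagonal of a
component, so no denominator vanishes. The labelling `s_i T` of a standard `T` is standard exactly
when the product of the two off-diagonal coefficients of `g_i` does not vanish
(`swapLabel_isStandard_iff`), so that nonstandard labellings may be dropped. The relations then
reduce to identities between rational functions of two or three letters; the braid relation is the
Yang–Baxter equation for these coefficients. Distinct standard tableaux have distinct words
(`eq_of_word_eq`), and they are connected by exchanges of consecutive numbers. Hence a nonzero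
submodule contains some `w_T`, and then all of them. A word also determines the placed shape up to
equivalence (`equivalent_of_word_eq`), which gives the isomorphism criterion.

*The classification.* Let `M` be irreducible and calibrated. Consecutive letters of a weight of `M`
differ, since otherwise `X_i` would not be diagonalizable
(`IsWeightBasis.hasRegularWeights`). Therefore the intertwiners `τ_i = g_i - diagCoeff` are
defined on all weight vectors; they exchange two letters of the weight, satisfy the braid relations,
and `τ_i²` is the product of the two `swapCoeff`s. By Matsumoto's argument for the symmetric
group (`exists_matsumoto_family`), a weight vector generates a family of weight vectors indexed by
the permutations, which spans `M`. Along such a family equal letters cannot cross, since they would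
have to become neighbours first. It follows that `τ_i` itself vanishes on a weight vector as soon as
`τ_i²` does (`HasRegularWeights.intertwiner_eq_zero`). Moving the letters of a weight by
intertwiners and comparing the two sides of the braid relation when no move is possible, one finds
that between two equal letters there are letters of both neighbouring contents
(`HasRegularWeights.exists_neighbours`). A word with this property is the word of a standard
tableau (`exists_placedShape_of_contents`): the occurrences of the letters of two adjacent
diagonals alternate, and the successive occurrences of a letter are the successive boxes of its
diagonal. The family generated from a vector with this weight by rescaled intertwiners satisfies the
formulas for the `w_T`, which gives a nonzero homomorphism from the module of the placed shape, an
isomorphism by Schur's lemma.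
-/

namespace YokonumaHecke

/-! ### Structure constants -/

/-- The coefficient of `w_T` in `g_i w_T`, as a function of the letters (component index and
eigenvalue of `X`) at the places `i` and `i + 1`. -/
noncomputable def diagCoeff {r : ℕ} (q : ℂ) (x y : Fin r × ℂ) : ℂ :=
  if x.1 = y.1 then y.2 * (q - q⁻¹) / (y.2 - x.2) else 0

/-- The coefficient of `w_{s_i T}` in `g_i w_T`, as a function of the letters at the places `i` and
`i + 1`. -/
noncomputable def swapCoeff {r : ℕ} (q : ℂ) (x y : Fin r × ℂ) : ℂ :=
  if x.1 = y.1 then (y.2 * q - x.2 * q⁻¹) / (y.2 - x.2) else 1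

section Coefficients

variable {r : ℕ} {q : ℂ} {x y z : Fin r × ℂ}

lemma snd_sub_ne_zero (h : x ≠ y) (h1 : x.1 = y.1) : y.2 - x.2 ≠ 0 := fun h2 =>
  h (Prod.ext h1 (sub_eq_zero.1 h2).symm)

lemma diagCoeff_add (h : x ≠ y) :
    diagCoeff q x y + diagCoeff q y x = if x.1 = y.1 then q - q⁻¹ else 0 := by
  unfold diagCoeff
  by_cases h1 : x.1 = y.1
  · have h2 := snd_sub_ne_zero h h1
    have h3 := snd_sub_ne_zero h.symm h1.symm
    rw [if_pos h1, if_pos h1.symm, if_pos h1]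
    rw [← neg_sub x.2 y.2, div_neg]
    field_simp
    ring
  · rw [if_neg h1, if_neg (Ne.symm h1), if_neg h1, add_zero]

lemma diagCoeff_mul_sub (h : x ≠ y) :
    diagCoeff q x y * (y.2 - x.2) = if x.1 = y.1 then y.2 * (q - q⁻¹) else 0 := by
  unfold diagCoeff
  by_cases h1 : x.1 = y.1
  · rw [if_pos h1, if_pos h1, div_mul_cancel₀ _ (snd_sub_ne_zero h h1)]
  · simp [h1]

/-- The quadratic relation in terms of the structure constants. -/
lemma diagCoeff_sq (hq : q ≠ 0) (h : x ≠ y) :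
    diagCoeff q x y ^ 2 + swapCoeff q x y * swapCoeff q y x =
      1 + if x.1 = y.1 then (q - q⁻¹) * diagCoeff q x y else 0 := by
  unfold diagCoeff swapCoeff
  by_cases h1 : x.1 = y.1
  · have h2 := snd_sub_ne_zero h h1
    have h3 := snd_sub_ne_zero h.symm h1.symm
    simp only [if_pos h1, if_pos h1.symm]
    rw [← neg_sub x.2 y.2] at h2 ⊢
    field_simp
    ring
  · simp [h1, Ne.symm h1]

lemma swapCoeff_mul_swapCoeff (hq : q ≠ 0) (h : x ≠ y) :
    swapCoeff q x y * swapCoeff q y x = 1 + diagCoeff q x y * diagCoeff q y x := by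
  have h1 := diagCoeff_add (q := q) h
  have h2 := diagCoeff_sq hq h
  have h3 : (if x.1 = y.1 then (q - q⁻¹) * diagCoeff q x y else 0) =
      (diagCoeff q x y + diagCoeff q y x) * diagCoeff q x y := by
    rw [h1]; split_ifs <;> ring
  rw [h3] at h2
  linear_combination h2

/-- The Yang–Baxter equation, in its form for the coefficients of `g_i`. -/
lemma diagCoeff_yangBaxter (hxy : x ≠ y) (hyz : y ≠ z) (hxz : x ≠ z) :
    diagCoeff q x y * diagCoeff q y z =
      diagCoeff q x z * diagCoeff q x y + diagCoeff q y z * diagCoeff q x z -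
        diagCoeff q x z * (if x.1 = y.1 then q - q⁻¹ else 0) := by
  unfold diagCoeff
  by_cases h1 : x.1 = y.1
  · by_cases h2 : y.1 = z.1
    · have a1 := snd_sub_ne_zero hxy h1
      have a2 := snd_sub_ne_zero hyz h2
      have a3 := snd_sub_ne_zero hxz (h1.trans h2)
      simp only [if_pos h1, if_pos h2, if_pos (h1.trans h2)]
      field_simp
      ring
    · have h3 : x.1 ≠ z.1 := fun h => h2 (h1.symm.trans h)
      simp [h2, h3]
  · by_cases h2 : y.1 = z.1
    · have h3 : x.1 ≠ z.1 := fun h => h1 (h.trans h2.symm)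
      simp [h1, h3]
    · simp [h1, h2]

/-- The companion of `diagCoeff_yangBaxter`, with the roles of `g_i` and `g_{i+1}` exchanged. -/
lemma diagCoeff_yangBaxter' (hxy : x ≠ y) (hyz : y ≠ z) (hxz : x ≠ z) :
    diagCoeff q x y * diagCoeff q y z =
      diagCoeff q x z * diagCoeff q x y + diagCoeff q y z * diagCoeff q x z -
        diagCoeff q x z * (if y.1 = z.1 then q - q⁻¹ else 0) := by
  rw [diagCoeff_yangBaxter hxy hyz hxz]
  by_cases h : x.1 = z.1
  · simp only [h, eq_comm]
  · simp [diagCoeff, h]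

/-- The product of the two coefficients vanishes exactly if the contents of the two letters
differ by one, that is, if their eigenvalues have quotient `q^{±2}`. -/
lemma swapCoeff_mul_eq_zero_iff (hq : q ≠ 0) (h : x ≠ y) :
    swapCoeff q x y * swapCoeff q y x = 0 ↔
      x.1 = y.1 ∧ (y.2 = q ^ 2 * x.2 ∨ x.2 = q ^ 2 * y.2) := by
  unfold swapCoeff
  by_cases h1 : x.1 = y.1
  · have h2 := snd_sub_ne_zero h h1
    have h3 := snd_sub_ne_zero h.symm h1.symm
    rw [if_pos h1, if_pos h1.symm, mul_eq_zero, div_eq_zero_iff, div_eq_zero_iff]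
    simp only [h2, h3, or_false, h1, true_and]
    have key : ∀ a b : ℂ, b * q - a * q⁻¹ = 0 ↔ a = q ^ 2 * b := by
      intro a b
      rw [sub_eq_zero, eq_mul_inv_iff_mul_eq₀ hq]
      constructor <;> intro h <;> linear_combination -h
    rw [key, key, or_comm]
  · simp [h1, Ne.symm h1]

end Coefficients

/-! ### Relations in the algebra -/

namespace YHat

variable {r n : ℕ} {q : ℂ}

/-- The element `e_i`. -/
noncomputable def e (r : ℕ) {n : ℕ} (q : ℂ) (i : Fin (n - 1)) : YHat r n q :=
  RingQuot.mkAlgHom ℂ (Rel r n q) (freeE r i)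

lemma g_mul_g_comm (i j : Fin (n - 1)) (h : i.1 + 2 ≤ j.1 ∨ j.1 + 2 ≤ i.1) :
    g r n q i * g r n q j = g r n q j * g r n q i := by
  have key := RingQuot.mkAlgHom_rel ℂ (Rel.g_comm (r := r) (q := q) i j h)
  simp only [map_mul] at key
  exact key

lemma g_braid (i j : Fin (n - 1)) (h : j.1 = i.1 + 1) :
    g r n q i * g r n q j * g r n q i = g r n q j * g r n q i * g r n q j := by
  have key := RingQuot.mkAlgHom_rel ℂ (Rel.g_braid (r := r) (q := q) i j h)
  simp only [map_mul] at key
  exact key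

lemma g_mul_t (i : Fin (n - 1)) (j : Fin n) :
    g r n q i * t r n q j = t r n q (Equiv.swap (lo i) (hi i) j) * g r n q i := by
  have key := RingQuot.mkAlgHom_rel ℂ (Rel.g_t (r := r) (q := q) i j)
  simp only [map_mul] at key
  exact key

lemma g_sq (i : Fin (n - 1)) :
    g r n q i * g r n q i = 1 + (q - q⁻¹) • (e r q i * g r n q i) := by
  have := RingQuot.mkAlgHom_rel ℂ (Rel.g_sq (r := r) (q := q) i)
  simp only [map_mul, map_add, map_smul, map_one, pow_two] at this
  exact this

lemma g_mul_X₁ (i : Fin (n - 1)) (h : 1 ≤ i.1) :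
    g r n q i * ofGen r n q Gen.X₁ = ofGen r n q Gen.X₁ * g r n q i := by
  have key := RingQuot.mkAlgHom_rel ℂ (Rel.g_X_comm (r := r) (q := q) i h)
  simp only [map_mul] at key
  exact key

lemma X_mul_inv : ofGen r n q Gen.X₁ * ofGen r n q Gen.X₁inv = 1 := by
  have key := RingQuot.mkAlgHom_rel ℂ (Rel.X_inv (r := r) (n := n) (q := q))
  simp only [map_mul, map_one] at key
  exact key

lemma inv_mul_X : ofGen r n q Gen.X₁inv * ofGen r n q Gen.X₁ = 1 := by
  have key := RingQuot.mkAlgHom_rel ℂ (Rel.inv_X (r := r) (n := n) (q := q))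
  simp only [map_mul, map_one] at key
  exact key

lemma X_zero (hn : 0 < n) : X r n q ⟨0, hn⟩ = ofGen r n q Gen.X₁ := rfl

lemma X_hi (i : Fin (n - 1)) :
    X r n q (hi i) = g r n q i * X r n q (lo i) * g r n q i := rfl

lemma g_mul_XAux_of_lt (i : Fin (n - 1)) :
    ∀ (k : ℕ) (hk : k < n), k < i.1 →
      g r n q i * XAux r n q k hk = XAux r n q k hk * g r n q i
  | 0, _, h => g_mul_X₁ i h
  | k + 1, hk, h => by
      have h1 := g_mul_g_comm (r := r) (q := q) i ⟨k, by omega⟩ (Or.inr (by simp only; omega))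
      have h2 := g_mul_XAux_of_lt i k (by omega) (by omega)
      rw [XAux]
      simp only [← mul_assoc]
      rw [h1, mul_assoc _ (g r n q i), h2]
      simp only [mul_assoc]
      rw [h1]

lemma g_mul_XAux_of_gt (i : Fin (n - 1)) :
    ∀ (k : ℕ) (hk : k < n), i.1 + 2 ≤ k →
      g r n q i * XAux r n q k hk = XAux r n q k hk * g r n q i
  | 0, _, h => absurd h (by omega)
  | k + 1, hk, h => by
      rcases eq_or_lt_of_le h with h0 | h0
      · obtain ⟨i, hi'⟩ := i
        simp only at h h0
        obtain rfl : k = i + 1 := by omega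
        have hi2 : i + 1 < n - 1 := by omega
        have hb := g_braid (r := r) (q := q) ⟨i, hi'⟩ ⟨i + 1, hi2⟩ rfl
        have h2 := g_mul_XAux_of_lt (r := r) (q := q) ⟨i + 1, hi2⟩ i (by omega) (by simp)
        rw [XAux, XAux]
        simp only [← mul_assoc]
        rw [hb, mul_assoc _ _ (XAux r n q i _), h2]
        simp only [mul_assoc] at hb ⊢
        rw [hb]
      · have h1 := g_mul_g_comm (r := r) (q := q) i ⟨k, by omega⟩ (Or.inl (by simp only; omega))
        have h2 := g_mul_XAux_of_gt i k (by omega) (by omega)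
        rw [XAux]
        simp only [← mul_assoc]
        rw [h1, mul_assoc _ (g r n q i), h2]
        simp only [mul_assoc]
        rw [h1]

lemma g_mul_X (i : Fin (n - 1)) (j : Fin n) (h1 : j ≠ lo i) (h2 : j ≠ hi i) :
    g r n q i * X r n q j = X r n q j * g r n q i := by
  have h1' : j.1 ≠ i.1 := fun h => h1 (Fin.ext h)
  have h2' : j.1 ≠ i.1 + 1 := fun h => h2 (Fin.ext h)
  rcases lt_or_gt_of_ne h1' with h | h
  · exact g_mul_XAux_of_lt i j.1 j.2 h
  · exact g_mul_XAux_of_gt i j.1 j.2 (by omega)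

/-- The generators generate: a subalgebra that contains all of them is everything. -/
lemma mem_of_ofGen_mem (S : Subalgebra ℂ (YHat r n q)) (h : ∀ x, ofGen r n q x ∈ S)
    (a : YHat r n q) : a ∈ S := by
  obtain ⟨b, rfl⟩ := RingQuot.mkAlgHom_surjective ℂ (Rel r n q) a
  induction b using FreeAlgebra.induction with
  | grade0 z => rw [AlgHom.commutes]; exact S.algebraMap_mem z
  | grade1 x => exact h x
  | mul a b ha hb => rw [map_mul]; exact S.mul_mem ha hb
  | add a b ha hb => rw [map_add]; exact S.add_mem ha hb

end YHat

/-- A linear map that commutes with `t_j`, `g_i` and `X_1` is linear over the whole algebra. -/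
lemma map_smul_of_generators {r n : ℕ} {q : ℂ} {M N : Type*}
    [AddCommGroup M] [Module ℂ M] [Module (YHat r n q) M] [IsScalarTower ℂ (YHat r n q) M]
    [AddCommGroup N] [Module ℂ N] [Module (YHat r n q) N] [IsScalarTower ℂ (YHat r n q) N]
    (f : M →ₗ[ℂ] N)
    (ht : ∀ j m, f (YHat.t r n q j • m) = YHat.t r n q j • f m)
    (hg : ∀ i m, f (YHat.g r n q i • m) = YHat.g r n q i • f m)
    (hX : ∀ m, f (YHat.ofGen r n q Gen.X₁ • m) = YHat.ofGen r n q Gen.X₁ • f m)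
    (a : YHat r n q) (m : M) : f (a • m) = a • f m := by
  let S : Subalgebra ℂ (YHat r n q) :=
    { carrier := {a | ∀ m, f (a • m) = a • f m}
      mul_mem' := fun {a b} ha hb m => by rw [mul_smul, ha, hb, mul_smul]
      add_mem' := fun {a b} ha hb m => by rw [add_smul, map_add, ha, hb, add_smul]
      algebraMap_mem' := fun z m => by rw [algebraMap_smul, algebraMap_smul, map_smul] }
  refine YHat.mem_of_ofGen_mem S (fun x => ?_) a m
  cases x with
  | t j => exact ht j
  | g i => exact hg i
  | X₁ => exact hX
  | X₁inv =>
    intro m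
    have h := hX (YHat.ofGen r n q Gen.X₁inv • m)
    rw [← mul_smul, YHat.X_mul_inv, one_smul] at h
    rw [h, ← mul_smul, YHat.inv_mul_X, one_smul]

/-! ### Weight vectors and intertwiners -/

section WeightVectors

variable {r n : ℕ} {q ζ : ℂ} {M : Type*} [AddCommGroup M] [Module ℂ M]
  [Module (YHat r n q) M]

/-- The word obtained from `a` by exchanging the letters at the places `i` and `i + 1`. -/
def swapWord {α : Type*} (a : Fin n → α) (i : Fin (n - 1)) : Fin n → α :=
  a ∘ Equiv.swap (lo i) (hi i)

lemma lo_ne_hi (i : Fin (n - 1)) : lo i ≠ hi i := by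
  simp [lo, hi]

@[simp] lemma swapWord_lo {α : Type*} (a : Fin n → α) (i : Fin (n - 1)) :
    swapWord a i (lo i) = a (hi i) := by simp [swapWord]

@[simp] lemma swapWord_hi {α : Type*} (a : Fin n → α) (i : Fin (n - 1)) :
    swapWord a i (hi i) = a (lo i) := by simp [swapWord]

lemma swapWord_of_ne {α : Type*} (a : Fin n → α) {i : Fin (n - 1)} {j : Fin n} (h1 : j ≠ lo i)
    (h2 : j ≠ hi i) : swapWord a i j = a j := by
  simp [swapWord, Equiv.swap_apply_of_ne_of_ne h1 h2]

@[simp] lemma swapWord_swapWord {α : Type*} (a : Fin n → α) (i : Fin (n - 1)) :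
    swapWord (swapWord a i) i = a := by
  funext j
  simp [swapWord]

/-- `m` is a simultaneous eigenvector of all `t_j` and `X_j` (or zero); the word `a` records the
eigenvalue `ζ^p` of `t_j` through its index `p`, and the eigenvalue of `X_j`. -/
def IsWeightVector (q ζ : ℂ) [Module (YHat r n q) M] (a : Fin n → Fin r × ℂ) (m : M) : Prop :=
  ∀ j, YHat.t r n q j • m = ζ ^ ((a j).1 : ℕ) • m ∧ YHat.X r n q j • m = (a j).2 • m

lemma IsWeightVector.zero {a : Fin n → Fin r × ℂ} : IsWeightVector q ζ a (0 : M) :=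
  fun j => by simp

/-- The intertwiner `τ_i`: on vectors of weight `a` it is `g_i` minus a scalar. -/
noncomputable def intertwiner (q : ℂ) [Module (YHat r n q) M] (i : Fin (n - 1))
    (a : Fin n → Fin r × ℂ) (m : M) : M :=
  YHat.g r n q i • m - diagCoeff q (a (lo i)) (a (hi i)) • m

lemma intertwiner_zero (i : Fin (n - 1)) (a : Fin n → Fin r × ℂ) :
    intertwiner q i a (0 : M) = 0 := by simp [intertwiner]

variable [IsScalarTower ℂ (YHat r n q) M]

lemma YHat.smul_scalar_smul (x : YHat r n q) (z : ℂ) (m : M) : x • z • m = z • x • m :=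
  smul_comm x z m

/-- The average `(1/r) ∑_s t^s t'^{r-s}` acts on a common eigenvector of `t` and `t'`, with `r`-th
roots of unity as eigenvalues, as the projection onto the case of equal eigenvalues. -/
lemma average_smul_of_eigen {A V : Type*} [Ring A] [Algebra ℂ A] [AddCommGroup V] [Module ℂ V]
    [Module A V] [IsScalarTower ℂ A V] (hr : 0 < r) (hζ : IsPrimitiveRoot ζ r) (t t' : A)
    (k l : Fin r) (m : V) (h1 : t • m = ζ ^ (k : ℕ) • m) (h2 : t' • m = ζ ^ (l : ℕ) • m) :
    ((1 / (r : ℂ)) • ∑ s ∈ Finset.range r, t ^ s * t' ^ (r - s)) • m =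
      (if k = l then (1 : ℂ) else 0) • m := by
  have pw : ∀ (a : A) (z : ℂ), a • m = z • m → ∀ s : ℕ, a ^ s • m = z ^ s • m := by
    intro a z h s
    induction s with
    | zero => simp
    | succ s ih => rw [pow_succ, mul_smul, h, smul_comm, ih, smul_smul, pow_succ, mul_comm]
  have hr' : (r : ℂ) ≠ 0 := by exact_mod_cast hr.ne'
  have hz : ζ ≠ 0 := hζ.ne_zero hr.ne'
  have term : ∀ s ∈ Finset.range r,
      (t ^ s * t' ^ (r - s)) • m = ((ζ ^ (k : ℕ) * (ζ ^ (l : ℕ))⁻¹) ^ s) • m := by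
    intro s hs
    have hs' : s ≤ r := (Finset.mem_range.1 hs).le
    rw [mul_smul, pw _ _ h2, smul_comm, pw _ _ h1, smul_smul, mul_pow, inv_pow]
    congr 1
    have : (ζ ^ (l : ℕ)) ^ (r - s) * (ζ ^ (l : ℕ)) ^ s = 1 := by
      rw [← pow_add, Nat.sub_add_cancel hs', ← pow_mul, mul_comm, pow_mul, hζ.pow_eq_one, one_pow]
    rw [eq_inv_of_mul_eq_one_left this, mul_comm]
  rw [smul_assoc, Finset.sum_smul, Finset.sum_congr rfl term, ← Finset.sum_smul, smul_smul]
  congr 1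
  by_cases hkl : k = l
  · subst hkl
    simp [hz, hr']
  · rw [if_neg hkl]
    have hne : ζ ^ (k : ℕ) * (ζ ^ (l : ℕ))⁻¹ ≠ 1 := by
      intro h
      rw [mul_inv_eq_one₀ (pow_ne_zero _ hz)] at h
      exact hkl (Fin.ext (hζ.pow_inj k.2 l.2 h))
    rw [geom_sum_eq hne, mul_pow, inv_pow, ← pow_mul, ← pow_mul, mul_comm (k : ℕ),
      mul_comm (l : ℕ), pow_mul, pow_mul, hζ.pow_eq_one]
    simp

/-- `e_i` projects onto the vectors on which `t_i` and `t_{i+1}` have the same eigenvalue. -/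
lemma e_smul_of_eigen (hr : 0 < r) (hζ : IsPrimitiveRoot ζ r) (i : Fin (n - 1)) (k l : Fin r)
    (m : M)
    (h1 : YHat.t r n q (lo i) • m = ζ ^ (k : ℕ) • m)
    (h2 : YHat.t r n q (hi i) • m = ζ ^ (l : ℕ) • m) :
    YHat.e r q i • m = (if k = l then (1 : ℂ) else 0) • m := by
  rw [← average_smul_of_eigen hr hζ _ _ k l m h1 h2]
  simp only [YHat.e, freeE, map_smul, map_sum, map_mul, map_pow]
  rfl

namespace IsWeightVector

variable {a : Fin n → Fin r × ℂ} {m : M}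

lemma smul (z : ℂ) (h : IsWeightVector q ζ a m) : IsWeightVector q ζ a (z • m) := fun j =>
  ⟨by rw [smul_comm, (h j).1, smul_comm], by rw [smul_comm, (h j).2, smul_comm]⟩

lemma e_smul (hr : 0 < r) (hζ : IsPrimitiveRoot ζ r) (h : IsWeightVector q ζ a m)
    (i : Fin (n - 1)) :
    YHat.e r q i • m = (if (a (lo i)).1 = (a (hi i)).1 then (1 : ℂ) else 0) • m :=
  e_smul_of_eigen hr hζ i _ _ m (h _).1 (h _).1

/-- `g_i` permutes the eigenvalues of the `t_j`. -/
lemma t_smul_g (h : IsWeightVector q ζ a m) (i : Fin (n - 1)) (j : Fin n) :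
    YHat.t r n q j • YHat.g r n q i • m =
      ζ ^ ((swapWord a i j).1 : ℕ) • YHat.g r n q i • m := by
  have := YHat.g_mul_t (r := r) (q := q) i (Equiv.swap (lo i) (hi i) j)
  rw [Equiv.swap_apply_self] at this
  rw [← mul_smul, ← this, mul_smul, (h _).1, smul_comm]
  rfl

lemma e_smul_g (hr : 0 < r) (hζ : IsPrimitiveRoot ζ r) (h : IsWeightVector q ζ a m)
    (i : Fin (n - 1)) :
    YHat.e r q i • YHat.g r n q i • m =
      (if (a (lo i)).1 = (a (hi i)).1 then (1 : ℂ) else 0) • YHat.g r n q i • m := by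
  rw [e_smul_of_eigen hr hζ i _ _ _ (h.t_smul_g i _) (h.t_smul_g i _)]
  simp [eq_comm]

lemma g_smul_g (hr : 0 < r) (hζ : IsPrimitiveRoot ζ r) (h : IsWeightVector q ζ a m)
    (i : Fin (n - 1)) :
    YHat.g r n q i • YHat.g r n q i • m =
      m + (if (a (lo i)).1 = (a (hi i)).1 then q - q⁻¹ else 0) • YHat.g r n q i • m := by
  rw [← mul_smul, YHat.g_sq, add_smul, one_smul, smul_assoc, mul_smul, h.e_smul_g hr hζ, smul_smul]
  simp

lemma X_hi_smul_g (hr : 0 < r) (hζ : IsPrimitiveRoot ζ r) (h : IsWeightVector q ζ a m)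
    (i : Fin (n - 1)) :
    YHat.X r n q (hi i) • YHat.g r n q i • m = (a (lo i)).2 • YHat.g r n q i • m +
      ((if (a (lo i)).1 = (a (hi i)).1 then q - q⁻¹ else 0) * (a (hi i)).2) • m := by
  have hy := (h (hi i)).2
  rw [YHat.X_hi, mul_smul, mul_smul] at hy
  rw [YHat.X_hi, mul_smul, mul_smul, h.g_smul_g hr hζ, smul_add, smul_add, (h (lo i)).2,
    smul_comm _ (a (lo i)).2, smul_comm (YHat.X r n q (lo i)), smul_comm (YHat.g r n q i), hy,
    smul_smul]

lemma X_lo_smul_g (hr : 0 < r) (hζ : IsPrimitiveRoot ζ r) (h : IsWeightVector q ζ a m)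
    (i : Fin (n - 1)) :
    YHat.X r n q (lo i) • YHat.g r n q i • m = (a (hi i)).2 • YHat.g r n q i • m -
      ((if (a (lo i)).1 = (a (hi i)).1 then q - q⁻¹ else 0) * (a (hi i)).2) • m := by
  have hy := (h (hi i)).2
  rw [YHat.X_hi, mul_smul, mul_smul] at hy
  set u := YHat.X r n q (lo i) • YHat.g r n q i • m with hu
  have h1 : YHat.g r n q i • YHat.g r n q i • u =
      u + (q - q⁻¹) • YHat.e r q i • YHat.g r n q i • u := by
    rw [← mul_smul, YHat.g_sq, add_smul, one_smul, smul_assoc, mul_smul]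
  rw [hy, smul_comm, smul_comm (YHat.e r q i), h.e_smul hr hζ] at h1
  rw [h1, smul_smul, smul_smul]
  split_ifs <;> simp [mul_comm]

end IsWeightVector

lemma intertwiner_smul (i : Fin (n - 1)) (a : Fin n → Fin r × ℂ) (z : ℂ) (m : M) :
    intertwiner q i a (z • m) = z • intertwiner q i a m := by
  simp only [intertwiner, smul_sub, YHat.smul_scalar_smul]
  rw [smul_comm z (diagCoeff q _ _)]

namespace IsWeightVector

variable {a : Fin n → Fin r × ℂ} {m : M}

/-- The intertwiner `τ_i` exchanges the letters `i` and `i + 1` of the weight. -/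
lemma intertwiner (hr : 0 < r) (hζ : IsPrimitiveRoot ζ r) (h : IsWeightVector q ζ a m)
    {i : Fin (n - 1)} (hi' : a (lo i) ≠ a (hi i)) :
    IsWeightVector q ζ (swapWord a i) (intertwiner q i a m) := by
  intro j
  have hd := diagCoeff_mul_sub (q := q) hi'
  have hQ : (if (a (lo i)).1 = (a (hi i)).1 then q - q⁻¹ else 0) * (a (hi i)).2 =
      diagCoeff q (a (lo i)) (a (hi i)) * ((a (hi i)).2 - (a (lo i)).2) := by
    rw [hd]; split_ifs <;> ring
  unfold YokonumaHecke.intertwiner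
  refine ⟨?_, ?_⟩
  · rw [smul_sub, h.t_smul_g, YHat.smul_scalar_smul, (h j).1, smul_sub]
    by_cases hp : (a (lo i)).1 = (a (hi i)).1
    · have : (swapWord a i j).1 = (a j).1 := by
        by_cases h1 : j = lo i
        · rw [h1, swapWord_lo, hp]
        · by_cases h2 : j = hi i
          · rw [h2, swapWord_hi, hp]
          · rw [swapWord_of_ne _ h1 h2]
      rw [this, smul_comm (diagCoeff q _ _)]
    · simp [diagCoeff, hp]
  · by_cases h1 : j = lo i
    · rw [h1, smul_sub, h.X_lo_smul_g hr hζ, YHat.smul_scalar_smul, (h _).2, hQ, swapWord_lo]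
      generalize YHat.g r n q i • m = u
      module
    · by_cases h2 : j = hi i
      · rw [h2, smul_sub, h.X_hi_smul_g hr hζ, YHat.smul_scalar_smul, (h _).2, hQ, swapWord_hi]
        generalize YHat.g r n q i • m = u
        module
      · rw [swapWord_of_ne _ h1 h2, smul_sub, ← mul_smul, ← YHat.g_mul_X i j h1 h2, mul_smul,
          (h j).2, YHat.smul_scalar_smul, YHat.smul_scalar_smul, (h j).2]
        generalize YHat.g r n q i • m = u
        module

/-- `τ_i²` acts on a weight vector by the product of the two off-diagonal coefficients. -/
lemma intertwiner_intertwiner (hq : q ≠ 0) (hr : 0 < r) (hζ : IsPrimitiveRoot ζ r)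
    (h : IsWeightVector q ζ a m) {i : Fin (n - 1)} (hi' : a (lo i) ≠ a (hi i)) :
    YokonumaHecke.intertwiner q i (swapWord a i) (YokonumaHecke.intertwiner q i a m) =
      (swapCoeff q (a (lo i)) (a (hi i)) * swapCoeff q (a (hi i)) (a (lo i))) • m := by
  have h1 := diagCoeff_add (q := q) hi'
  simp only [YokonumaHecke.intertwiner, swapWord_lo, swapWord_hi, smul_sub]
  rw [h.g_smul_g hr hζ, ← h1]
  rw [YHat.smul_scalar_smul]
  rw [swapCoeff_mul_swapCoeff hq hi']
  generalize YHat.g r n q i • m = u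
  module

end IsWeightVector

lemma lo_ne_of_far {i j : Fin (n - 1)} (h : i.1 + 2 ≤ j.1 ∨ j.1 + 2 ≤ i.1) :
    lo j ≠ lo i ∧ lo j ≠ hi i ∧ hi j ≠ lo i ∧ hi j ≠ hi i := by
  simp only [lo, hi, ne_eq, Fin.mk.injEq]
  omega

lemma intertwiner_comm (a : Fin n → Fin r × ℂ) (m : M) {i j : Fin (n - 1)}
    (h : i.1 + 2 ≤ j.1 ∨ j.1 + 2 ≤ i.1) :
    intertwiner q i (swapWord a j) (intertwiner q j a m) =
      intertwiner q j (swapWord a i) (intertwiner q i a m) := by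
  obtain ⟨h1, h2, h3, h4⟩ := lo_ne_of_far h
  obtain ⟨h1', h2', h3', h4'⟩ := lo_ne_of_far h.symm
  simp only [intertwiner, swapWord_of_ne a h1 h2, swapWord_of_ne a h3 h4,
    swapWord_of_ne a h1' h2', swapWord_of_ne a h3' h4', smul_sub]
  rw [← mul_smul, ← mul_smul, YHat.g_mul_g_comm i j h]
  simp only [mul_smul, YHat.smul_scalar_smul]
  generalize YHat.g r n q i • m = u, YHat.g r n q j • m = v
  generalize YHat.g r n q j • u = u'
  module

lemma hi_eq_lo {i j : Fin (n - 1)} (h : j.1 = i.1 + 1) : hi i = lo j := Fin.ext h.symm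

lemma lo_ne_lo_hi {i j : Fin (n - 1)} (h : j.1 = i.1 + 1) :
    lo i ≠ lo j ∧ lo i ≠ hi j ∧ hi j ≠ lo i ∧ hi j ≠ hi i := by
  simp only [lo, hi, ne_eq, Fin.mk.injEq]
  omega

/-- The intertwiners satisfy the braid relation on a weight vector whose three letters at the
places concerned are pairwise different. -/
lemma IsWeightVector.intertwiner_braid {a : Fin n → Fin r × ℂ} {m : M} (hr : 0 < r)
    (hζ : IsPrimitiveRoot ζ r) (h : IsWeightVector q ζ a m) {i j : Fin (n - 1)}
    (hij : j.1 = i.1 + 1) (hxy : a (lo i) ≠ a (lo j)) (hyz : a (lo j) ≠ a (hi j))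
    (hxz : a (lo i) ≠ a (hi j)) :
    YokonumaHecke.intertwiner q i (swapWord (swapWord a i) j)
        (YokonumaHecke.intertwiner q j (swapWord a i) (YokonumaHecke.intertwiner q i a m)) =
      YokonumaHecke.intertwiner q j (swapWord (swapWord a j) i)
        (YokonumaHecke.intertwiner q i (swapWord a j) (YokonumaHecke.intertwiner q j a m)) := by
  obtain ⟨h1, h2, h3, h4⟩ := lo_ne_lo_hi hij
  have e1 := hi_eq_lo hij
  rw [e1] at h4
  have s1 : swapWord a i (lo j) = a (lo i) := by rw [← e1, swapWord_hi]
  have s2 : swapWord a i (hi j) = a (hi j) := swapWord_of_ne _ h3 (by rwa [e1])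
  have s3 : swapWord a j (lo i) = a (lo i) := swapWord_of_ne _ h1 h2
  have s4 : swapWord (swapWord a i) j (lo i) = a (lo j) := by
    rw [swapWord_of_ne _ h1 h2, swapWord_lo, e1]
  have s5 : swapWord (swapWord a j) i (hi j) = a (lo j) := by
    rw [swapWord_of_ne _ h3 (by rwa [e1]), swapWord_hi]
  have s6 : swapWord (swapWord a j) i (lo j) = a (lo i) := by
    rw [← e1, swapWord_hi, s3]
  have gx := h.g_smul_g hr hζ i
  have gy := h.g_smul_g hr hζ j
  rw [e1] at gx
  have Y1 := diagCoeff_yangBaxter (q := q) hxy hyz hxz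
  have Y2 := diagCoeff_yangBaxter' (q := q) hxy hyz hxz
  simp only [YokonumaHecke.intertwiner, e1, s1, s2, s3, s4, s5, s6, swapWord_lo,
    smul_sub]
  simp only [YHat.smul_scalar_smul, gx, gy]
  have hb : YHat.g r n q i • YHat.g r n q j • YHat.g r n q i • m =
      YHat.g r n q j • YHat.g r n q i • YHat.g r n q j • m := by
    simp only [← mul_smul]
    rw [← mul_assoc, ← mul_assoc, YHat.g_braid i j hij]
  rw [hb]
  generalize YHat.g r n q j • YHat.g r n q i • YHat.g r n q j • m = w
  generalize YHat.g r n q i • YHat.g r n q j • m = u', YHat.g r n q j • YHat.g r n q i • m = v'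
  generalize YHat.g r n q i • m = u, YHat.g r n q j • m = v
  linear_combination (norm := module) (-Y1) • u + Y2 • v

end WeightVectors

end YokonumaHecke

namespace YokonumaHecke

/-! ### Adjacent transpositions and Matsumoto's theorem for the symmetric group -/

section Permutations

variable {n : ℕ}

/-- The transposition `s_i = (i, i + 1)`. -/
def adjSwap (i : Fin (n - 1)) : Equiv.Perm (Fin n) := Equiv.swap (lo i) (hi i)

lemma coe_mul_adjSwap (w : Equiv.Perm (Fin n)) (i : Fin (n - 1)) :
    ⇑(w * adjSwap i) = swapWord w i := rfl

lemma mul_adjSwap_mul_adjSwap (w : Equiv.Perm (Fin n)) (i : Fin (n - 1)) :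
    w * adjSwap i * adjSwap i = w := by
  rw [mul_assoc, adjSwap, Equiv.swap_mul_self, mul_one]

lemma adjSwap_comm {i j : Fin (n - 1)} (h : i.1 + 2 ≤ j.1 ∨ j.1 + 2 ≤ i.1) :
    adjSwap i * adjSwap j = adjSwap j * adjSwap i := by
  obtain ⟨h1, h2, h3, h4⟩ := lo_ne_of_far h
  refine (Equiv.Perm.Disjoint.commute ?_).eq
  refine Equiv.Perm.disjoint_iff_disjoint_support.2 ?_
  rw [adjSwap, adjSwap, Equiv.Perm.support_swap (lo_ne_hi i), Equiv.Perm.support_swap (lo_ne_hi j)]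
  simp [h1, h2, h3, h4]

lemma adjSwap_braid {i j : Fin (n - 1)} (h : j.1 = i.1 + 1) :
    adjSwap i * adjSwap j * adjSwap i = adjSwap j * adjSwap i * adjSwap j := by
  obtain ⟨h1, h2, h3, h4⟩ := lo_ne_lo_hi h
  have e1 := hi_eq_lo h
  rw [e1] at h4
  rw [adjSwap, adjSwap, e1, Equiv.swap_mul_swap_mul_swap h1 h2,
    Equiv.swap_comm (lo i), Equiv.swap_comm (lo j) (hi j),
    Equiv.swap_mul_swap_mul_swap h4 h3, Equiv.swap_comm]

/-- A permutation without descents is the identity. -/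
lemma eq_one_of_no_descent (w : Equiv.Perm (Fin n)) (h : ∀ i, w (lo i) < w (hi i)) : w = 1 := by
  have hm : StrictMono w := by
    cases n with
    | zero => exact fun a => a.elim0
    | succ n => exact Fin.strictMono_iff_lt_succ.2 fun i => h i
  let o : Fin n ≃o Fin n := ⟨w, fun {a b} => hm.le_iff_le⟩
  have : o = OrderIso.refl _ := Subsingleton.elim _ _
  ext j
  exact congrArg (fun o : Fin n ≃o Fin n => (o j).1) this

/-- Removing a descent lowers `∑ (n - j) w(j)`, which takes the place of the length in inductions. -/
lemma sum_mul_swap_lt (w : Equiv.Perm (Fin n)) (i : Fin (n - 1)) (h : w (hi i) < w (lo i)) :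
    ∑ j, (n - j.1) * ((w * adjSwap i) j).1 < ∑ j, (n - j.1) * (w j).1 := by
  have hlo : lo i ∈ (Finset.univ : Finset (Fin n)) := Finset.mem_univ _
  have hhi : hi i ∈ Finset.univ.erase (lo i) := by simp [(lo_ne_hi i).symm]
  rw [← Finset.add_sum_erase _ _ hlo, ← Finset.add_sum_erase _ _ hhi,
    ← Finset.add_sum_erase _ (fun j => (n - j.1) * (w j).1) hlo,
    ← Finset.add_sum_erase _ (fun j => (n - j.1) * (w j).1) hhi, ← add_assoc, ← add_assoc]
  refine add_lt_add_of_lt_of_le ?_ (Finset.sum_le_sum fun j hj => ?_)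
  · simp only [coe_mul_adjSwap, swapWord_lo, swapWord_hi]
    have h1 : n - (lo i).1 = (n - (hi i).1) + 1 := by simp only [lo, hi]; omega
    rw [h1]
    have : (w (hi i)).1 < (w (lo i)).1 := h
    nlinarith
  · simp only [Finset.mem_erase] at hj
    rw [coe_mul_adjSwap, swapWord_of_ne _ hj.2.1 hj.1]

/-- Induction on permutations by removing descents. -/
theorem descent_induction {P : Equiv.Perm (Fin n) → Prop} (one : P 1)
    (step : ∀ w i, w (hi i) < w (lo i) → P (w * adjSwap i) → P w) (w : Equiv.Perm (Fin n)) :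
    P w := by
  by_cases h : ∀ i, w (lo i) < w (hi i)
  · rwa [eq_one_of_no_descent w h]
  · push Not at h
    obtain ⟨i, hi'⟩ := h
    have hlt := lt_of_le_of_ne hi' fun e => lo_ne_hi i (w.injective e).symm
    have := sum_mul_swap_lt w i hlt
    exact step w i hlt (descent_induction one step (w * adjSwap i))
termination_by ∑ j, (n - j.1) * (w j).1

/-- A nontrivial permutation of the places of a word that does not change the word inverts two
places with equal letters. -/
lemma exists_inverted_of_comp_eq {α : Type*} {a : Fin n → α} {w : Equiv.Perm (Fin n)}
    (hw : w ≠ 1) (h : a ∘ w = a) : ∃ k l, k < l ∧ w l < w k ∧ a k = a l := by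
  have hex : ∃ k, w k ≠ k := by
    by_contra! hc
    exact hw (Equiv.ext hc)
  -- `k` is the first place that is moved
  obtain ⟨k, hk, hmin⟩ := WellFounded.has_min (wellFounded_lt (α := Fin n)) {k | w k ≠ k} hex
  have hfix : ∀ j, j < k → w j = j := fun j hj => by
    by_contra hc
    exact hmin j hc hj
  have h1 : k < w.symm k := by
    rcases lt_trichotomy k (w.symm k) with h1 | h1 | h1
    · exact h1
    · exact absurd ((Equiv.eq_symm_apply w).1 h1) hk
    · have := hfix _ h1
      rw [Equiv.apply_symm_apply] at this
      exact absurd h1 (by rw [← this]; exact lt_irrefl _)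
  have h2 : k < w k := by
    rcases lt_trichotomy k (w k) with h2 | h2 | h2
    · exact h2
    · exact absurd h2.symm hk
    · exact absurd (w.injective (hfix _ h2)) hk
  refine ⟨k, w.symm k, h1, by rwa [Equiv.apply_symm_apply], ?_⟩
  have := congrFun h (w.symm k)
  rwa [Function.comp_apply, Equiv.apply_symm_apply] at this

section Matsumoto

variable {S : Type*} (f : Fin (n - 1) → S → S) (x₀ : S)

/-- `ReducedPath f x₀ w x`: the element `x` arises from `x₀` by applying the maps `f_i` along a
reduced decomposition of `w`. -/
inductive ReducedPath : Equiv.Perm (Fin n) → S → Prop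
  | one : ReducedPath 1 x₀
  | step {w : Equiv.Perm (Fin n)} {x : S} (i : Fin (n - 1)) (h : ReducedPath w x)
      (hi' : w (lo i) < w (hi i)) : ReducedPath (w * adjSwap i) (f i x)

variable {f x₀}

lemma ReducedPath.of_descent {w : Equiv.Perm (Fin n)} {x : S} {i : Fin (n - 1)}
    (h : ReducedPath f x₀ (w * adjSwap i) x) (hi' : w (hi i) < w (lo i)) :
    ReducedPath f x₀ w (f i x) := by
  have := h.step i (by simpa only [coe_mul_adjSwap, swapWord_lo, swapWord_hi] using hi')
  rwa [mul_adjSwap_mul_adjSwap] at this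

lemma ReducedPath.exists_of (w : Equiv.Perm (Fin n)) : ∃ x, ReducedPath f x₀ w x := by
  induction w using descent_induction with
  | one => exact ⟨x₀, .one⟩
  | step w i h ih =>
    obtain ⟨x, hx⟩ := ih
    exact ⟨_, hx.of_descent h⟩

lemma ReducedPath.cases_of {w : Equiv.Perm (Fin n)} {x : S} (h : ReducedPath f x₀ w x) :
    (w = 1 ∧ x = x₀) ∨
      ∃ i y, w (hi i) < w (lo i) ∧ ReducedPath f x₀ (w * adjSwap i) y ∧ x = f i y := by
  cases h with
  | one => exact Or.inl ⟨rfl, rfl⟩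
  | @step w y i h hi' =>
    refine Or.inr ⟨i, y, ?_, ?_, rfl⟩
    · simpa only [coe_mul_adjSwap, swapWord_lo, swapWord_hi] using hi'
    · rwa [mul_adjSwap_mul_adjSwap]

/-- Two reduced paths that end with the steps `i` and `i + 1` give the same element, if the reduced
paths to the shorter permutations do. -/
lemma ReducedPath.eq_of_adjacent
    (hbraid : ∀ i j, j.1 = i.1 + 1 → ∀ x, f i (f j (f i x)) = f j (f i (f j x)))
    {w : Equiv.Perm (Fin n)} {i j : Fin (n - 1)} (hij : j.1 = i.1 + 1)
    (hi' : w (hi i) < w (lo i)) (hj' : w (hi j) < w (lo j)) {y z : S}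
    (hy : ∀ y', ReducedPath f x₀ (w * adjSwap i) y' → y = y')
    (hz : ∀ z', ReducedPath f x₀ (w * adjSwap j) z' → z = z') : f i y = f j z := by
  obtain ⟨h1, h2, h3, h4⟩ := lo_ne_lo_hi hij
  have e1 := hi_eq_lo hij
  rw [e1] at h4 hi'
  obtain ⟨x, hx⟩ := ReducedPath.exists_of (f := f) (x₀ := x₀)
    (w * adjSwap i * adjSwap j * adjSwap i)
  have hx' := hx
  rw [mul_assoc, mul_assoc, ← mul_assoc (adjSwap i), adjSwap_braid hij, ← mul_assoc,
    ← mul_assoc] at hx'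
  -- the values of the intermediate permutations at the three places `i`, `i + 1`, `i + 2`
  have a1 : (w * adjSwap i) (lo j) = w (lo i) := by rw [coe_mul_adjSwap, ← e1, swapWord_hi]
  have a2 : (w * adjSwap i) (hi j) = w (hi j) := by
    rw [coe_mul_adjSwap, swapWord_of_ne _ h3 (by rwa [e1])]
  have a3 : (w * adjSwap i * adjSwap j) (lo i) = w (lo j) := by
    rw [coe_mul_adjSwap, swapWord_of_ne _ h1 h2, coe_mul_adjSwap, swapWord_lo, e1]
  have a4 : (w * adjSwap i * adjSwap j) (hi i) = w (hi j) := by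
    rw [e1, coe_mul_adjSwap, swapWord_lo, a2]
  have b1 : (w * adjSwap j) (lo i) = w (lo i) := by rw [coe_mul_adjSwap, swapWord_of_ne _ h1 h2]
  have b2 : (w * adjSwap j) (hi i) = w (hi j) := by rw [coe_mul_adjSwap, e1, swapWord_lo]
  have b3 : (w * adjSwap j * adjSwap i) (lo j) = w (lo i) := by
    rw [coe_mul_adjSwap, ← e1, swapWord_hi, b1]
  have b4 : (w * adjSwap j * adjSwap i) (hi j) = w (lo j) := by
    rw [coe_mul_adjSwap, swapWord_of_ne _ h3 (by rwa [e1]), coe_mul_adjSwap, swapWord_hi]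
  have p1 := (hx.of_descent (by rwa [a3, a4])).of_descent (by rw [a1, a2]; exact hj'.trans hi')
  have p2 := (hx'.of_descent (by rwa [b3, b4])).of_descent (by rw [b1, b2]; exact hj'.trans hi')
  rw [hy _ p1, hz _ p2, hbraid i j hij]

/-- Any two reduced decompositions of a permutation give the same element. The proof is by
induction on the length, with the last two steps compared by the braid relations. -/
theorem ReducedPath.unique
    (hcomm : ∀ i j, (i.1 + 2 ≤ j.1 ∨ j.1 + 2 ≤ i.1) → ∀ x, f i (f j x) = f j (f i x))
    (hbraid : ∀ i j, j.1 = i.1 + 1 → ∀ x, f i (f j (f i x)) = f j (f i (f j x)))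
    (w : Equiv.Perm (Fin n)) {x x' : S} (h : ReducedPath f x₀ w x) (h' : ReducedPath f x₀ w x') :
    x = x' := by
  rcases h.cases_of with ⟨hw, rfl⟩ | ⟨i, y, hi', hy, rfl⟩
  · rcases h'.cases_of with ⟨_, rfl⟩ | ⟨i, y, hi', _, _⟩
    · rfl
    · subst hw
      exact absurd (show hi i < lo i from hi') (by simp [lo, hi, Fin.lt_def])
  · rcases h'.cases_of with ⟨hw, rfl⟩ | ⟨j, z, hj', hz, rfl⟩
    · subst hw
      exact absurd (show hi i < lo i from hi') (by simp [lo, hi, Fin.lt_def])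
    · have := sum_mul_swap_lt w i hi'
      have := sum_mul_swap_lt w j hj'
      have hy' := fun y' => ReducedPath.unique hcomm hbraid (w * adjSwap i) (x' := y') hy
      have hz' := fun z' => ReducedPath.unique hcomm hbraid (w * adjSwap j) (x' := z') hz
      by_cases hij : i = j
      · subst hij
        rw [hy' z hz]
      · by_cases h1 : j.1 = i.1 + 1
        · exact eq_of_adjacent hbraid h1 hi' hj' hy' hz'
        · by_cases h2 : i.1 = j.1 + 1
          · exact (eq_of_adjacent hbraid h2 hj' hi' hz' hy').symm
          · have hij' : i.1 ≠ j.1 := fun e => hij (Fin.ext e)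
            have hfar : i.1 + 2 ≤ j.1 ∨ j.1 + 2 ≤ i.1 := by omega
            obtain ⟨c1, c2, c3, c4⟩ := lo_ne_of_far hfar
            obtain ⟨d1, d2, d3, d4⟩ := lo_ne_of_far hfar.symm
            obtain ⟨x, hx⟩ := ReducedPath.exists_of (f := f) (x₀ := x₀)
              (w * adjSwap i * adjSwap j)
            have hx' := hx
            rw [mul_assoc, adjSwap_comm hfar, ← mul_assoc] at hx'
            rw [hy' _ (hx.of_descent (by
                rwa [coe_mul_adjSwap, swapWord_of_ne _ c1 c2, swapWord_of_ne _ c3 c4])),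
              hz' _ (hx'.of_descent (by
                rwa [coe_mul_adjSwap, swapWord_of_ne _ d1 d2, swapWord_of_ne _ d3 d4])),
              hcomm i j hfar]
termination_by ∑ j, (n - j.1) * (w j).1

/-- Matsumoto's theorem for the symmetric group: maps `f_i` that satisfy the braid relations extend
to a family indexed by the permutations, along reduced decompositions. -/
theorem exists_matsumoto_family (f : Fin (n - 1) → S → S) (x₀ : S)
    (hcomm : ∀ i j, (i.1 + 2 ≤ j.1 ∨ j.1 + 2 ≤ i.1) → ∀ x, f i (f j x) = f j (f i x))
    (hbraid : ∀ i j, j.1 = i.1 + 1 → ∀ x, f i (f j (f i x)) = f j (f i (f j x))) :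
    ∃ u : Equiv.Perm (Fin n) → S, u 1 = x₀ ∧
      ∀ w i, w (lo i) < w (hi i) → u (w * adjSwap i) = f i (u w) := by
  choose u hu using ReducedPath.exists_of (f := f) (x₀ := x₀)
  exact ⟨u, ReducedPath.unique hcomm hbraid 1 (hu 1) .one, fun w i h =>
    ReducedPath.unique hcomm hbraid _ (hu _) ((hu w).step i h)⟩

end Matsumoto

end Permutations

end YokonumaHecke

namespace YokonumaHecke

variable {r n : ℕ}

/-! ### Skew shapes and standard tableaux -/

namespace SkewShape

variable {S : SkewShape r n}

lemma Box.ext' {b b' : S.Box} (hp : b.p = b'.p) (hr : b.row = b'.row) (hc : b.col = b'.col) :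
    b = b' :=
  Subtype.ext (Prod.ext hp (Prod.ext hr hc))

/-- The box `b` lies weakly northwest of `b'`, in the same component. -/
def Box.Le (b b' : S.Box) : Prop := b.p = b'.p ∧ b.row ≤ b'.row ∧ b.col ≤ b'.col

lemma Box.diag_eq (b : S.Box) : b.diag = (b.col : ℤ) - b.row := rfl

/-- Skew shapes are convex. -/
lemma exists_box_between {b b' : S.Box} (hp : b.p = b'.p) {x y : ℕ} (h1 : b.row ≤ x)
    (h2 : x ≤ b'.row) (h3 : b.col ≤ y) (h4 : y ≤ b'.col) :
    ∃ e : S.Box, e.p = b.p ∧ e.row = x ∧ e.col = y := by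
  refine ⟨⟨(b.p, (x, y)), ?_, fun h => b.2.2 ?_⟩, rfl, rfl, rfl⟩
  · rw [hp]
    exact (S.lam b'.p).isLowerSet (show (x, y) ≤ b'.1.2 from ⟨h2, h4⟩) b'.2.1
  · exact (S.mu b.p).isLowerSet (show b.1.2 ≤ (x, y) from ⟨h1, h3⟩) h

lemma Box.le_or_le {b b' : S.Box} (hp : b.p = b'.p) (h1 : b'.diag ≤ b.diag + 1)
    (h2 : b.diag ≤ b'.diag + 1) : b.Le b' ∨ b'.Le b := by
  rw [Box.diag_eq, Box.diag_eq] at h1 h2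
  by_cases h : b.row ≤ b'.row ∧ b.col ≤ b'.col
  · exact Or.inl ⟨hp, h⟩
  · exact Or.inr ⟨hp.symm, by omega, by omega⟩

lemma IsStandard.lt_of_le {T : S.Box ≃ Fin n} (hT : S.IsStandard T) {b b' : S.Box} (h : b.Le b')
    (hne : b ≠ b') : T b < T b' := by
  obtain ⟨hp, hr, hc⟩ := h
  obtain ⟨e, ep, er, ec⟩ := exists_box_between hp le_rfl hr hc le_rfl
  have h1 : T b ≤ T e := by
    rcases eq_or_lt_of_le hc with h | h
    · rw [Box.ext' ep.symm er.symm (h.trans ec.symm)]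
    · exact (hT.1 b e ep.symm er.symm (by rwa [ec])).le
  have h2 : T e ≤ T b' := by
    rcases eq_or_lt_of_le hr with h | h
    · rw [Box.ext' (ep.trans hp) (er.trans h) ec]
    · exact (hT.2 e b' (ep.trans hp) ec (by rwa [er])).le
  exact lt_of_le_of_ne (h1.trans h2) fun h => hne (T.injective h)

lemma isStandard_iff {T : S.Box ≃ Fin n} :
    S.IsStandard T ↔ ∀ b b' : S.Box, b.Le b' → b ≠ b' → T b < T b' := by
  refine ⟨fun h _ _ => h.lt_of_le, fun h => ⟨fun b b' hp hr hc => ?_, fun b b' hp hc hr => ?_⟩⟩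
  · exact h b b' ⟨hp, hr.le, hc.le⟩ fun e => by rw [e] at hc; exact lt_irrefl _ hc
  · exact h b b' ⟨hp, hr.le, hc.le⟩ fun e => by rw [e] at hr; exact lt_irrefl _ hr

/-- Standardness has to be checked for adjacent boxes only. -/
lemma isStandard_of_adjacent {T : S.Box ≃ Fin n}
    (h1 : ∀ b b' : S.Box, b.IsLeftOf b' → T b < T b')
    (h2 : ∀ b b' : S.Box, b.IsAbove b' → T b < T b') : S.IsStandard T := by
  constructor
  · have key : ∀ k : ℕ, ∀ b b' : S.Box, b.p = b'.p → b.row = b'.row → b'.col = b.col + k + 1 →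
        T b < T b' := by
      intro k
      induction k with
      | zero => exact fun b b' hp hr hc => h1 b b' ⟨hp, hr.symm, hc⟩
      | succ k ih =>
        intro b b' hp hr hc
        obtain ⟨e, ep, er, ec⟩ := exists_box_between (y := b.col + k + 1) hp le_rfl hr.le
          (by omega) (by omega)
        exact (ih b e ep.symm er.symm ec).trans
          (h1 e b' ⟨ep.trans hp, hr.symm.trans er.symm, by omega⟩)
    intro b b' hp hr hc
    exact key (b'.col - b.col - 1) b b' hp hr (by omega)
  · have key : ∀ k : ℕ, ∀ b b' : S.Box, b.p = b'.p → b.col = b'.col → b'.row = b.row + k + 1 →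
        T b < T b' := by
      intro k
      induction k with
      | zero => exact fun b b' hp hc hr => h2 b b' ⟨hp, hr, hc.symm⟩
      | succ k ih =>
        intro b b' hp hc hr
        obtain ⟨e, ep, er, ec⟩ := exists_box_between (x := b.row + k + 1) hp (by omega) (by omega)
          le_rfl hc.le
        exact (ih b e ep.symm ec.symm er).trans
          (h2 e b' ⟨ep.trans hp, by omega, hc.symm.trans ec.symm⟩)
    intro b b' hp hc hr
    exact key (b'.row - b.row - 1) b b' hp hc (by omega)

lemma Box.IsLeftOf.le {b b' : S.Box} (h : b.IsLeftOf b') : b.Le b' :=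
  ⟨h.1, h.2.1.ge, by rw [h.2.2]; omega⟩

lemma Box.IsAbove.le {b b' : S.Box} (h : b.IsAbove b') : b.Le b' :=
  ⟨h.1, by rw [h.2.1]; omega, h.2.2.ge⟩

lemma Box.IsLeftOf.diag_eq {b b' : S.Box} (h : b.IsLeftOf b') : b'.diag = b.diag + 1 := by
  have := h.2
  rw [Box.diag_eq, Box.diag_eq]
  omega

lemma Box.IsAbove.diag_eq {b b' : S.Box} (h : b.IsAbove b') : b.diag = b'.diag + 1 := by
  have := h.2
  rw [Box.diag_eq, Box.diag_eq]
  omega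

lemma Box.ne_of_diag_ne {b b' : S.Box} (h : b.diag ≠ b'.diag) : b ≠ b' := fun e => h (by rw [e])

lemma IsStandard.le_of_lt {T : S.Box ≃ Fin n} (hT : S.IsStandard T) {b b' : S.Box}
    (hp : b.p = b'.p) (h1 : b'.diag ≤ b.diag + 1) (h2 : b.diag ≤ b'.diag + 1) (h : T b < T b') :
    b.Le b' := by
  rcases Box.le_or_le hp h1 h2 with h' | h'
  · exact h'
  · refine absurd h (not_lt.2 ?_)
    by_cases e : b' = b
    · rw [e]
    · exact (hT.lt_of_le h' e).le

/-! ### Exchanging consecutive numbers -/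

/-- The labelling obtained from `T` by exchanging the numbers `i` and `i + 1`. -/
def swapLabel (T : S.Box ≃ Fin n) (i : Fin (n - 1)) : S.Box ≃ Fin n :=
  T.trans (Equiv.swap (lo i) (hi i))

lemma coe_swapLabel_symm (T : S.Box ≃ Fin n) (i : Fin (n - 1)) :
    ⇑(swapLabel T i).symm = swapWord T.symm i := rfl

@[simp] lemma swapLabel_swapLabel (T : S.Box ≃ Fin n) (i : Fin (n - 1)) :
    swapLabel (swapLabel T i) i = T := by
  ext b
  simp [swapLabel]

end SkewShape

lemma swap_lt_swap {i : Fin (n - 1)} {a b : Fin n} (h : a < b) (hne : ¬(a = lo i ∧ b = hi i)) :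
    Equiv.swap (lo i) (hi i) a < Equiv.swap (lo i) (hi i) b := by
  simp only [Equiv.swap_apply_def, lo, hi, Fin.ext_iff, Fin.lt_def] at *
  split_ifs <;> (try simp only) <;> omega

namespace SkewShape

variable {S : SkewShape r n} {T T' : S.Box ≃ Fin n}

lemma symm_lo_ne_symm_hi (T : S.Box ≃ Fin n) (i : Fin (n - 1)) : T.symm (lo i) ≠ T.symm (hi i) :=
  fun h => lo_ne_hi i (T.symm.injective h)

lemma IsStandard.swapLabel_iff (hT : S.IsStandard T) (i : Fin (n - 1)) :
    S.IsStandard (swapLabel T i) ↔ ¬(T.symm (lo i)).Le (T.symm (hi i)) := by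
  constructor
  · intro h hle
    have := h.lt_of_le hle (symm_lo_ne_symm_hi T i)
    simp [swapLabel, lo, hi, Fin.lt_def] at this
  · intro h
    rw [isStandard_iff]
    intro b b' hle hne
    refine swap_lt_swap (hT.lt_of_le hle hne) ?_
    rintro ⟨h1, h2⟩
    rw [← h1, ← h2, Equiv.symm_apply_apply, Equiv.symm_apply_apply] at h
    exact h hle

/-- Exchanging two consecutive numbers whose order is the opposite one in another standard tableau
leads to a standard tableau. -/
lemma IsStandard.swapLabel_of_inverted (hT : S.IsStandard T) (hT' : S.IsStandard T')
    {i : Fin (n - 1)} (h : T' (T.symm (hi i)) < T' (T.symm (lo i))) :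
    S.IsStandard (swapLabel T i) := by
  rw [hT.swapLabel_iff]
  exact fun hle => lt_asymm h (hT'.lt_of_le hle (symm_lo_ne_symm_hi T i))

/-- Comparable boxes with consecutive numbers are adjacent, since a box between them would need a
number between theirs. -/
lemma IsStandard.adjacent_of_le (hT : S.IsStandard T) {i : Fin (n - 1)}
    (hle : (T.symm (lo i)).Le (T.symm (hi i))) :
    (T.symm (lo i)).IsLeftOf (T.symm (hi i)) ∨ (T.symm (lo i)).IsAbove (T.symm (hi i)) := by
  have hne := symm_lo_ne_symm_hi T i
  set b := T.symm (lo i) with hb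
  set b' := T.symm (hi i) with hb'
  have Tb : T b = lo i := T.apply_symm_apply _
  have Tb' : T b' = hi i := T.apply_symm_apply _
  have key : ∀ e : S.Box, b.Le e → e.Le b' → e ≠ b → e = b' := by
    intro e h1 h2 h3
    by_contra h4
    have l1 := hT.lt_of_le h1 h3.symm
    have l2 := hT.lt_of_le h2 h4
    rw [Tb] at l1
    rw [Tb'] at l2
    simp only [lo, hi, Fin.lt_def] at l1 l2
    omega
  obtain ⟨hp, hr, hc⟩ := hle
  by_cases h : b.row = b'.row
  · have hlt : b.col < b'.col := lt_of_le_of_ne hc fun e => hne (Box.ext' hp h e)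
    obtain ⟨e, ep, er, ec⟩ := exists_box_between (y := b.col + 1) hp le_rfl hr (by omega) hlt
    have := key e ⟨ep.symm, er.ge, by omega⟩ ⟨ep.trans hp, by omega, by omega⟩
      (fun h => by rw [h] at ec; omega)
    rw [this] at ec er
    exact Or.inl ⟨hp, er, ec⟩
  · have hlt : b.row < b'.row := lt_of_le_of_ne hr h
    obtain ⟨e, ep, er, ec⟩ := exists_box_between (x := b.row + 1) hp (by omega) hlt le_rfl hc
    have := key e ⟨ep.symm, by omega, ec.ge⟩ ⟨ep.trans hp, by omega, by omega⟩
      (fun h => by rw [h] at er; omega)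
    rw [this] at ec er
    exact Or.inr ⟨hp, er, ec⟩

/-- Three consecutive numbers never contain two boxes of the same diagonal at their ends: between
two such boxes a skew shape has at least two more boxes. -/
lemma IsStandard.diag_ne_of_two (hT : S.IsStandard T) {i j : Fin (n - 1)} (hij : j.1 = i.1 + 1)
    (hp : (T.symm (lo i)).p = (T.symm (hi j)).p) :
    (T.symm (lo i)).diag ≠ (T.symm (hi j)).diag := by
  intro hd
  have hlt : lo i < hi j := by simp only [lo, hi, Fin.lt_def]; omega
  set b := T.symm (lo i) with hb
  set b' := T.symm (hi j) with hb'
  have Tb : T b = lo i := T.apply_symm_apply _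
  have Tb' : T b' = hi j := T.apply_symm_apply _
  have hle := hT.le_of_lt hp (by omega) (by omega) (by rwa [Tb, Tb'])
  have hne : b ≠ b' := fun h => hlt.ne (by rw [← Tb, ← Tb', h])
  have hrow : b.row < b'.row := lt_of_le_of_ne hle.2.1 fun e => hne (Box.ext' hp e (by
    rw [Box.diag_eq, Box.diag_eq] at hd; omega))
  have hcol : b.col < b'.col := by rw [Box.diag_eq, Box.diag_eq] at hd; omega
  obtain ⟨e, ep, er, ec⟩ := exists_box_between (x := b.row + 1) hp (by omega) hrow le_rfl hcol.le
  obtain ⟨f, fp, fr, fc⟩ := exists_box_between (y := b.col + 1) hp le_rfl hrow.le (by omega) hcol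
  have key : ∀ e : S.Box, b.Le e → e.Le b' → e ≠ b → e ≠ b' → T e = lo j := by
    intro e h1 h2 h3 h4
    have l1 := hT.lt_of_le h1 h3.symm
    have l2 := hT.lt_of_le h2 h4
    rw [Tb] at l1
    rw [Tb'] at l2
    simp only [lo, hi, Fin.lt_def] at l1 l2
    ext
    simp only [lo]
    omega
  have e1 := key e ⟨ep.symm, by omega, by omega⟩ ⟨ep.trans hp, by omega, by omega⟩
    (fun h => by rw [h] at er; omega) (fun h => by rw [h] at ec; omega)
  have f1 := key f ⟨fp.symm, by omega, by omega⟩ ⟨fp.trans hp, by omega, by omega⟩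
    (fun h => by rw [h] at fc; omega) (fun h => by rw [h] at fr; omega)
  have := T.injective (e1.trans f1.symm)
  rw [this] at er
  omega

/-- Induction over the standard tableaux, starting at a fixed one and exchanging consecutive
numbers. -/
theorem IsStandard.induction {P : (S.Box ≃ Fin n) → Prop} {T₀ : S.Box ≃ Fin n}
    (h₀ : S.IsStandard T₀) (one : P T₀)
    (step : ∀ T i, S.IsStandard T → S.IsStandard (swapLabel T i) → P (swapLabel T i) → P T)
    (T : S.Box ≃ Fin n) (hT : S.IsStandard T) : P T := by
  have key : ∀ w : Equiv.Perm (Fin n), ∀ T : S.Box ≃ Fin n, T.symm.trans T₀ = w →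
      S.IsStandard T → P T := by
    intro w
    induction w using descent_induction with
    | one =>
      intro T hw _
      have : T = T₀ := by
        ext b
        have := congrArg (fun w : Equiv.Perm (Fin n) => (w (T b)).1) hw
        simpa using this.symm
      rwa [this]
    | step w i h ih =>
      rintro T rfl hT
      have hs : S.IsStandard (swapLabel T i) := hT.swapLabel_of_inverted h₀ h
      exact step T i hT hs (ih _ rfl hs)
  exact key _ T rfl hT

/-! ### Existence of standard tableaux -/

lemma nonempty_std (S : SkewShape r n) : Nonempty S.Std := by
  classical
  let φ : S.Box ≃ Σ s : Fin r, {x // x ∈ (S.lam s).cells \ (S.mu s).cells} :=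
    { toFun := fun b => ⟨b.1.1, b.1.2, by
        simpa [YoungDiagram.mem_cells] using b.2⟩
      invFun := fun x => ⟨(x.1, x.2.1), by
        have h := x.2.2
        rw [Finset.mem_sdiff] at h
        exact h⟩
      left_inv := fun _ => rfl
      right_inv := fun _ => rfl }
  let _ : Fintype S.Box := Fintype.ofEquiv _ φ.symm
  have hcard : Fintype.card S.Box = n := by
    rw [Fintype.card_congr φ, Fintype.card_sigma]
    simpa using S.card_boxes
  let key : S.Box → Fin r ×ₗ (ℕ ×ₗ ℕ) := fun b => toLex (b.p, toLex (b.row, b.col))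
  have hkey : Function.Injective key := by
    intro b b' h
    have h1 := congrArg (fun x => (ofLex x).1) h
    have h2 := congrArg (fun x => (ofLex (ofLex x).2).1) h
    have h3 := congrArg (fun x => (ofLex (ofLex x).2).2) h
    exact Box.ext' h1 h2 h3
  let _ : LinearOrder S.Box := LinearOrder.lift' key hkey
  let o := Fintype.orderIsoFinOfCardEq S.Box hcard
  refine ⟨⟨o.symm.toEquiv, ?_⟩⟩
  rw [isStandard_iff]
  rintro b b' ⟨hp, hr, hc⟩ hne
  refine o.symm.strictMono (lt_of_le_of_ne (show key b ≤ key b' from ?_) hne)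
  refine Prod.Lex.toLex_le_toLex.2 (Or.inr ⟨hp, Prod.Lex.toLex_le_toLex.2 ?_⟩)
  rcases eq_or_lt_of_le hr with h | h
  · exact Or.inr ⟨h, hc⟩
  · exact Or.inl h

end SkewShape

/-! ### Contents and weights -/

section Qpow

variable {q : ℂ} {D : Set ℂ}

lemma qpow_ne_zero (x : ℂ) : qpow q x ≠ 0 := Complex.exp_ne_zero _

lemma qpow_add_one (hq : q ≠ 0) (x : ℂ) : qpow q (x + 1) = q ^ 2 * qpow q x := by
  rw [qpow, qpow, mul_add, mul_one, Complex.exp_add, Complex.exp_log (pow_ne_zero 2 hq), mul_comm]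

lemma qpow_eq_iff (hD : IsContentDomain q D) {x y : ℂ} (hx : x ∈ D) (hy : y ∈ D) :
    qpow q x = qpow q y ↔ x = y :=
  hD.2.injOn.eq_iff hx hy

lemma qpow_eq_mul_iff (hq : q ≠ 0) (hD : IsContentDomain q D) {x y : ℂ} (hx : x ∈ D)
    (hy : y ∈ D) : qpow q y = q ^ 2 * qpow q x ↔ y = x + 1 := by
  rw [← qpow_add_one hq, qpow_eq_iff hD hy ((hD.1 x).2 hx)]

end Qpow

namespace PlacedShape

open SkewShape

variable {D : Set ℂ}

/-- The weight of a labelling: the component indices of the boxes `T|1, …, T|n` and the values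
`ν_j = q^{2c(T|j)}`. -/
noncomputable def word (P : PlacedShape r n D) (q : ℂ) (T : P.Box ≃ Fin n) (j : Fin n) :
    Fin r × ℂ :=
  ((T.symm j).p, qpow q (P.c (T.symm j)))

lemma word_swapLabel (P : PlacedShape r n D) (q : ℂ) (T : P.Box ≃ Fin n) (i : Fin (n - 1)) :
    P.word q (swapLabel T i) = swapWord (P.word q T) i := rfl

variable {q : ℂ} {P : PlacedShape r n D}

lemma word_eq_iff (hD : IsContentDomain q D) {P' : PlacedShape r n D} {T : P.Box ≃ Fin n}
    {T' : P'.Box ≃ Fin n} {j k : Fin n} : P.word q T j = P'.word q T' k ↔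
      (T.symm j).p = (T'.symm k).p ∧ P.c (T.symm j) = P'.c (T'.symm k) := by
  rw [word, word, Prod.mk.injEq, qpow_eq_iff hD (P.c_mem _) (P'.c_mem _)]

lemma word_lo_ne_word_hi (hD : IsContentDomain q D) {T : P.Box ≃ Fin n} (hT : P.IsStandard T)
    (i : Fin (n - 1)) : P.word q T (lo i) ≠ P.word q T (hi i) := by
  rw [Ne, word_eq_iff hD]
  rintro ⟨hp, hc⟩
  have hd := (P.c_same _ _ hp).1 hc.symm
  have hle := hT.le_of_lt hp (by omega) (by omega) (by
    rw [Equiv.apply_symm_apply, Equiv.apply_symm_apply]; simp [lo, hi, Fin.lt_def])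
  rcases hT.adjacent_of_le hle with h | h
  · have := h.diag_eq; omega
  · have := h.diag_eq; omega

lemma word_lo_ne_word_hi_of_two (hD : IsContentDomain q D) {T : P.Box ≃ Fin n}
    (hT : P.IsStandard T) {i j : Fin (n - 1)} (hij : j.1 = i.1 + 1) :
    P.word q T (lo i) ≠ P.word q T (hi j) := by
  rw [Ne, word_eq_iff hD]
  rintro ⟨hp, hc⟩
  exact hT.diag_ne_of_two hij hp ((P.c_same _ _ hp).1 hc.symm).symm

/-- For a standard tableau `T`, the tableau `s_i T` is standard if and only if the product of the
two off-diagonal coefficients of `g_i` does not vanish. -/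
lemma swapLabel_isStandard_iff (hq : q ≠ 0) (hD : IsContentDomain q D) {T : P.Box ≃ Fin n}
    (hT : P.IsStandard T) (i : Fin (n - 1)) :
    P.IsStandard (swapLabel T i) ↔
      swapCoeff q (P.word q T (lo i)) (P.word q T (hi i)) *
        swapCoeff q (P.word q T (hi i)) (P.word q T (lo i)) ≠ 0 := by
  rw [hT.swapLabel_iff, Ne, swapCoeff_mul_eq_zero_iff hq (word_lo_ne_word_hi hD hT i), not_iff_not]
  simp only [word]
  rw [qpow_eq_mul_iff hq hD (P.c_mem _) (P.c_mem _), qpow_eq_mul_iff hq hD (P.c_mem _) (P.c_mem _)]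
  constructor
  · intro hle
    refine ⟨hle.1, ?_⟩
    rcases hT.adjacent_of_le hle with h | h
    · exact Or.inl ((P.c_adjacent _ _ hle.1).2 h.diag_eq)
    · exact Or.inr ((P.c_adjacent _ _ hle.1.symm).2 h.diag_eq)
  · rintro ⟨hp, h⟩
    have hd : (T.symm (hi i)).diag = (T.symm (lo i)).diag + 1 ∨
        (T.symm (lo i)).diag = (T.symm (hi i)).diag + 1 :=
      h.imp (P.c_adjacent _ _ hp).1 (P.c_adjacent _ _ hp.symm).1
    exact hT.le_of_lt hp (by omega) (by omega) (by
      rw [Equiv.apply_symm_apply, Equiv.apply_symm_apply]; simp [lo, hi, Fin.lt_def])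

/-- A standard tableau of a placed shape is determined by its weight. -/
lemma eq_of_word_eq (hD : IsContentDomain q D) {T T' : P.Box ≃ Fin n} (hT : P.IsStandard T)
    (hT' : P.IsStandard T') (h : P.word q T = P.word q T') : T = T' := by
  -- the boxes with the number `j` agree if all boxes with smaller numbers do
  have half : ∀ T T' : P.Box ≃ Fin n, P.IsStandard T' → ∀ j : Fin n,
      (∀ k < j, T.symm k = T'.symm k) → (T.symm j).Le (T'.symm j) → T.symm j = T'.symm j := by
    intro T T' hT' j ih hle
    by_contra hne
    have hlt := hT'.lt_of_le hle hne
    rw [Equiv.apply_symm_apply] at hlt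
    have := ih _ hlt
    rw [Equiv.symm_apply_apply] at this
    exact hlt.ne (T.symm.injective this)
  have key : ∀ j : Fin n, T.symm j = T'.symm j := by
    intro j
    induction j using WellFoundedLT.induction with
    | ind j ih =>
      obtain ⟨hp, hc⟩ := (word_eq_iff hD).1 (congrFun h j)
      have hd := (P.c_same _ _ hp).1 hc.symm
      rcases Box.le_or_le hp (by omega) (by omega) with hle | hle
      · exact half T T' hT' j ih hle
      · exact (half T' T hT j (fun k hk => (ih k hk).symm) hle).symm
  exact Equiv.symm_bijective.injective (Equiv.ext key)

/-! ### Equivalent placed shapes -/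

variable {P' : PlacedShape r n D}

/-- Tableaux of the same weight have the same adjacent boxes: the boxes of a diagonal and those of
a neighbouring diagonal alternate in the order of their numbers. -/
lemma adjacent_of_word_eq (hD : IsContentDomain q D) {T : P.Box ≃ Fin n} {T' : P'.Box ≃ Fin n}
    (hT : P.IsStandard T) (hT' : P'.IsStandard T') (h : P.word q T = P'.word q T')
    {b b' : P.Box} :
    (b.IsLeftOf b' → (T'.symm (T b)).IsLeftOf (T'.symm (T b'))) ∧
      (b.IsAbove b' → (T'.symm (T b)).IsAbove (T'.symm (T b'))) := by
  have hφ : ∀ b : P.Box, b.p = (T'.symm (T b)).p ∧ P.c b = P'.c (T'.symm (T b)) := fun b => by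
    have := (word_eq_iff hD).1 (congrFun h (T b))
    rwa [Equiv.symm_apply_apply] at this
  set B := T'.symm (T b) with hB
  set B' := T'.symm (T b') with hB'
  have TB : T' B = T b := T'.apply_symm_apply _
  have TB' : T' B' = T b' := T'.apply_symm_apply _
  -- no box of the diagonal of `B` has a number between those of `B` and `B'`
  have gap : b.IsLeftOf b' ∨ b.IsAbove b' → ∀ E' : P'.Box, E'.p = B.p → E'.diag = B.diag →
      T' B < T' E' → T' E' < T' B' → False := by
    intro hadj E' hp hd l1 l2
    obtain ⟨hEp, hEc⟩ := hφ (T.symm (T' E'))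
    rw [Equiv.apply_symm_apply, Equiv.symm_apply_apply] at hEp hEc
    set E := T.symm (T' E') with hE
    have TE : T E = T' E' := T.apply_symm_apply _
    have hp' : b.p = E.p := by rw [hEp, hp, (hφ b).1]
    have hc' : P.c E = P.c b := by
      rw [hEc, (hφ b).2]
      exact (P'.c_same _ _ hp.symm).2 hd
    have hd' := (P.c_same _ _ hp').1 hc'
    rw [TB, ← TE] at l1
    rw [TB', ← TE] at l2
    have hle := hT.le_of_lt hp' (by omega) (by omega) l1
    have hne : b ≠ E := fun e => by rw [e] at l1; exact lt_irrefl _ l1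
    have hrc : b.row < E.row ∧ b.col < E.col := by
      have h1 : b.row ≠ E.row := fun e => hne (Box.ext' hp' e (by
        rw [Box.diag_eq, Box.diag_eq] at hd'; omega))
      have := hle.2
      rw [Box.diag_eq, Box.diag_eq] at hd'
      omega
    have hle' : b'.Le E := by
      rcases hadj with h | h
      · exact ⟨h.1.symm.trans hp', by have := h.2; omega, by have := h.2; omega⟩
      · exact ⟨h.1.symm.trans hp', by have := h.2; omega, by have := h.2; omega⟩
    by_cases e : b' = E
    · rw [e] at l2; exact lt_irrefl _ l2
    · exact lt_asymm l2 (hT.lt_of_le hle' e)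
  have diagStep : ∀ hadj : b.IsLeftOf b' ∨ b.IsAbove b', B.Le B' → B'.diag ≠ B.diag →
      ¬(B.row + 1 ≤ B'.row ∧ B.col + 1 ≤ B'.col) := by
    rintro hadj hle hdne ⟨h1, h2⟩
    obtain ⟨e, ep, er, ec⟩ := exists_box_between (x := B.row + 1) (y := B.col + 1) hle.1
      (by omega) h1 (by omega) h2
    have ed : e.diag = B.diag := by rw [Box.diag_eq, Box.diag_eq]; omega
    refine gap hadj e ep ed (hT'.lt_of_le ⟨ep.symm, by omega, by omega⟩ ?_)
      (hT'.lt_of_le ⟨ep.trans hle.1, by omega, by omega⟩ ?_)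
    · intro e'
      rw [← e'] at er
      omega
    · intro e'
      rw [e'] at ed
      exact hdne ed
  constructor
  · intro hadj
    have hp : B.p = B'.p := by rw [← (hφ b).1, ← (hφ b').1, hadj.1]
    have hd : B'.diag = B.diag + 1 := by
      rw [← P'.c_adjacent _ _ hp, ← (hφ b).2, ← (hφ b').2, P.c_adjacent _ _ hadj.1, hadj.diag_eq]
    have hlt : T' B < T' B' := by
      rw [TB, TB']
      exact hT.lt_of_le hadj.le (Box.ne_of_diag_ne (by have := hadj.diag_eq; omega))
    have hle := hT'.le_of_lt hp (by omega) (by omega) hlt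
    have := diagStep (Or.inl hadj) hle (by omega)
    have h2 := hle.2
    rw [Box.diag_eq, Box.diag_eq] at hd
    exact ⟨hp, by omega, by omega⟩
  · intro hadj
    have hp : B.p = B'.p := by rw [← (hφ b).1, ← (hφ b').1, hadj.1]
    have hd : B.diag = B'.diag + 1 := by
      rw [← P'.c_adjacent _ _ hp.symm, ← (hφ b).2, ← (hφ b').2, P.c_adjacent _ _ hadj.1.symm,
        hadj.diag_eq]
    have hlt : T' B < T' B' := by
      rw [TB, TB']
      exact hT.lt_of_le hadj.le (Box.ne_of_diag_ne (by have := hadj.diag_eq; omega))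
    have hle := hT'.le_of_lt hp (by omega) (by omega) hlt
    have := diagStep (Or.inr hadj) hle (by omega)
    have h2 := hle.2
    rw [Box.diag_eq, Box.diag_eq] at hd
    exact ⟨hp, by omega, by omega⟩

/-- Placed shapes that have standard tableaux of the same weight are equivalent. -/
theorem equivalent_of_word_eq (hD : IsContentDomain q D) {T : P.Box ≃ Fin n}
    {T' : P'.Box ≃ Fin n} (hT : P.IsStandard T) (hT' : P'.IsStandard T')
    (h : P.word q T = P'.word q T') : P.Equivalent P' := by
  have hφ : ∀ b : P.Box, b.p = (T'.symm (T b)).p ∧ P.c b = P'.c (T'.symm (T b)) := fun b => by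
    have := (word_eq_iff hD).1 (congrFun h (T b))
    rwa [Equiv.symm_apply_apply] at this
  refine ⟨T.trans T'.symm, fun b => (hφ b).1.symm, fun b => (hφ b).2.symm, fun b b' => ⟨?_, ?_⟩,
    fun b b' => ⟨?_, ?_⟩⟩
  · intro hb
    simpa using (adjacent_of_word_eq hD hT' hT h.symm).1 hb
  · exact (adjacent_of_word_eq hD hT hT' h).1
  · intro hb
    simpa using (adjacent_of_word_eq hD hT' hT h.symm).2 hb
  · exact (adjacent_of_word_eq hD hT hT' h).2

/-- An equivalence of placed shapes transports standard tableaux. -/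
lemma isStandard_transport {φ : P.Box ≃ P'.Box}
    (h1 : ∀ b b', (φ b).IsLeftOf (φ b') ↔ b.IsLeftOf b')
    (h2 : ∀ b b', (φ b).IsAbove (φ b') ↔ b.IsAbove b') {T : P.Box ≃ Fin n} :
    P'.IsStandard (φ.symm.trans T) ↔ P.IsStandard T := by
  constructor
  · intro h
    refine isStandard_of_adjacent (fun b b' hb => ?_) (fun b b' hb => ?_)
    · have hb' := (h1 b b').2 hb
      simpa using h.lt_of_le hb'.le (Box.ne_of_diag_ne (by have := hb'.diag_eq; omega))
    · have hb' := (h2 b b').2 hb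
      simpa using h.lt_of_le hb'.le (Box.ne_of_diag_ne (by have := hb'.diag_eq; omega))
  · intro h
    refine isStandard_of_adjacent (fun b b' hb => ?_) (fun b b' hb => ?_)
    · have hb' := (h1 (φ.symm b) (φ.symm b')).1 (by simpa using hb)
      exact h.lt_of_le hb'.le (Box.ne_of_diag_ne (by have := hb'.diag_eq; omega))
    · have hb' := (h2 (φ.symm b) (φ.symm b')).1 (by simpa using hb)
      exact h.lt_of_le hb'.le (Box.ne_of_diag_ne (by have := hb'.diag_eq; omega))

end PlacedShape

end YokonumaHecke

namespace YokonumaHecke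

open SkewShape

variable {r n : ℕ}

/-! ### The tableau representation -/

namespace SkewShape

variable {S : SkewShape r n}

lemma w_coe (T : S.Std) : S.w T.1 = Finsupp.single T 1 := dif_pos T.2

lemma linearCombination_w {N : Type*} [AddCommGroup N] [Module ℂ N] (v : S.Std → N) (T : S.Std) :
    Finsupp.linearCombination ℂ v (S.w T.1) = v T :=
  (congrArg _ (w_coe T)).trans ((Finsupp.linearCombination_single ℂ 1 T).trans (one_smul ℂ _))

lemma w_apply_self (T : S.Std) : S.w T.1 T = 1 :=
  (congrArg (fun x : S.Space => x T) (w_coe T)).trans Finsupp.single_eq_same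

lemma w_apply_of_ne {T T' : S.Std} (h : T ≠ T') : S.w T.1 T' = 0 :=
  (congrArg (fun x : S.Space => x T') (w_coe T)).trans (Finsupp.single_eq_of_ne h.symm)

lemma w_of_not {T : S.Box ≃ Fin n} (h : ¬S.IsStandard T) : S.w T = 0 := by
  rw [w, dif_neg h]

lemma w_ne_zero (T : S.Std) : S.w T.1 ≠ 0 :=
  fun h => one_ne_zero ((w_apply_self T).symm.trans (congrArg (fun x : S.Space => x T) h))

lemma hom_ext_w {N : Type*} [AddCommGroup N] [Module ℂ N] {f g : S.Space →ₗ[ℂ] N}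
    (h : ∀ T, S.IsStandard T → f (S.w T) = g (S.w T)) : f = g := by
  refine Finsupp.lhom_ext' fun T => LinearMap.ext_ring ?_
  have := h T.1 T.2
  rw [w_coe] at this
  exact this

/-- The operator on the tableau space that is diagonal in the basis `w_T`. -/
noncomputable def diagOp (S : SkewShape r n) (φ : (S.Box ≃ Fin n) → ℂ) : Module.End ℂ S.Space :=
  Finsupp.linearCombination ℂ fun T : S.Std => φ T.1 • S.w T.1

lemma diagOp_w (φ : (S.Box ≃ Fin n) → ℂ) (T : S.Box ≃ Fin n) :
    S.diagOp φ (S.w T) = φ T • S.w T := by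
  by_cases h : S.IsStandard T
  · exact linearCombination_w (fun T : S.Std => φ T.1 • S.w T.1) ⟨T, h⟩
  · simp [w_of_not h]

lemma diagOp_mul (φ ψ : (S.Box ≃ Fin n) → ℂ) :
    S.diagOp φ * S.diagOp ψ = S.diagOp fun T => φ T * ψ T := by
  refine hom_ext_w fun T _ => ?_
  rw [Module.End.mul_apply, diagOp_w, map_smul, diagOp_w, diagOp_w, smul_smul, mul_comm]

lemma diagOp_comm (φ ψ : (S.Box ≃ Fin n) → ℂ) :
    S.diagOp φ * S.diagOp ψ = S.diagOp ψ * S.diagOp φ := by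
  simp only [diagOp_mul, mul_comm]

lemma diagOp_one : S.diagOp (fun _ => 1) = 1 :=
  hom_ext_w fun T _ => by rw [diagOp_w, one_smul, Module.End.one_apply]

lemma diagOp_pow (φ : (S.Box ≃ Fin n) → ℂ) (k : ℕ) :
    S.diagOp φ ^ k = S.diagOp fun T => φ T ^ k := by
  induction k with
  | zero => simp [diagOp_one]
  | succ k ih => simp only [pow_succ, ih, diagOp_mul]

/-- An operator that is diagonal in the basis `w_T` acts on the coordinates by scalars. -/
lemma apply_coord {f : Module.End ℂ S.Space} {φ : (S.Box ≃ Fin n) → ℂ}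
    (h : ∀ T, S.IsStandard T → f (S.w T) = φ T • S.w T) (x : S.Space) (T : S.Std) :
    f x T = φ T.1 * x T := by
  have : (Finsupp.lapply T).comp f = φ T.1 • (Finsupp.lapply T : S.Space →ₗ[ℂ] ℂ) := by
    refine hom_ext_w fun T' hT' => ?_
    simp only [LinearMap.comp_apply, h T' hT', map_smul, LinearMap.smul_apply]
    by_cases hT : (⟨T', hT'⟩ : S.Std) = T
    · subst hT
      rfl
    · have h0 : (Finsupp.lapply T : S.Space →ₗ[ℂ] ℂ) (S.w T') = 0 := w_apply_of_ne hT
      rw [h0, smul_zero, smul_zero]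
  exact congrArg (fun g : S.Space →ₗ[ℂ] ℂ => g x) this

lemma swapLabel_braid (T : S.Box ≃ Fin n) {i j : Fin (n - 1)} (hij : j.1 = i.1 + 1) :
    swapLabel (swapLabel (swapLabel T i) j) i = swapLabel (swapLabel (swapLabel T j) i) j := by
  have := adjSwap_braid hij
  ext b
  exact congrArg (fun w : Equiv.Perm (Fin n) => (w (T b)).1) this

lemma swapLabel_comm (T : S.Box ≃ Fin n) {i j : Fin (n - 1)}
    (hij : i.1 + 2 ≤ j.1 ∨ j.1 + 2 ≤ i.1) :
    swapLabel (swapLabel T i) j = swapLabel (swapLabel T j) i := by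
  have := adjSwap_comm hij.symm
  ext b
  exact congrArg (fun w : Equiv.Perm (Fin n) => (w (T b)).1) this

end SkewShape

namespace PlacedShape

variable {D : Set ℂ} (P : PlacedShape r n D) (q ζ : ℂ)

/-- The operator by which `t_j` acts. -/
noncomputable def tOp (j : Fin n) : Module.End ℂ P.Space :=
  P.diagOp fun T => ζ ^ ((T.symm j).p : ℕ)

/-- The operator by which `X_j` acts. -/
noncomputable def XOp (j : Fin n) : Module.End ℂ P.Space :=
  P.diagOp fun T => (P.word q T j).2

/-- The operator by which `X_j⁻¹` acts. -/
noncomputable def XinvOp (j : Fin n) : Module.End ℂ P.Space :=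
  P.diagOp fun T => (P.word q T j).2⁻¹

/-- The operator by which `g_i` acts. -/
noncomputable def gOp (i : Fin (n - 1)) : Module.End ℂ P.Space :=
  Finsupp.linearCombination ℂ fun T : P.Std =>
    diagCoeff q (P.word q T.1 (lo i)) (P.word q T.1 (hi i)) • P.w T.1 +
      swapCoeff q (P.word q T.1 (lo i)) (P.word q T.1 (hi i)) • P.w (swapLabel T.1 i)

open Classical in
/-- The coefficient of `w_{s_i T}` in `g_i w_T` for an arbitrary labelling `T`; it is zero if `T` is
not standard, since then `w_T = 0`. -/
noncomputable def stdCoeff (T : P.Box ≃ Fin n) (i : Fin (n - 1)) : ℂ :=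
  if P.IsStandard T then swapCoeff q (P.word q T (lo i)) (P.word q T (hi i)) else 0

variable {P q ζ}

lemma gOp_w (T : P.Box ≃ Fin n) (i : Fin (n - 1)) :
    P.gOp q i (P.w T) = diagCoeff q (P.word q T (lo i)) (P.word q T (hi i)) • P.w T +
      P.stdCoeff q T i • P.w (swapLabel T i) := by
  by_cases h : P.IsStandard T
  · rw [stdCoeff, if_pos h]
    exact linearCombination_w (fun T : P.Std =>
      diagCoeff q (P.word q T.1 (lo i)) (P.word q T.1 (hi i)) • P.w T.1 +
        swapCoeff q (P.word q T.1 (lo i)) (P.word q T.1 (hi i)) • P.w (swapLabel T.1 i)) ⟨T, h⟩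
  · rw [w_of_not h, stdCoeff, if_neg h]
    simp

lemma stdCoeff_mul (hq : q ≠ 0) (hD : IsContentDomain q D) {T : P.Box ≃ Fin n}
    (hT : P.IsStandard T) (i : Fin (n - 1)) :
    P.stdCoeff q T i * P.stdCoeff q (swapLabel T i) i =
      swapCoeff q (P.word q T (lo i)) (P.word q T (hi i)) *
        swapCoeff q (P.word q T (hi i)) (P.word q T (lo i)) := by
  rw [stdCoeff, if_pos hT, stdCoeff, word_swapLabel, swapWord_lo, swapWord_hi]
  by_cases h : P.IsStandard (swapLabel T i)
  · rw [if_pos h]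
  · rw [if_neg h, mul_zero]
    rw [swapLabel_isStandard_iff hq hD hT, not_not] at h
    exact h.symm

/-- The two coefficients of `g_i f g_i w_T`, for a diagonal operator `f`. -/
lemma gOp_comp_gOp (T : P.Box ≃ Fin n) (i : Fin (n - 1)) (φ : (P.Box ≃ Fin n) → ℂ) :
    P.gOp q i (P.diagOp φ (P.gOp q i (P.w T))) =
      (diagCoeff q (P.word q T (lo i)) (P.word q T (hi i)) ^ 2 * φ T +
        P.stdCoeff q T i * P.stdCoeff q (swapLabel T i) i * φ (swapLabel T i)) • P.w T +
      (P.stdCoeff q T i * (diagCoeff q (P.word q T (lo i)) (P.word q T (hi i)) * φ T +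
        diagCoeff q (P.word q T (hi i)) (P.word q T (lo i)) * φ (swapLabel T i))) •
          P.w (swapLabel T i) := by
  simp only [gOp_w, map_add, map_smul, diagOp_w, word_swapLabel, swapWord_lo, swapWord_hi,
    swapLabel_swapLabel]
  module

lemma gOp_gOp_w (hq : q ≠ 0) (hD : IsContentDomain q D) {T : P.Box ≃ Fin n}
    (hT : P.IsStandard T) (i : Fin (n - 1)) :
    P.gOp q i (P.gOp q i (P.w T)) = P.w T +
      (if (P.word q T (lo i)).1 = (P.word q T (hi i)).1 then q - q⁻¹ else 0) •
        P.gOp q i (P.w T) := by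
  have hne := word_lo_ne_word_hi hD hT i
  have h := gOp_comp_gOp (q := q) T i fun _ => 1
  rw [diagOp_one, Module.End.one_apply] at h
  have hA := diagCoeff_add (q := q) hne
  have hS := diagCoeff_sq hq hne
  have hS' : diagCoeff q (P.word q T (lo i)) (P.word q T (hi i)) ^ 2 +
      swapCoeff q (P.word q T (lo i)) (P.word q T (hi i)) *
        swapCoeff q (P.word q T (hi i)) (P.word q T (lo i)) = 1 +
      (if (P.word q T (lo i)).1 = (P.word q T (hi i)).1 then q - q⁻¹ else 0) *
        diagCoeff q (P.word q T (lo i)) (P.word q T (hi i)) := by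
    rw [hS]; split_ifs <;> ring
  rw [h, gOp_w, stdCoeff_mul hq hD hT, ← hA, mul_one, mul_one, mul_one, mul_one, hS', ← hA]
  module

/-- `X_{i+1} = g_i X_i g_i` holds for the operators. -/
lemma gOp_XOp_gOp (hq : q ≠ 0) (hD : IsContentDomain q D) (i : Fin (n - 1)) :
    P.gOp q i * P.XOp q (lo i) * P.gOp q i = P.XOp q (hi i) := by
  refine hom_ext_w fun T hT => ?_
  have hne := word_lo_ne_word_hi hD hT i
  rw [Module.End.mul_apply, Module.End.mul_apply, XOp, XOp, gOp_comp_gOp, diagOp_w,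
    stdCoeff_mul hq hD hT, word_swapLabel, swapWord_lo]
  have hA := diagCoeff_add (q := q) hne
  have hS := diagCoeff_sq hq hne
  have hM := diagCoeff_mul_sub (q := q) hne
  set x := P.word q T (lo i)
  set y := P.word q T (hi i)
  have c1 : diagCoeff q x y ^ 2 * x.2 + swapCoeff q x y * swapCoeff q y x * y.2 = y.2 := by
    by_cases h : x.1 = y.1
    · rw [if_pos h] at hS hM
      linear_combination y.2 * hS - diagCoeff q x y * hM
    · rw [if_neg h] at hS
      have h0 : diagCoeff q x y = 0 := by rw [diagCoeff, if_neg h]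
      rw [h0] at hS ⊢
      linear_combination y.2 * hS
  have c2 : diagCoeff q x y * x.2 + diagCoeff q y x * y.2 = 0 := by
    by_cases h : x.1 = y.1
    · rw [if_pos h] at hA hM
      linear_combination y.2 * hA - hM
    · simp [diagCoeff, h, Ne.symm h]
  rw [c1, c2, mul_zero, zero_smul, add_zero]

lemma gOp_diagOp_comm (i : Fin (n - 1)) {φ ψ : (P.Box ≃ Fin n) → ℂ}
    (h : ∀ T, φ (swapLabel T i) = ψ T)
    (h' : ∀ T, diagCoeff q (P.word q T (lo i)) (P.word q T (hi i)) ≠ 0 → φ T = ψ T) :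
    P.gOp q i * P.diagOp ψ = P.diagOp φ * P.gOp q i := by
  refine hom_ext_w fun T _ => ?_
  rw [Module.End.mul_apply, Module.End.mul_apply, diagOp_w, map_smul, gOp_w, map_add, map_smul,
    map_smul, diagOp_w, diagOp_w, h]
  by_cases h0 : diagCoeff q (P.word q T (lo i)) (P.word q T (hi i)) = 0
  · rw [h0]
    module
  · rw [h' T h0]
    module

lemma gOp_tOp (i : Fin (n - 1)) (j : Fin n) :
    P.gOp q i * P.tOp ζ j = P.tOp ζ (Equiv.swap (lo i) (hi i) j) * P.gOp q i := by
  refine gOp_diagOp_comm i (fun T => ?_) fun T hT => ?_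
  · rw [coe_swapLabel_symm, swapWord, Function.comp_apply, Equiv.swap_apply_self]
  · have hp : (T.symm (lo i)).p = (T.symm (hi i)).p := by
      by_contra hp
      exact hT (if_neg hp)
    by_cases h1 : j = lo i
    · rw [h1, Equiv.swap_apply_left, hp]
    · by_cases h2 : j = hi i
      · rw [h2, Equiv.swap_apply_right, hp]
      · rw [Equiv.swap_apply_of_ne_of_ne h1 h2]

lemma gOp_XOp (i : Fin (n - 1)) {j : Fin n} (h1 : j ≠ lo i) (h2 : j ≠ hi i) :
    P.gOp q i * P.XOp q j = P.XOp q j * P.gOp q i := by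
  refine gOp_diagOp_comm i (fun T => ?_) fun T _ => rfl
  rw [word_swapLabel, swapWord_of_ne _ h1 h2]

lemma gOp_comm {i j : Fin (n - 1)}
    (hij : i.1 + 2 ≤ j.1 ∨ j.1 + 2 ≤ i.1) :
    P.gOp q i * P.gOp q j = P.gOp q j * P.gOp q i := by
  obtain ⟨h1, h2, h3, h4⟩ := lo_ne_of_far hij
  obtain ⟨h1', h2', h3', h4'⟩ := lo_ne_of_far hij.symm
  refine hom_ext_w fun T hT => ?_
  simp only [Module.End.mul_apply, gOp_w, map_add, map_smul, word_swapLabel,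
    swapWord_of_ne _ h1 h2, swapWord_of_ne _ h3 h4, swapWord_of_ne _ h1' h2',
    swapWord_of_ne _ h3' h4', swapLabel_comm T hij]
  -- only the coefficients of the labelling with both pairs exchanged need an argument
  have key : (P.stdCoeff q T j * P.stdCoeff q (swapLabel T j) i) • P.w (swapLabel (swapLabel T j) i)
      = (P.stdCoeff q T i * P.stdCoeff q (swapLabel T i) j) •
        P.w (swapLabel (swapLabel T j) i) := by
    by_cases hs : P.IsStandard (swapLabel (swapLabel T j) i)
    · have si : P.IsStandard (swapLabel T i) := by
        refine hT.swapLabel_of_inverted hs ?_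
        simp only [swapLabel, Equiv.trans_apply, Equiv.apply_symm_apply,
          Equiv.swap_apply_of_ne_of_ne h1' h2', Equiv.swap_apply_of_ne_of_ne h3' h4',
          Equiv.swap_apply_left, Equiv.swap_apply_right]
        simp [lo, hi, Fin.lt_def]
      have sj : P.IsStandard (swapLabel T j) := by
        rw [← swapLabel_comm T hij] at hs
        refine hT.swapLabel_of_inverted hs ?_
        simp only [swapLabel, Equiv.trans_apply, Equiv.apply_symm_apply,
          Equiv.swap_apply_of_ne_of_ne h1 h2, Equiv.swap_apply_of_ne_of_ne h3 h4,
          Equiv.swap_apply_left, Equiv.swap_apply_right]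
        simp [lo, hi, Fin.lt_def]
      simp only [stdCoeff, if_pos hT, if_pos si, if_pos sj, word_swapLabel,
        swapWord_of_ne _ h1 h2, swapWord_of_ne _ h3 h4, swapWord_of_ne _ h1' h2',
        swapWord_of_ne _ h3' h4']
      rw [mul_comm]
    · rw [w_of_not hs, smul_zero, smul_zero]
  linear_combination (norm := module) key

/-- The braid relation for the operators `g_i`. -/
lemma gOp_braid {i j : Fin (n - 1)} (hq : q ≠ 0) (hD : IsContentDomain q D)
    (hij : j.1 = i.1 + 1) :
    P.gOp q i * P.gOp q j * P.gOp q i = P.gOp q j * P.gOp q i * P.gOp q j := by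
  obtain ⟨h1, h2, h3, h4⟩ := lo_ne_lo_hi hij
  have e1 := hi_eq_lo hij
  rw [e1] at h4
  refine hom_ext_w fun T hT => ?_
  have hxy := word_lo_ne_word_hi hD hT i
  have hyz := word_lo_ne_word_hi hD hT j
  have hxz := word_lo_ne_word_hi_of_two hD hT hij
  have fxy := stdCoeff_mul hq hD hT i
  have fyz := stdCoeff_mul hq hD hT j
  rw [e1] at hxy fxy
  set a := P.word q T with ha
  have s1 : swapWord a i (lo j) = a (lo i) := by rw [← e1, swapWord_hi]
  have s2 : swapWord a i (hi j) = a (hi j) := swapWord_of_ne _ h3 (by rwa [e1])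
  have s3 : swapWord a j (lo i) = a (lo i) := swapWord_of_ne _ h1 h2
  have s4 : swapWord (swapWord a i) j (lo i) = a (lo j) := by
    rw [swapWord_of_ne _ h1 h2, swapWord_lo, e1]
  have s5 : swapWord (swapWord a j) i (hi j) = a (lo j) := by
    rw [swapWord_of_ne _ h3 (by rwa [e1]), swapWord_hi]
  have s6 : swapWord (swapWord a j) i (lo j) = a (lo i) := by
    rw [← e1, swapWord_hi, s3]
  have s7 : swapWord a i (lo i) = a (lo j) := by rw [swapWord_lo, e1]
  have s8 : swapWord (swapWord a i) j (lo j) = a (hi j) := by rw [swapWord_lo, s2]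
  -- the coefficients of the completely reversed labelling agree
  have key : (P.stdCoeff q T i * P.stdCoeff q (swapLabel T i) j *
        P.stdCoeff q (swapLabel (swapLabel T i) j) i) •
          P.w (swapLabel (swapLabel (swapLabel T j) i) j) =
      (P.stdCoeff q T j * P.stdCoeff q (swapLabel T j) i *
        P.stdCoeff q (swapLabel (swapLabel T j) i) j) •
          P.w (swapLabel (swapLabel (swapLabel T j) i) j) := by
    by_cases hs : P.IsStandard (swapLabel (swapLabel (swapLabel T j) i) j)
    · have v1 : ∀ b, swapLabel (swapLabel (swapLabel T j) i) j b =
          adjSwap j (adjSwap i (adjSwap j (T b))) := fun _ => rfl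
      have b1 : adjSwap j (adjSwap i (adjSwap j (lo i))) = hi j := by
        simp only [adjSwap, Equiv.swap_apply_of_ne_of_ne h1 h2, Equiv.swap_apply_left, e1]
      have b2 : adjSwap j (adjSwap i (adjSwap j (lo j))) = lo j := by
        simp only [adjSwap, Equiv.swap_apply_left,
          Equiv.swap_apply_of_ne_of_ne h3 (by rwa [e1] : hi j ≠ hi i), Equiv.swap_apply_right]
      have b3 : adjSwap j (adjSwap i (adjSwap j (hi j))) = lo i := by
        simp only [adjSwap, Equiv.swap_apply_right, ← e1]
        rw [e1, Equiv.swap_apply_of_ne_of_ne h1 h2]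
      have l12 : lo i < lo j := by simp only [lo, Fin.lt_def]; omega
      have l23 : lo j < hi j := by simp only [lo, hi, Fin.lt_def]; omega
      have t1 : P.IsStandard (swapLabel T i) := by
        refine hT.swapLabel_of_inverted hs ?_
        rw [v1, v1, Equiv.apply_symm_apply, Equiv.apply_symm_apply, e1, b1, b2]
        exact l23
      have t2 : P.IsStandard (swapLabel T j) := by
        refine hT.swapLabel_of_inverted hs ?_
        rw [v1, v1, Equiv.apply_symm_apply, Equiv.apply_symm_apply, b3, b2]
        exact l12
      have t12 : P.IsStandard (swapLabel (swapLabel T i) j) := by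
        refine t1.swapLabel_of_inverted hs ?_
        rw [coe_swapLabel_symm, swapWord_of_ne _ h3 (by rwa [e1]), ← e1, swapWord_hi, v1, v1,
          Equiv.apply_symm_apply, Equiv.apply_symm_apply, b1, b3]
        exact l12.trans l23
      have t21 : P.IsStandard (swapLabel (swapLabel T j) i) := by
        refine t2.swapLabel_of_inverted hs ?_
        rw [coe_swapLabel_symm, swapWord_of_ne _ h1 h2, e1, swapWord_lo, v1, v1,
          Equiv.apply_symm_apply, Equiv.apply_symm_apply, b1, b3]
        exact l12.trans l23
      simp only [stdCoeff, if_pos hT, if_pos t1, if_pos t2, if_pos t12, if_pos t21,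
        word_swapLabel, ← ha, e1, s1, s2, s3, s4, s5, s6, s8, swapWord_lo]
      congr 1
      ring
    · rw [w_of_not hs, smul_zero, smul_zero]
  have Y1 := diagCoeff_yangBaxter (q := q) hxy hyz hxz
  have Y2 := diagCoeff_yangBaxter' (q := q) hxy hyz hxz
  have A1 := diagCoeff_add (q := q) hxy
  have A2 := diagCoeff_add (q := q) hyz
  have S1' := fxy.trans (swapCoeff_mul_swapCoeff hq hxy)
  have S2' := fyz.trans (swapCoeff_mul_swapCoeff hq hyz)
  rw [← A1] at Y1
  rw [← A2] at Y2
  simp only [Module.End.mul_apply, gOp_w, map_add, map_smul, swapLabel_swapLabel, word_swapLabel,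
    ← ha, e1, s1, s2, s3, s4, s5, s6, s7, s8, swapWord_lo, swapWord_hi, swapLabel_braid T hij,
    smul_add, smul_smul]
  generalize P.w (swapLabel (swapLabel (swapLabel T j) i) j) = w3 at key ⊢
  linear_combination (norm := module) key +
    (diagCoeff q (a (lo i)) (a (lo j)) * Y1 - diagCoeff q (a (lo j)) (a (hi j)) * Y2 +
      diagCoeff q (a (lo i)) (a (hi j)) * S1' - diagCoeff q (a (lo i)) (a (hi j)) * S2') • P.w T +
    (P.stdCoeff q T i * Y1) • P.w (swapLabel T i) - (P.stdCoeff q T j * Y2) • P.w (swapLabel T j)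

end PlacedShape

end YokonumaHecke

namespace YokonumaHecke

open SkewShape

variable {r n : ℕ}

namespace PlacedShape

variable {D : Set ℂ} {P P' : PlacedShape r n D} {q ζ : ℂ}

/-! ### Existence and uniqueness of the action -/

/-- The operators by which the generators act. -/
noncomputable def genOp (P : PlacedShape r n D) (q ζ : ℂ) (hn : 0 < n) :
    Gen n → Module.End ℂ P.Space
  | Gen.t j => P.tOp ζ j
  | Gen.g i => P.gOp q i
  | Gen.X₁ => P.XOp q ⟨0, hn⟩
  | Gen.X₁inv => P.XinvOp q ⟨0, hn⟩

lemma word_snd_ne_zero (T : P.Box ≃ Fin n) (j : Fin n) : (P.word q T j).2 ≠ 0 := qpow_ne_zero _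

lemma genOp_rel (hr : 0 < r) (hn : 0 < n) (hq : q ≠ 0) (hζ : IsPrimitiveRoot ζ r)
    (hD : IsContentDomain q D) {x y : Free n} (h : Rel r n q x y) :
    FreeAlgebra.lift ℂ (P.genOp q ζ hn) x = FreeAlgebra.lift ℂ (P.genOp q ζ hn) y := by
  have lift_gen : ∀ x, FreeAlgebra.lift ℂ (P.genOp q ζ hn) (gen x) = P.genOp q ζ hn x := fun x =>
    FreeAlgebra.lift_ι_apply _ _
  cases h with
  | g_comm i j h =>
    simp only [map_mul, lift_gen, genOp]
    exact gOp_comm h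
  | g_braid i j h =>
    simp only [map_mul, lift_gen, genOp]
    exact gOp_braid hq hD h
  | t_comm i j =>
    simp only [map_mul, lift_gen, genOp]
    exact diagOp_comm _ _
  | g_t i j =>
    simp only [map_mul, lift_gen, genOp]
    exact gOp_tOp i j
  | t_pow i =>
    simp only [map_pow, map_one, lift_gen, genOp]
    rw [tOp, diagOp_pow, ← diagOp_one]
    congr 1
    funext T
    rw [← pow_mul, mul_comm, pow_mul, hζ.pow_eq_one, one_pow]
  | g_sq i =>
    simp only [map_pow, map_add, map_one, map_smul, map_mul, freeE, map_sum, lift_gen, genOp]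
    refine hom_ext_w fun T hT => ?_
    rw [pow_two, Module.End.mul_apply, gOp_gOp_w hq hD hT]
    simp only [LinearMap.add_apply, LinearMap.smul_apply, Module.End.one_apply]
    congr 1
    have ev : ∀ T' j, P.tOp ζ j • P.w T' = ζ ^ ((T'.symm j).p : ℕ) • P.w T' := fun T' j =>
      diagOp_w _ T'
    have e1 := average_smul_of_eigen hr hζ (P.tOp ζ (lo i)) (P.tOp ζ (hi i)) _ _ _
      (ev T (lo i)) (ev T (hi i))
    have e2 := average_smul_of_eigen hr hζ (P.tOp ζ (lo i)) (P.tOp ζ (hi i)) _ _ _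
      (ev (swapLabel T i) (lo i)) (ev (swapLabel T i) (hi i))
    rw [Module.End.smul_def] at e1 e2
    rw [coe_swapLabel_symm, swapWord_lo, swapWord_hi] at e2
    rw [Module.End.mul_apply, gOp_w, map_add, map_smul, map_smul, e1, e2]
    by_cases hp : (T.symm (lo i)).p = (T.symm (hi i)).p
    · rw [if_pos hp, if_pos hp.symm, if_pos (show (P.word q T (lo i)).1 = (P.word q T (hi i)).1
        from hp)]
      module
    · rw [if_neg hp, if_neg (Ne.symm hp), if_neg (show (P.word q T (lo i)).1 ≠
        (P.word q T (hi i)).1 from hp)]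
      module
  | X_inv =>
    simp only [map_mul, map_one, lift_gen, genOp]
    rw [XOp, XinvOp, diagOp_mul, ← diagOp_one]
    congr 1
    funext T
    exact mul_inv_cancel₀ (word_snd_ne_zero T _)
  | inv_X =>
    simp only [map_mul, map_one, lift_gen, genOp]
    rw [XOp, XinvOp, diagOp_mul, ← diagOp_one]
    congr 1
    funext T
    exact inv_mul_cancel₀ (word_snd_ne_zero T _)
  | g_X i h =>
    simp only [map_mul, lift_gen, genOp]
    have h0 : (⟨0, hn⟩ : Fin n) = lo i := Fin.ext h.symm
    rw [h0, gOp_XOp_gOp hq hD, mul_assoc (P.XOp q (lo i)), mul_assoc (P.XOp q (lo i)),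
      gOp_XOp_gOp hq hD]
    exact diagOp_comm _ _
  | g_X_comm i h =>
    simp only [map_mul, lift_gen, genOp]
    refine gOp_XOp i ?_ ?_
    · simp only [lo, ne_eq, Fin.mk.injEq]
      omega
    · simp [hi]
  | t_X_comm j =>
    simp only [map_mul, lift_gen, genOp]
    exact diagOp_comm _ _

/-- The action of the affine Yokonuma–Hecke algebra on the tableau space. -/
theorem exists_isTableauAction (hr : 0 < r) (hn : 0 < n) (hq : q ≠ 0) (hζ : IsPrimitiveRoot ζ r)
    (hD : IsContentDomain q D) (P : PlacedShape r n D) :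
    ∃ ρ : YHat r n q →ₐ[ℂ] Module.End ℂ P.Space, P.IsTableauAction q ζ ρ := by
  obtain ⟨ρ, hρ⟩ : ∃ ρ : YHat r n q →ₐ[ℂ] Module.End ℂ P.Space,
      ∀ x, ρ (YHat.ofGen r n q x) = P.genOp q ζ hn x :=
    ⟨RingQuot.liftAlgHom ℂ ⟨FreeAlgebra.lift ℂ (P.genOp q ζ hn),
      fun _ _ h => genOp_rel hr hn hq hζ hD h⟩, fun x =>
      (RingQuot.liftAlgHom_mkAlgHom_apply _ _ _ _).trans (FreeAlgebra.lift_ι_apply _ _)⟩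
  have hX : ∀ (k : ℕ) (hk : k < n), ρ (YHat.XAux r n q k hk) = P.XOp q ⟨k, hk⟩ := by
    intro k
    induction k with
    | zero => exact fun _ => hρ Gen.X₁
    | succ k ih =>
      intro hk
      rw [YHat.XAux, map_mul, map_mul, ih]
      have hg := hρ (Gen.g ⟨k, by omega⟩)
      rw [show ρ (YHat.g r n q ⟨k, by omega⟩) = _ from hg]
      exact gOp_XOp_gOp hq hD ⟨k, by omega⟩
  have hg : ∀ i, ρ (YHat.g r n q i) = P.gOp q i := fun i => hρ (Gen.g i)
  have ht : ∀ j, ρ (YHat.t r n q j) = P.tOp ζ j := fun j => hρ (Gen.t j)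
  refine ⟨ρ, fun T j => ?_, fun T j => ?_, fun T i h => ?_, fun T i h => ?_⟩
  · rw [ht]
    exact diagOp_w _ T.1
  · rw [show ρ (YHat.X r n q j) = P.XOp q j from hX j.1 j.2]
    exact diagOp_w _ T.1
  · have h' : (P.word q T.1 (lo i)).1 ≠ (P.word q T.1 (hi i)).1 := h
    rw [hg, gOp_w, diagCoeff, stdCoeff, if_pos T.2, swapCoeff, if_neg h', if_neg h', zero_smul,
      zero_add, one_smul]
    rfl
  · have h' : (P.word q T.1 (lo i)).1 = (P.word q T.1 (hi i)).1 := h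
    rw [hg, gOp_w, diagCoeff, stdCoeff, if_pos T.2, swapCoeff, if_pos h', if_pos h']
    rfl

section Action

variable {ρ : YHat r n q →ₐ[ℂ] Module.End ℂ P.Space} (hρ : P.IsTableauAction q ζ ρ)

include hρ

lemma IsTableauAction.g_apply {T : P.Box ≃ Fin n} (hT : P.IsStandard T) (i : Fin (n - 1)) :
    ρ (YHat.g r n q i) (P.w T) =
      diagCoeff q (P.word q T (lo i)) (P.word q T (hi i)) • P.w T +
        swapCoeff q (P.word q T (lo i)) (P.word q T (hi i)) • P.w (swapLabel T i) := by
  by_cases h : (T.symm (lo i)).p = (T.symm (hi i)).p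
  · have h' : (P.word q T (lo i)).1 = (P.word q T (hi i)).1 := h
    rw [diagCoeff, swapCoeff, if_pos h', if_pos h']
    exact hρ.g_apply_of_eq ⟨T, hT⟩ i h
  · have h' : (P.word q T (lo i)).1 ≠ (P.word q T (hi i)).1 := h
    rw [diagCoeff, swapCoeff, if_neg h', if_neg h', zero_smul, zero_add, one_smul]
    exact hρ.g_apply_of_ne ⟨T, hT⟩ i h

lemma IsTableauAction.X₁_apply (hn : 0 < n) {T : P.Box ≃ Fin n} (hT : P.IsStandard T) :
    ρ (YHat.ofGen r n q Gen.X₁) (P.w T) = (P.word q T ⟨0, hn⟩).2 • P.w T :=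
  hρ.X_apply ⟨T, hT⟩ ⟨0, hn⟩

lemma IsTableauAction.isWeightVector {T : P.Box ≃ Fin n} (hT : P.IsStandard T) :
    IsWeightVector q ζ (P.word q T) (show RepModule ρ from P.w T) := fun j =>
  ⟨hρ.t_apply ⟨T, hT⟩ j, hρ.X_apply ⟨T, hT⟩ j⟩

/-- The formulas determine the action. -/
theorem IsTableauAction.unique (hn : 0 < n) {ρ' : YHat r n q →ₐ[ℂ] Module.End ℂ P.Space}
    (hρ' : P.IsTableauAction q ζ ρ') : ρ = ρ' := by
  have hX : ρ (YHat.ofGen r n q Gen.X₁) = ρ' (YHat.ofGen r n q Gen.X₁) :=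
    hom_ext_w fun T hT => (hρ.X₁_apply hn hT).trans (hρ'.X₁_apply hn hT).symm
  refine AlgHom.ext fun a => YHat.mem_of_ofGen_mem (AlgHom.equalizer ρ ρ') (fun x => ?_) a
  cases x with
  | t j =>
    exact hom_ext_w fun T hT => (hρ.t_apply ⟨T, hT⟩ j).trans (hρ'.t_apply ⟨T, hT⟩ j).symm
  | g i => exact hom_ext_w fun T hT => (hρ.g_apply hT i).trans (hρ'.g_apply hT i).symm
  | X₁ => exact hX
  | X₁inv =>
    change ρ (YHat.ofGen r n q Gen.X₁inv) = ρ' (YHat.ofGen r n q Gen.X₁inv)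
    have h1 : ρ (YHat.ofGen r n q Gen.X₁inv) * ρ (YHat.ofGen r n q Gen.X₁) = 1 := by
      rw [← map_mul, YHat.inv_mul_X, map_one]
    have h2 : ρ' (YHat.ofGen r n q Gen.X₁) * ρ' (YHat.ofGen r n q Gen.X₁inv) = 1 := by
      rw [← map_mul, YHat.X_mul_inv, map_one]
    rw [← mul_one (ρ _), ← h2, ← mul_assoc, ← hX, h1, one_mul]

/-! ### Irreducibility -/

/-- A nonzero submodule contains a basis vector: an element of it with minimal support has only one
basis vector in its support, since the weights of the basis vectors are different. -/
lemma IsTableauAction.exists_w_mem (hζ : IsPrimitiveRoot ζ r) (hD : IsContentDomain q D)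
    (N : Submodule (YHat r n q) (RepModule ρ)) {x : P.Space} (hx : x ≠ 0)
    (hxN : (show RepModule ρ from x) ∈ N) :
    ∃ T : P.Std, (show RepModule ρ from P.w T.1) ∈ N := by
  classical
  obtain ⟨m, hm⟩ : ∃ m, x.support.card = m := ⟨_, rfl⟩
  induction m using Nat.strong_induction_on generalizing x with
  | _ m ih =>
    have hsmul : ∀ z : ℂ, ∀ y : P.Space, (show RepModule ρ from y) ∈ N →
        (show RepModule ρ from z • y) ∈ N := fun z y hy => N.smul_of_tower_mem z hy
    obtain ⟨T₀, hT₀⟩ := Finsupp.support_nonempty_iff.2 hx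
    by_cases hex : ∃ T₁ ∈ x.support, T₁ ≠ T₀
    · obtain ⟨T₁, hT₁, hne⟩ := hex
      -- an operator that kills `w_{T₀}` but not `w_{T₁}` makes the support smaller
      have key : ∀ (a : YHat r n q) (φ : (P.Box ≃ Fin n) → ℂ),
          (∀ T, P.IsStandard T → ρ a (P.w T) = φ T • P.w T) → φ T₁.1 ≠ φ T₀.1 →
          ∃ T : P.Std, (show RepModule ρ from P.w T.1) ∈ N := by
        intro a φ ha hφ
        have hc : ∀ T : P.Std, (ρ a x - φ T₀.1 • x) T = (φ T.1 - φ T₀.1) * x T := fun T => by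
          rw [Finsupp.sub_apply, apply_coord ha, Finsupp.smul_apply, smul_eq_mul, sub_mul]
        have hsub : (ρ a x - φ T₀.1 • x).support ⊆ x.support.erase T₀ := by
          intro T hT
          rw [Finsupp.mem_support_iff, hc] at hT
          rw [Finset.mem_erase, Finsupp.mem_support_iff]
          refine ⟨fun e => hT ?_, right_ne_zero_of_mul hT⟩
          rw [e, sub_self, zero_mul]
        have hlt : (ρ a x - φ T₀.1 • x).support.card < m := by
          rw [← hm]
          exact (Finset.card_le_card hsub).trans_lt (Finset.card_erase_lt_of_mem hT₀)
        refine ih _ hlt (x := ρ a x - φ T₀.1 • x) (fun h0 => ?_)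
          (N.sub_mem (N.smul_mem a hxN) (hsmul _ _ hxN)) rfl
        have := hc T₁
        rw [h0, Finsupp.zero_apply, eq_comm, mul_eq_zero, sub_eq_zero] at this
        exact this.elim hφ (Finsupp.mem_support_iff.1 hT₁)
      have hw : P.word q T₁.1 ≠ P.word q T₀.1 := fun h =>
        hne (Subtype.ext (eq_of_word_eq hD T₁.2 T₀.2 h))
      obtain ⟨j, hj⟩ := Function.ne_iff.1 hw
      by_cases hp : (P.word q T₁.1 j).1 = (P.word q T₀.1 j).1
      · exact key (YHat.X r n q j) (fun T => (P.word q T j).2)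
          (fun T hT => hρ.X_apply ⟨T, hT⟩ j) fun h => hj (Prod.ext hp h)
      · refine key (YHat.t r n q j) (fun T => ζ ^ ((P.word q T j).1 : ℕ))
          (fun T hT => hρ.t_apply ⟨T, hT⟩ j) fun h => hp (Fin.ext ?_)
        exact hζ.pow_inj (Fin.is_lt _) (Fin.is_lt _) h
    · push Not at hex
      refine ⟨T₀, ?_⟩
      have hx' : P.w T₀.1 = (x T₀)⁻¹ • x := by
        ext T
        rw [Finsupp.smul_apply, smul_eq_mul]
        by_cases hT : T₀ = T
        · subst hT
          rw [w_apply_self, inv_mul_cancel₀ (Finsupp.mem_support_iff.1 hT₀)]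
        · rw [w_apply_of_ne hT]
          have : x T = 0 := by
            by_contra h
            exact hT (hex T (Finsupp.mem_support_iff.2 h)).symm
          rw [this, mul_zero]
      rw [hx']
      exact hsmul _ _ hxN

/-- The module is irreducible: if `w_T` lies in a submodule and `s_i T` is standard, then so does
`w_{s_i T}`, as its coefficient in `g_i w_T` is not zero. -/
theorem IsTableauAction.isSimpleModule (hq : q ≠ 0) (hζ : IsPrimitiveRoot ζ r)
    (hD : IsContentDomain q D) : IsSimpleModule (YHat r n q) (RepModule ρ) := by
  obtain ⟨T₀⟩ := nonempty_std P.toSkewShape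
  have hnt : Nontrivial (RepModule ρ) := ⟨⟨P.w T₀.1, 0, w_ne_zero T₀⟩⟩
  rw [isSimpleModule_iff]
  refine { exists_pair_ne := ⟨⊥, ⊤, bot_ne_top⟩, eq_bot_or_eq_top := fun N => ?_ }
  by_cases hN : N = ⊥
  · exact Or.inl hN
  · right
    obtain ⟨x, hxN, hx⟩ := N.ne_bot_iff.1 hN
    obtain ⟨T₁, hT₁⟩ := hρ.exists_w_mem hζ hD N hx hxN
    have hsmul : ∀ z : ℂ, ∀ y : P.Space, (show RepModule ρ from y) ∈ N →
        (show RepModule ρ from z • y) ∈ N := fun z y hy => N.smul_of_tower_mem z hy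
    have hall : ∀ T, P.IsStandard T → (show RepModule ρ from P.w T) ∈ N := by
      refine IsStandard.induction (P := fun T => (show RepModule ρ from P.w T) ∈ N) T₁.2 hT₁ ?_
      intro T i hT hs hmem
      have hg := hρ.g_apply hs i
      rw [swapLabel_swapLabel, word_swapLabel, swapWord_lo, swapWord_hi] at hg
      have hne := right_ne_zero_of_mul ((swapLabel_isStandard_iff hq hD hT i).1 hs)
      have : P.w T = (swapCoeff q (P.word q T (hi i)) (P.word q T (lo i)))⁻¹ •
          (ρ (YHat.g r n q i) (P.w (swapLabel T i)) -
            diagCoeff q (P.word q T (hi i)) (P.word q T (lo i)) • P.w (swapLabel T i)) := by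
        rw [hg, add_sub_cancel_left, smul_smul, inv_mul_cancel₀ hne, one_smul]
      rw [this]
      exact hsmul _ _ (N.sub_mem (N.smul_mem _ hmem) (hsmul _ _ hmem))
    rw [eq_top_iff]
    intro y _
    let N' : Submodule ℂ P.Space :=
      { carrier := {y | (show RepModule ρ from y) ∈ N}
        add_mem' := fun ha hb => N.add_mem ha hb
        zero_mem' := N.zero_mem
        smul_mem' := fun z y hy => hsmul z y hy }
    have hy : N'.mkQ = 0 := hom_ext_w fun T hT => by
      rw [LinearMap.zero_apply, Submodule.mkQ_apply, Submodule.Quotient.mk_eq_zero]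
      exact hall T hT
    have := congrArg (fun f : P.Space →ₗ[ℂ] P.Space ⧸ N' => f y) hy
    exact (Submodule.Quotient.mk_eq_zero N').1 this

theorem IsTableauAction.isCalibrated : IsCalibrated r n q ζ (RepModule ρ) := by
  obtain ⟨T₀⟩ := nonempty_std P.toSkewShape
  have hfin : Finite P.Std := by
    refine Finite.of_injective (β := Equiv.Perm (Fin n)) (fun T => T₀.1.symm.trans T.1) ?_
    intro T T' h
    refine Subtype.ext (Equiv.ext fun b => ?_)
    have := congrArg (fun w : Equiv.Perm (Fin n) => w (T₀.1 b)) h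
    simpa using this
  let b : Module.Basis P.Std ℂ (RepModule ρ) :=
    (Finsupp.basisSingleOne : Module.Basis P.Std ℂ P.Space)
  have hf : Module.Finite ℂ (RepModule ρ) := Module.Finite.of_basis b
  let _ : Fintype P.Std := Fintype.ofFinite _
  refine ⟨hf, b.reindex (Fintype.equivFinOfCardEq (Module.finrank_eq_card_basis b).symm), ?_⟩
  intro k j
  rw [Module.Basis.reindex_apply]
  set T := (Fintype.equivFinOfCardEq (Module.finrank_eq_card_basis b).symm).symm k
  have hb : b T = P.w T.1 := (w_coe T).symm
  rw [hb]
  exact ⟨⟨_, word_snd_ne_zero (q := q) T.1 j, hρ.X_apply T j⟩, ⟨_, hρ.t_apply T j⟩⟩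

/-! ### Isomorphic tableau modules -/

/-- A vector of weight `a` has only basis vectors of weight `a` in its support. -/
lemma IsTableauAction.word_eq_of_isWeightVector (hζ : IsPrimitiveRoot ζ r)
    {a : Fin n → Fin r × ℂ} {x : P.Space} (hx : IsWeightVector q ζ a (show RepModule ρ from x))
    {T : P.Std} (hT : x T ≠ 0) : P.word q T.1 = a := by
  funext j
  obtain ⟨h1, h2⟩ := hx j
  refine Prod.ext (Fin.ext (hζ.pow_inj (Fin.is_lt _) (Fin.is_lt _) (mul_right_cancel₀ hT ?_)))
    (mul_right_cancel₀ hT ?_)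
  · have := congrArg (fun y : P.Space => y T) h1
    exact (apply_coord (f := ρ (YHat.t r n q j)) (φ := fun T => ζ ^ ((P.word q T j).1 : ℕ))
      (fun T hT => hρ.t_apply ⟨T, hT⟩ j) x T).symm.trans this
  · have := congrArg (fun y : P.Space => y T) h2
    exact (apply_coord (f := ρ (YHat.X r n q j)) (φ := fun T => (P.word q T j).2)
      (fun T hT => hρ.X_apply ⟨T, hT⟩ j) x T).symm.trans this

/-- An isomorphism maps `w_T` to a vector of the same weight, so that both shapes have a standard
tableau of this weight. -/
theorem IsTableauAction.nonempty_equiv_iff (hn : 0 < n) (hζ : IsPrimitiveRoot ζ r)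
    (hD : IsContentDomain q D) {ρ' : YHat r n q →ₐ[ℂ] Module.End ℂ P'.Space}
    (hρ' : P'.IsTableauAction q ζ ρ') :
    Nonempty (RepModule ρ ≃ₗ[YHat r n q] RepModule ρ') ↔ P.Equivalent P' := by
  constructor
  · rintro ⟨f⟩
    obtain ⟨T⟩ := nonempty_std P.toSkewShape
    set y : P'.Space := f (show RepModule ρ from P.w T.1) with hy
    have hy0 : y ≠ 0 := fun h => w_ne_zero T (f.map_eq_zero_iff.1 h)
    have hfs : ∀ (z : ℂ) (m : RepModule ρ), f (z • m) = z • f m := fun z m => by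
      rw [← algebraMap_smul (YHat r n q) z m, map_smul, algebraMap_smul]
    have hw : IsWeightVector q ζ (P.word q T.1) (show RepModule ρ' from y) := by
      intro j
      obtain ⟨h1, h2⟩ := hρ.isWeightVector T.2 j
      exact ⟨(map_smul f _ _).symm.trans ((congrArg f h1).trans (hfs _ _)),
        (map_smul f _ _).symm.trans ((congrArg f h2).trans (hfs _ _))⟩
    obtain ⟨T', hT'⟩ := Finsupp.support_nonempty_iff.2 hy0
    have := hρ'.word_eq_of_isWeightVector hζ hw (Finsupp.mem_support_iff.1 hT')
    exact equivalent_of_word_eq hD T.2 T'.2 this.symm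
  · rintro ⟨φ, hp, hc, h1, h2⟩
    let tr : (P.Box ≃ Fin n) → (P'.Box ≃ Fin n) := fun T => φ.symm.trans T
    have htr : ∀ T, P'.IsStandard (tr T) ↔ P.IsStandard T := fun T => isStandard_transport h1 h2
    let e : P.Std ≃ P'.Std :=
      { toFun := fun T => ⟨tr T.1, (htr T.1).2 T.2⟩
        invFun := fun T' => ⟨φ.trans T'.1, (htr _).1 (by
          have : tr (φ.trans T'.1) = T'.1 := by ext b; simp [tr]
          rw [this]; exact T'.2)⟩
        left_inv := fun T => Subtype.ext (by ext b; simp [tr])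
        right_inv := fun T' => Subtype.ext (by ext b; simp [tr]) }
    let F : P.Space ≃ₗ[ℂ] P'.Space := Finsupp.domLCongr e
    have hF : ∀ T, F (P.w T) = P'.w (tr T) := by
      intro T
      by_cases h : P.IsStandard T
      · have a1 : P.w T = Finsupp.single (⟨T, h⟩ : P.Std) 1 := w_coe (S := P.toSkewShape) ⟨T, h⟩
        have a2 : P'.w (tr T) = Finsupp.single (e ⟨T, h⟩) 1 := 
          w_coe (S := P'.toSkewShape) ⟨tr T, (htr T).2 h⟩
        rw [a1, a2]
        exact Finsupp.domLCongr_single _ _ _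
      · rw [w_of_not h, w_of_not fun h' => h ((htr T).1 h'), map_zero]
    have hword : ∀ T, P'.word q (tr T) = P.word q T := by
      intro T
      funext j
      exact Prod.ext (hp _) (congrArg (qpow q) (hc _))
    have hgen : ∀ (a : YHat r n q), (∀ T, P.IsStandard T →
        F (ρ a (P.w T)) = ρ' a (F (P.w T))) → ∀ x : P.Space, F (ρ a x) = ρ' a (F x) := by
      intro a ha x
      have : F.toLinearMap ∘ₗ ρ a = ρ' a ∘ₗ F.toLinearMap := hom_ext_w ha
      exact congrArg (fun f : P.Space →ₗ[ℂ] P'.Space => f x) this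
    let G : RepModule ρ →ₗ[ℂ] RepModule ρ' := F.toLinearMap
    have hG : ∀ (a : YHat r n q) (m : RepModule ρ), G (a • m) = a • G m := by
      refine map_smul_of_generators G (fun j m => ?_) (fun i m => ?_) (fun m => ?_)
      · refine hgen (YHat.t r n q j) (fun T hT => ?_) m
        have a1 := hρ.t_apply ⟨T, hT⟩ j
        have a2 := hρ'.t_apply ⟨tr T, (htr T).2 hT⟩ j
        have a3 := congrArg Prod.fst (congrFun (hword T) j)
        simp only at a1 a2
        rw [a1, map_smul, hF, a2]
        exact congrArg (fun k : Fin r => ζ ^ (k : ℕ) • P'.w (tr T)) a3.symm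
      · refine hgen (YHat.g r n q i) (fun T hT => ?_) m
        rw [hρ.g_apply hT, map_add, map_smul, map_smul, hF, hF, hρ'.g_apply ((htr T).2 hT), hword]
        rfl
      · refine hgen (YHat.ofGen r n q Gen.X₁) (fun T hT => ?_) m
        rw [hρ.X₁_apply hn hT, map_smul, hF, hρ'.X₁_apply hn ((htr T).2 hT), hword]
    exact ⟨{ F with map_smul' := hG }⟩

end Action

end PlacedShape

end YokonumaHecke

namespace YokonumaHecke

variable {r n : ℕ}

/-! ### Weight vectors in calibrated modules -/

section Calibrated

variable {q ζ : ℂ} {M : Type*} [AddCommGroup M] [Module ℂ M] [Module (YHat r n q) M]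

/-- A basis of weight vectors with nonzero eigenvalues of the `X_j`; `A k` is the weight of the
basis vector `b k`. -/
structure IsWeightBasis {κ : Type*} (q ζ : ℂ) [Module (YHat r n q) M] (b : Module.Basis κ ℂ M)
    (A : κ → Fin n → Fin r × ℂ) : Prop where
  isWeightVector : ∀ k, IsWeightVector q ζ (A k) (b k)
  snd_ne_zero : ∀ k j, (A k j).2 ≠ 0

lemma IsCalibrated.exists_weightBasis (h : IsCalibrated r n q ζ M) :
    ∃ (b : Module.Basis (Fin (Module.finrank ℂ M)) ℂ M)
      (A : Fin (Module.finrank ℂ M) → Fin n → Fin r × ℂ), IsWeightBasis q ζ b A := by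
  obtain ⟨-, b, hb⟩ := h
  choose hX ht using hb
  choose ν hν0 hν using hX
  choose p hp using ht
  exact ⟨b, fun k j => (p k j, ν k j), fun k j => ⟨hp k j, hν k j⟩, hν0⟩

/-- The letters of a weight at consecutive places are different. Calibrated modules have this
property, and it makes the intertwiners well behaved on all weight vectors. -/
def HasRegularWeights (q ζ : ℂ) (M : Type*) [AddCommGroup M] [Module ℂ M]
    [Module (YHat r n q) M] : Prop :=
  ∀ (a : Fin n → Fin r × ℂ) (m : M), IsWeightVector q ζ a m → m ≠ 0 →
    ∀ i : Fin (n - 1), a (lo i) ≠ a (hi i)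

variable [IsScalarTower ℂ (YHat r n q) M]

section WeightBasis

variable {κ : Type*} {b : Module.Basis κ ℂ M} {A : κ → Fin n → Fin r × ℂ}

lemma repr_smul_of_eigen {x : YHat r n q} {φ : κ → ℂ} (h : ∀ k, x • b k = φ k • b k) (m : M)
    (k : κ) : b.repr (x • m) k = φ k * b.repr m k := by
  have : b.coord k ∘ₗ (Algebra.lsmul ℂ ℂ M x) = φ k • b.coord k := by
    refine b.ext fun l => ?_
    simp only [LinearMap.comp_apply, Algebra.lsmul_coe, h, map_smul, LinearMap.smul_apply,
      Module.Basis.coord_apply, Module.Basis.repr_self, smul_eq_mul]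
    by_cases hl : l = k
    · rw [hl]
    · rw [Finsupp.single_eq_of_ne (Ne.symm hl), mul_zero, mul_zero]
  exact congrArg (fun f : M →ₗ[ℂ] ℂ => f m) this

variable (hA : IsWeightBasis q ζ b A)

include hA

lemma IsWeightBasis.weight_eq (hζ : IsPrimitiveRoot ζ r) {a : Fin n → Fin r × ℂ} {m : M}
    (hm : IsWeightVector q ζ a m) {k : κ} (hk : b.repr m k ≠ 0) : A k = a := by
  funext j
  have h1 := repr_smul_of_eigen (fun k => (hA.isWeightVector k j).1) m k
  have h2 := repr_smul_of_eigen (fun k => (hA.isWeightVector k j).2) m k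
  rw [(hm j).1, map_smul, Finsupp.smul_apply, smul_eq_mul] at h1
  rw [(hm j).2, map_smul, Finsupp.smul_apply, smul_eq_mul] at h2
  exact Prod.ext (Fin.ext (hζ.pow_inj (Fin.is_lt _) (Fin.is_lt _)
    (mul_right_cancel₀ hk h1.symm))) (mul_right_cancel₀ hk h2.symm)

omit [IsScalarTower ℂ (YHat r n q) M] hA in
lemma exists_repr_ne_zero {m : M} (hm : m ≠ 0) : ∃ k, b.repr m k ≠ 0 := by
  by_contra! h
  exact hm (b.repr.map_eq_zero_iff.1 (Finsupp.ext h))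

/-- If two consecutive letters were equal, then `X_i` would not be diagonalizable on the span of
`m` and `g_i m`. -/
lemma IsWeightBasis.hasRegularWeights (hr : 0 < r) (hζ : IsPrimitiveRoot ζ r)
    (hQ : q - q⁻¹ ≠ 0) : HasRegularWeights (r := r) (n := n) q ζ M := by
  intro a m hm h0 i heq
  obtain ⟨k, hk⟩ := exists_repr_ne_zero (b := b) h0
  have hAk := hA.weight_eq hζ hm hk
  have h1 := repr_smul_of_eigen (fun k => (hA.isWeightVector k (lo i)).2) (YHat.g r n q i • m) k
  rw [hm.X_lo_smul_g hr hζ] at h1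
  generalize YHat.g r n q i • m = m' at h1
  rw [heq, if_pos rfl, map_sub, map_smul, map_smul, Finsupp.sub_apply,
    Finsupp.smul_apply, Finsupp.smul_apply, smul_eq_mul, smul_eq_mul, hAk, heq] at h1
  have h2 : (q - q⁻¹) * (a (hi i)).2 * b.repr m k = 0 := by linear_combination -h1
  have h3 : (a (hi i)).2 ≠ 0 := by
    rw [← hAk]
    exact hA.snd_ne_zero k _
  exact mul_ne_zero (mul_ne_zero hQ h3) hk h2

/-- A weight vector in the span of a family of weight vectors shares its weight with a nonzero
member of the family. -/
lemma IsWeightBasis.exists_of_mem_span (hζ : IsPrimitiveRoot ζ r) {ι : Type*} {u : ι → M}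
    {c : ι → Fin n → Fin r × ℂ} (hu : ∀ x, IsWeightVector q ζ (c x) (u x))
    {a : Fin n → Fin r × ℂ} {m : M} (hm : IsWeightVector q ζ a m) (h0 : m ≠ 0)
    (hmem : m ∈ Submodule.span ℂ (Set.range u)) : ∃ x, u x ≠ 0 ∧ c x = a := by
  obtain ⟨k, hk⟩ := exists_repr_ne_zero (b := b) h0
  by_contra! hc
  refine hk ?_
  have hle : Submodule.span ℂ (Set.range u) ≤ LinearMap.ker (b.coord k) := by
    rw [Submodule.span_le]
    rintro _ ⟨x, rfl⟩
    by_contra hne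
    have hne' : b.repr (u x) k ≠ 0 := hne
    refine hc x (fun e => hne' (by rw [e, map_zero]; rfl)) ?_
    rw [← hA.weight_eq hζ (hu x) hne', hA.weight_eq hζ hm hk]
  exact hle hmem

end WeightBasis

/-! ### Families of weight vectors generated by intertwiners -/

section Families

variable (hreg : HasRegularWeights (r := r) (n := n) q ζ M)

include hreg

lemma HasRegularWeights.intertwiner (hr : 0 < r) (hζ : IsPrimitiveRoot ζ r)
    {a : Fin n → Fin r × ℂ} {m : M} (h : IsWeightVector q ζ a m) (i : Fin (n - 1)) :
    IsWeightVector q ζ (swapWord a i) (intertwiner q i a m) := by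
  by_cases h0 : m = 0
  · rw [h0, intertwiner_zero]
    exact IsWeightVector.zero
  · exact h.intertwiner hr hζ (hreg a m h h0 i)

lemma HasRegularWeights.intertwiner_intertwiner (hq : q ≠ 0) (hr : 0 < r)
    (hζ : IsPrimitiveRoot ζ r) {a : Fin n → Fin r × ℂ} {m : M} (h : IsWeightVector q ζ a m)
    (i : Fin (n - 1)) :
    YokonumaHecke.intertwiner q i (swapWord a i) (YokonumaHecke.intertwiner q i a m) =
      (swapCoeff q (a (lo i)) (a (hi i)) * swapCoeff q (a (hi i)) (a (lo i))) • m := by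
  by_cases h0 : m = 0
  · rw [h0, intertwiner_zero, intertwiner_zero, smul_zero]
  · exact h.intertwiner_intertwiner hq hr hζ (hreg a m h h0 i)

/-- The braid relation for the intertwiners. If the outer letters `x` and `z` agree, then both sides
vanish, as they pass through weights with equal neighbouring letters. -/
lemma HasRegularWeights.intertwiner_braid (hr : 0 < r) (hζ : IsPrimitiveRoot ζ r)
    {a : Fin n → Fin r × ℂ} {m : M} (h : IsWeightVector q ζ a m) {i j : Fin (n - 1)}
    (hij : j.1 = i.1 + 1) :
    YokonumaHecke.intertwiner q i (swapWord (swapWord a i) j)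
        (YokonumaHecke.intertwiner q j (swapWord a i) (YokonumaHecke.intertwiner q i a m)) =
      YokonumaHecke.intertwiner q j (swapWord (swapWord a j) i)
        (YokonumaHecke.intertwiner q i (swapWord a j) (YokonumaHecke.intertwiner q j a m)) := by
  obtain ⟨h1, h2, h3, h4⟩ := lo_ne_lo_hi hij
  have e1 := hi_eq_lo hij
  by_cases h0 : m = 0
  · simp only [h0, intertwiner_zero]
  by_cases hxz : a (lo i) = a (hi j)
  · have z1 : YokonumaHecke.intertwiner q i a m = 0 := by
      by_contra hc
      refine hreg _ _ (hreg.intertwiner hr hζ h i) hc j ?_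
      rw [← e1, swapWord_hi, swapWord_of_ne _ h3 h4, hxz]
    have z2 : YokonumaHecke.intertwiner q j a m = 0 := by
      by_contra hc
      refine hreg _ _ (hreg.intertwiner hr hζ h j) hc i ?_
      rw [e1, swapWord_lo, swapWord_of_ne _ h1 h2, hxz]
    simp only [z1, z2, intertwiner_zero]
  · refine h.intertwiner_braid hr hζ hij ?_ (hreg a m h h0 j) hxz
    rw [← e1]
    exact hreg a m h h0 i

/-- The vectors that arise from a weight vector by the intertwiners, rescaled by a function `κ` of
the exchanged letters, form a family indexed by the permutations. -/
theorem HasRegularWeights.exists_family (hr : 0 < r) (hζ : IsPrimitiveRoot ζ r)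
    (κ : Fin r × ℂ → Fin r × ℂ → ℂ) {a : Fin n → Fin r × ℂ} {m : M} (h : IsWeightVector q ζ a m) :
    ∃ u : Equiv.Perm (Fin n) → M, u 1 = m ∧
      (∀ w : Equiv.Perm (Fin n), IsWeightVector q ζ (a ∘ w) (u w)) ∧
      ∀ (w : Equiv.Perm (Fin n)) (i : Fin (n - 1)), w (lo i) < w (hi i) → u (w * adjSwap i) =
        κ (a (w (lo i))) (a (w (hi i))) • YokonumaHecke.intertwiner q i (a ∘ w) (u w) := by
  let S := {s : (Fin n → Fin r × ℂ) × M // IsWeightVector q ζ s.1 s.2}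
  let f : Fin (n - 1) → S → S := fun i s =>
    ⟨(swapWord s.1.1 i, κ (s.1.1 (lo i)) (s.1.1 (hi i)) •
      YokonumaHecke.intertwiner q i s.1.1 s.1.2), (hreg.intertwiner hr hζ s.2 i).smul _⟩
  obtain ⟨u, hu1, hu⟩ := exists_matsumoto_family f ⟨(a, m), h⟩
    (by
      rintro i j hij ⟨⟨c, x⟩, hx⟩
      obtain ⟨h1, h2, h3, h4⟩ := lo_ne_of_far hij
      obtain ⟨h1', h2', h3', h4'⟩ := lo_ne_of_far hij.symm
      refine Subtype.ext (Prod.ext ?_ ?_)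
      · have := congrArg (fun w : Equiv.Perm (Fin n) => c ∘ w) (adjSwap_comm hij.symm)
        exact this
      · simp only [f, intertwiner_smul, smul_smul, swapWord_of_ne _ h1 h2, swapWord_of_ne _ h3 h4,
          swapWord_of_ne _ h1' h2', swapWord_of_ne _ h3' h4']
        rw [intertwiner_comm c x hij, mul_comm])
    (by
      rintro i j hij ⟨⟨c, x⟩, hx⟩
      obtain ⟨h1, h2, h3, h4⟩ := lo_ne_lo_hi hij
      have e1 := hi_eq_lo hij
      refine Subtype.ext (Prod.ext ?_ ?_)
      · have := congrArg (fun w : Equiv.Perm (Fin n) => c ∘ w) (adjSwap_braid hij)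
        exact this
      · have s1 : swapWord c i (lo j) = c (lo i) := by rw [← e1, swapWord_hi]
        have s2 : swapWord c i (hi j) = c (hi j) := swapWord_of_ne _ h3 h4
        have s3 : swapWord c j (lo i) = c (lo i) := swapWord_of_ne _ h1 h2
        have s4 : swapWord (swapWord c i) j (lo i) = c (lo j) := by
          rw [swapWord_of_ne _ h1 h2, swapWord_lo, e1]
        have s5 : swapWord (swapWord c j) i (hi j) = c (lo j) := by
          rw [swapWord_of_ne _ h3 h4, swapWord_hi]
        have s6 : swapWord (swapWord c j) i (lo j) = c (lo i) := by
          rw [← e1, swapWord_hi, s3]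
        simp only [f, intertwiner_smul, smul_smul]
        rw [hreg.intertwiner_braid hr hζ hx hij]
        simp only [e1, s1, s2, s3, s4, s5, s6, swapWord_lo]
        congr 1
        ring)
  have hword : ∀ w, (u w).1.1 = a ∘ w := by
    intro w
    induction w using descent_induction with
    | one => rw [hu1]; rfl
    | step w i hi' ih =>
      have := hu (w * adjSwap i) i (by
        simpa only [coe_mul_adjSwap, swapWord_lo, swapWord_hi] using hi')
      rw [mul_adjSwap_mul_adjSwap] at this
      rw [this]
      change swapWord (u (w * adjSwap i)).1.1 i = a ∘ w
      rw [ih]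
      exact swapWord_swapWord (a ∘ w) i
  refine ⟨fun w => (u w).1.2, by simp only [hu1], fun w => ?_, fun w i hi' => ?_⟩
  · rw [← hword]
    exact (u w).2
  · simp only [hu w i hi', f, hword, Function.comp_apply]

end Families

/-- A subspace that is stable under the generators is stable under the algebra. -/
lemma smul_mem_of_generators {N : Submodule ℂ M}
    (h : ∀ x, ∀ m ∈ N, YHat.ofGen r n q x • m ∈ N) (a : YHat r n q) {m : M} (hm : m ∈ N) :
    a • m ∈ N := by
  let S : Subalgebra ℂ (YHat r n q) :=
    { carrier := {a | ∀ m ∈ N, a • m ∈ N}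
      mul_mem' := fun {a b} ha hb m hm => by rw [mul_smul]; exact ha _ (hb _ hm)
      add_mem' := fun {a b} ha hb m hm => by rw [add_smul]; exact N.add_mem (ha _ hm) (hb _ hm)
      algebraMap_mem' := fun z m hm => by rw [algebraMap_smul]; exact N.smul_mem z hm }
  exact YHat.mem_of_ofGen_mem S h a m hm

section Simple

variable (hreg : HasRegularWeights (r := r) (n := n) q ζ M)
  (hM : IsSimpleModule (YHat r n q) M)

include hreg hM

/-- In an irreducible module the family generated by the intertwiners from a nonzero weight vector
spans. -/
theorem HasRegularWeights.mem_span_family (hn : 0 < n) (hq : q ≠ 0) (hr : 0 < r)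
    (hζ : IsPrimitiveRoot ζ r) {a : Fin n → Fin r × ℂ} {u : Equiv.Perm (Fin n) → M} (h1 : u 1 ≠ 0)
    (hu : ∀ w : Equiv.Perm (Fin n), IsWeightVector q ζ (a ∘ w) (u w))
    (hstep : ∀ (w : Equiv.Perm (Fin n)) (i : Fin (n - 1)), w (lo i) < w (hi i) →
      u (w * adjSwap i) = YokonumaHecke.intertwiner q i (a ∘ w) (u w)) (m : M) :
    m ∈ Submodule.span ℂ (Set.range u) := by
  set N := Submodule.span ℂ (Set.range u) with hN
  have humem : ∀ w, u w ∈ N := fun w => Submodule.subset_span ⟨w, rfl⟩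
  have hτ : ∀ (w : Equiv.Perm (Fin n)) (i : Fin (n - 1)),
      YokonumaHecke.intertwiner q i (a ∘ w) (u w) ∈ N := by
    intro w i
    rcases lt_or_gt_of_ne (fun e => lo_ne_hi i (w.injective e)) with hlt | hgt
    · rw [← hstep w i hlt]
      exact humem _
    · have h2 := hstep (w * adjSwap i) i (by
        simpa only [coe_mul_adjSwap, swapWord_lo, swapWord_hi] using hgt)
      rw [mul_adjSwap_mul_adjSwap] at h2
      have h3 := hreg.intertwiner_intertwiner hq hr hζ (hu (w * adjSwap i)) i
      rw [show swapWord (a ∘ ⇑(w * adjSwap i)) i = a ∘ w from swapWord_swapWord (a ∘ w) i,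
        ← h2] at h3
      rw [h3]
      exact N.smul_mem _ (humem _)
  have hgen : ∀ x, ∀ m ∈ N, YHat.ofGen r n q x • m ∈ N := by
    intro x m hm
    induction hm using Submodule.span_induction with
    | zero => rw [smul_zero]; exact N.zero_mem
    | add m m' _ _ hm hm' => rw [smul_add]; exact N.add_mem hm hm'
    | smul z m _ hm => rw [YHat.smul_scalar_smul]; exact N.smul_mem z hm
    | mem m hm =>
      obtain ⟨w, rfl⟩ := hm
      have hX := (hu w ⟨0, hn⟩).2
      rw [YHat.X_zero] at hX
      cases x with
      | t j =>
        rw [show YHat.ofGen r n q (Gen.t j) • u w = _ from (hu w j).1]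
        exact N.smul_mem _ (humem w)
      | g i =>
        have h2 := N.add_mem (hτ w i) (N.smul_mem
          (diagCoeff q ((a ∘ w) (lo i)) ((a ∘ w) (hi i))) (humem w))
        rwa [YokonumaHecke.intertwiner, sub_add_cancel] at h2
      | X₁ =>
        rw [hX]
        exact N.smul_mem _ (humem w)
      | X₁inv =>
        have h2 : u w = ((a ∘ w) ⟨0, hn⟩).2 • YHat.ofGen r n q Gen.X₁inv • u w := by
          rw [← YHat.smul_scalar_smul, ← hX, ← mul_smul, YHat.inv_mul_X, one_smul]
        by_cases h0 : ((a ∘ w) ⟨0, hn⟩).2 = 0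
        · rw [h0, zero_smul] at h2
          rw [h2, smul_zero]
          exact N.zero_mem
        · rw [← inv_smul_eq_iff₀ h0] at h2
          rw [← h2]
          exact N.smul_mem _ (humem w)
  let N' : Submodule (YHat r n q) M :=
    { carrier := N
      add_mem' := N.add_mem
      zero_mem' := N.zero_mem
      smul_mem' := fun a _ hm => smul_mem_of_generators hgen a hm }
  have hne : N' ≠ ⊥ := fun h => h1 ((Submodule.eq_bot_iff N').1 h (u 1) (humem 1))
  have htop : N' = ⊤ := (eq_bot_or_eq_top N').resolve_left hne
  have : m ∈ N' := by rw [htop]; exact Submodule.mem_top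
  exact this

omit hM [IsScalarTower ℂ (YHat r n q) M] in
/-- Equal letters do not cross: the vector `u w` vanishes if `w` inverts two equal letters, since
they have to become neighbours first. -/
lemma HasRegularWeights.family_eq_zero_of_inverted {a : Fin n → Fin r × ℂ}
    {u : Equiv.Perm (Fin n) → M} (hu : ∀ w : Equiv.Perm (Fin n), IsWeightVector q ζ (a ∘ w) (u w))
    (hstep : ∀ (w : Equiv.Perm (Fin n)) (i : Fin (n - 1)), w (lo i) < w (hi i) →
      u (w * adjSwap i) = YokonumaHecke.intertwiner q i (a ∘ w) (u w)) (w : Equiv.Perm (Fin n)) :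
    ∀ k l, k < l → w l < w k → a (w k) = a (w l) → u w = 0 := by
  induction w using descent_induction with
  | one => exact fun k l h1 h2 _ => absurd h1 (lt_asymm h2)
  | step w i hi' ih =>
    intro k l hkl hw ha
    have h2 := hstep (w * adjSwap i) i (by
      simpa only [coe_mul_adjSwap, swapWord_lo, swapWord_hi] using hi')
    rw [mul_adjSwap_mul_adjSwap] at h2
    have h0 : u (w * adjSwap i) = 0 := by
      by_cases hc : k = lo i ∧ l = hi i
      · obtain ⟨rfl, rfl⟩ := hc
        by_contra h0
        refine hreg _ _ (hu (w * adjSwap i)) h0 i ?_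
        simp only [Function.comp_apply, coe_mul_adjSwap, swapWord_lo, swapWord_hi, ha]
      · refine ih (Equiv.swap (lo i) (hi i) k) (Equiv.swap (lo i) (hi i) l)
          (swap_lt_swap hkl hc) ?_ ?_
        · simpa only [coe_mul_adjSwap, swapWord, Function.comp_apply, Equiv.swap_apply_self] using hw
        · simpa only [coe_mul_adjSwap, swapWord, Function.comp_apply, Equiv.swap_apply_self] using ha
    rw [h2, h0, intertwiner_zero]

/-- In an irreducible calibrated module the intertwiner `τ_i` vanishes on the vectors of a weight
for which `τ_i²` does. Otherwise `v` could be recovered from `v' = τ_i v` by a sequence of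
intertwiners; as equal letters do not cross, this sequence belongs to `s_i`, so that `v` would be a
multiple of `τ_i v' = 0`. -/
theorem HasRegularWeights.intertwiner_eq_zero {κ : Type*} {b : Module.Basis κ ℂ M}
    {A : κ → Fin n → Fin r × ℂ} (hA : IsWeightBasis q ζ b A) (hn : 0 < n) (hq : q ≠ 0)
    (hr : 0 < r) (hζ : IsPrimitiveRoot ζ r) {a : Fin n → Fin r × ℂ} {v : M}
    (hv : IsWeightVector q ζ a v) {i : Fin (n - 1)}
    (hz : swapCoeff q (a (lo i)) (a (hi i)) * swapCoeff q (a (hi i)) (a (lo i)) = 0) :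
    YokonumaHecke.intertwiner q i a v = 0 := by
  by_contra hne
  have hv0 : v ≠ 0 := fun h => hne (by rw [h, intertwiner_zero])
  obtain ⟨u, hu1, hu, hstep⟩ := hreg.exists_family hr hζ (fun _ _ => 1)
    (hreg.intertwiner hr hζ hv i)
  simp only [one_smul] at hstep
  have hspan := hreg.mem_span_family hM hn hq hr hζ (by rwa [hu1]) hu hstep v
  obtain ⟨w, hw0, hw⟩ := hA.exists_of_mem_span hζ hu hv hv0 hspan
  by_cases h1 : w * adjSwap i = 1
  · have h2 : w = 1 * adjSwap i := by
      rw [← h1, mul_adjSwap_mul_adjSwap]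
    have h3 := hstep 1 i (by simp [lo, hi, Fin.lt_def])
    rw [← h2, hu1] at h3
    refine hw0 (h3.trans ?_)
    have := hreg.intertwiner_intertwiner hq hr hζ hv i
    rw [hz, zero_smul] at this
    exact this
  · have h2 : swapWord a i ∘ ⇑(w * adjSwap i) = swapWord a i := by
      rw [coe_mul_adjSwap]
      conv_rhs => rw [← hw]
      rfl
    obtain ⟨k, l, hkl, hinv, heq⟩ := exists_inverted_of_comp_eq h1 h2
    have hk := congrFun h2 k
    have hl := congrFun h2 l
    rw [← hk, ← hl] at heq
    by_cases hc : k = lo i ∧ l = hi i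
    · obtain ⟨rfl, rfl⟩ := hc
      refine hreg _ _ (hu w) hw0 i ?_
      rw [Function.comp_apply, Function.comp_apply, coe_mul_adjSwap, swapWord_lo, swapWord_hi] at heq
      exact heq.symm
    · exact hw0 (hreg.family_eq_zero_of_inverted hu hstep w _ _ (swap_lt_swap hkl hc) hinv heq)

/-- Between two equal letters of a weight of an irreducible calibrated module there are letters of
both neighbouring contents. By induction on the distance of the two letters they can be assumed not
to be movable towards each other, so that their inner neighbours have neighbouring contents. If
these two neighbours are different letters, they are as required; if they are equal letters at
different places, the induction hypothesis between them gives a copy of the outer letter; and they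
cannot be at the same place, since the braid relation would force `q⁴ = 1`. -/
theorem HasRegularWeights.exists_neighbours {κ : Type*} {b : Module.Basis κ ℂ M}
    {A : κ → Fin n → Fin r × ℂ} (hA : IsWeightBasis q ζ b A) (hn : 0 < n) (hq : q ≠ 0)
    (hq4 : q + q⁻¹ ≠ 0) (hr : 0 < r) (hζ : IsPrimitiveRoot ζ r) {a : Fin n → Fin r × ℂ} {v : M}
    (hv : IsWeightVector q ζ a v) (hv0 : v ≠ 0) {j k : Fin n} (hjk : j < k) (ha : a j = a k) :
    (∃ l, j < l ∧ l < k ∧ (a l).1 = (a j).1 ∧ (a l).2 = q ^ 2 * (a j).2) ∧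
      ∃ l, j < l ∧ l < k ∧ (a l).1 = (a j).1 ∧ (a j).2 = q ^ 2 * (a l).2 := by
  obtain ⟨d, hd⟩ : ∃ d, k.1 - j.1 = d := ⟨_, rfl⟩
  induction d using Nat.strong_induction_on generalizing a v j k with
  | _ d ih =>
    have hjk' : j.1 < k.1 := hjk
    have hk := k.2
    -- the places next to `j` and `k`
    let i : Fin (n - 1) := ⟨j.1, by omega⟩
    let i' : Fin (n - 1) := ⟨k.1 - 1, by omega⟩
    have hj_lo : lo i = j := rfl
    have hk_hi : hi i' = k := Fin.ext (by simp only [hi, i']; omega)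
    have hnei := hreg a v hv hv0 i
    have hnei' := hreg a v hv hv0 i'
    rw [hj_lo] at hnei
    rw [hk_hi] at hnei'
    have hlt1 : hi i < k := lt_of_le_of_ne (by simp only [hi, i, Fin.le_def]; omega)
      fun e => hnei (by rw [e, ha])
    have hlt2 : j < lo i' := lt_of_le_of_ne (by simp only [lo, i', Fin.le_def]; omega)
      fun e => hnei' (by rw [← e, ha])
    have hj_hi : j < hi i := by simp only [hi, i, Fin.lt_def]; omega
    have hlo_k : lo i' < k := by simp only [lo, i', Fin.lt_def]; omega
    by_cases hmid : ∃ m, j < m ∧ m < k ∧ a m = a j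
    · obtain ⟨m, h1, h2, h3⟩ := hmid
      have h1' : j.1 < m.1 := h1
      have h2' : m.1 < k.1 := h2
      obtain ⟨⟨l, e1, e2, e3⟩, ⟨l', e1', e2', e3'⟩⟩ :=
        ih (m.1 - j.1) (by omega) hv hv0 h1 h3.symm rfl
      exact ⟨⟨l, e1, e2.trans h2, e3⟩, ⟨l', e1', e2'.trans h2, e3'⟩⟩
    by_cases hc : swapCoeff q (a (lo i)) (a (hi i)) * swapCoeff q (a (hi i)) (a (lo i)) = 0
    swap
    · -- the letters at `j` and `j + 1` can be exchanged
      have hne : YokonumaHecke.intertwiner q i a v ≠ 0 := by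
        intro h0
        have := hreg.intertwiner_intertwiner hq hr hζ hv i
        rw [h0, intertwiner_zero] at this
        exact smul_ne_zero hc hv0 this.symm
      have hout : ∀ l, hi i < l → swapWord a i l = a l := fun l hl =>
        swapWord_of_ne _ (hj_hi.trans hl).ne' hl.ne'
      have hlt1' : (hi i).1 < k.1 := hlt1
      have hhi : swapWord a i (hi i) = a j := swapWord_hi a i
      obtain ⟨⟨l, e1, e2, e3⟩, ⟨l', e1', e2', e3'⟩⟩ := ih (k.1 - (hi i).1)
        (by simp only [hi, i]; omega) (hreg.intertwiner hr hζ hv i) hne hlt1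
        (by rw [hhi, hout k hlt1, ha]) rfl
      rw [hhi, hout l e1] at e3
      rw [hhi, hout l' e1'] at e3'
      exact ⟨⟨l, hj_hi.trans e1, e2, e3⟩, ⟨l', hj_hi.trans e1', e2', e3'⟩⟩
    by_cases hc' : swapCoeff q (a (lo i')) (a (hi i')) * swapCoeff q (a (hi i')) (a (lo i')) = 0
    swap
    · -- the letters at `k - 1` and `k` can be exchanged
      have hne : YokonumaHecke.intertwiner q i' a v ≠ 0 := by
        intro h0
        have := hreg.intertwiner_intertwiner hq hr hζ hv i'
        rw [h0, intertwiner_zero] at this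
        exact smul_ne_zero hc' hv0 this.symm
      have hout : ∀ l, l < lo i' → swapWord a i' l = a l := fun l hl =>
        swapWord_of_ne _ hl.ne (by rw [hk_hi]; exact (hl.trans hlo_k).ne)
      have hlt2' : j.1 < (lo i').1 := hlt2
      have hlo : swapWord a i' (lo i') = a k := by rw [swapWord_lo, hk_hi]
      obtain ⟨⟨l, e1, e2, e3⟩, ⟨l', e1', e2', e3'⟩⟩ := ih ((lo i').1 - j.1)
        (by simp only [lo, i']; omega) (hreg.intertwiner hr hζ hv i') hne hlt2
        (by rw [hlo, hout j hlt2, ha]) rfl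
      rw [hout j hlt2, hout l e2] at e3
      rw [hout j hlt2, hout l' e2'] at e3'
      exact ⟨⟨l, e1, e2.trans hlo_k, e3⟩, ⟨l', e1', e2'.trans hlo_k, e3'⟩⟩
    -- the intertwiners at both ends vanish, and both neighbours have neighbouring contents
    have kill := hreg.intertwiner_eq_zero hM hA hn hq hr hζ hv hc
    have kill' := hreg.intertwiner_eq_zero hM hA hn hq hr hζ hv hc'
    have hcc := hc
    rw [swapCoeff_mul_eq_zero_iff hq (by rwa [hj_lo]), hj_lo] at hc
    rw [swapCoeff_mul_eq_zero_iff hq (by rwa [hk_hi]), hk_hi, ← ha] at hc'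
    obtain ⟨hp, hc⟩ := hc
    obtain ⟨hp', hc'⟩ := hc'
    have hq2 : q ^ 2 ≠ 0 := pow_ne_zero 2 hq
    -- if both neighbours are equal, then they are different places
    have hdiff : a (hi i) = a (lo i') → hi i < lo i' := by
      intro heq
      refine lt_of_le_of_ne ?_ fun hsame => ?_
      · have : (hi i).1 < k.1 := hlt1
        simp only [hi, lo, i, i', Fin.le_def] at this ⊢
        omega
      have hii' : i'.1 = i.1 + 1 := (Fin.ext_iff.1 hsame).symm
      have hbr : YHat.g r n q i • YHat.g r n q i' • YHat.g r n q i • v =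
          YHat.g r n q i' • YHat.g r n q i • YHat.g r n q i' • v := by
        simp only [← mul_smul]
        rw [← mul_assoc, ← mul_assoc, YHat.g_braid i i' hii']
      rw [YokonumaHecke.intertwiner, sub_eq_zero, hj_lo] at kill
      rw [YokonumaHecke.intertwiner, sub_eq_zero, hk_hi, ← heq, ← ha] at kill'
      simp only [kill, kill', YHat.smul_scalar_smul, smul_smul] at hbr
      have hs := smul_left_injective ℂ hv0 hbr
      have h1 := diagCoeff_add (q := q) hnei
      rw [if_pos hp] at h1
      rw [swapCoeff_mul_swapCoeff hq (by rwa [hj_lo]), hj_lo] at hcc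
      set α := diagCoeff q (a j) (a (hi i))
      set β := diagCoeff q (a (hi i)) (a j)
      have h2 : α = β := by linear_combination (α - β) * hcc - hs
      have h3 : (q + q⁻¹) ^ 2 = 0 := by
        have h4 : q * q⁻¹ = 1 := mul_inv_cancel₀ hq
        rw [← h2] at h1 hcc
        linear_combination 4 * h4 + 4 * hcc - (q - q⁻¹ + 2 * α) * h1
      exact hq4 (pow_eq_zero_iff two_ne_zero |>.1 h3)
    rcases hc with hc | hc <;> rcases hc' with hc' | hc'
    · exact ⟨⟨_, hj_hi, hlt1, hp.symm, hc⟩, ⟨_, hlt2, hlo_k, hp', hc'⟩⟩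
    · have heq : a (hi i) = a (lo i') := Prod.ext (hp.symm.trans hp'.symm) (hc.trans hc'.symm)
      have hlt := hdiff heq
      have hlt' : (hi i).1 < (lo i').1 := hlt
      obtain ⟨-, ⟨l, e1, e2, e3, e4⟩⟩ := ih ((lo i').1 - (hi i).1) (by
        simp only [lo, hi, i, i'] at hlt' ⊢; omega) hv hv0 hlt heq rfl
      refine absurd ⟨l, hj_hi.trans e1, e2.trans hlo_k, Prod.ext (e3.trans hp.symm) ?_⟩ hmid
      exact mul_left_cancel₀ hq2 (e4.symm.trans hc)
    · have heq : a (hi i) = a (lo i') := Prod.ext (hp.symm.trans hp'.symm)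
        (mul_left_cancel₀ hq2 (hc.symm.trans hc'))
      have hlt := hdiff heq
      have hlt' : (hi i).1 < (lo i').1 := hlt
      obtain ⟨⟨l, e1, e2, e3, e4⟩, -⟩ := ih ((lo i').1 - (hi i).1) (by
        simp only [lo, hi, i, i'] at hlt' ⊢; omega) hv hv0 hlt heq rfl
      refine absurd ⟨l, hj_hi.trans e1, e2.trans hlo_k, Prod.ext (e3.trans hp.symm) ?_⟩ hmid
      exact e4.trans hc.symm
    · exact ⟨⟨_, hlt2, hlo_k, hp', hc'⟩, ⟨_, hj_hi, hlt1, hp.symm, hc⟩⟩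

end Simple

end Calibrated

end YokonumaHecke

namespace YokonumaHecke

open SkewShape

variable {r n : ℕ}

/-! ### Skew shapes from words -/

/-- A Young diagram whose boundary has height `H d` on the `d`-th diagonal, for `d ≥ 0`, and is
horizontal below the main diagonal. The natural number `b - a` is `0` for boxes below the main
diagonal. -/
lemma exists_youngDiagram_of_profile {H : ℕ → ℕ} (h1 : ∀ d, H (d + 1) ≤ H d)
    (h2 : ∀ d, H d ≤ H (d + 1) + 1) {N : ℕ} (hN : ∀ d, N ≤ d → H d = 0) :
    ∃ Y : YoungDiagram, ∀ a b, (a, b) ∈ Y ↔ a < H (b - a) := by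
  have hanti : Antitone H := antitone_nat_of_succ_le h1
  have hlip : ∀ k d, H d ≤ H (d + k) + k := by
    intro k
    induction k with
    | zero => exact fun d => le_rfl
    | succ k ih =>
      intro d
      have := h2 (d + k)
      have := ih d
      change H d ≤ H (d + k + 1) + (k + 1)
      omega
  have hmem : ∀ a b : ℕ, (a, b) ∈ ((Finset.range (H 0) ×ˢ Finset.range (N + H 0)).filter
      fun x : ℕ × ℕ => x.1 < H (x.2 - x.1)) ↔ a < H (b - a) := by
    intro a b
    rw [Finset.mem_filter, Finset.mem_product, Finset.mem_range, Finset.mem_range]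
    refine ⟨fun h => h.2, fun h => ⟨⟨?_, ?_⟩, h⟩⟩
    · exact h.trans_le (hanti (Nat.zero_le _))
    · have : b - a < N := by
        by_contra hc
        rw [hN _ (not_lt.1 hc)] at h
        omega
      have := h.trans_le (hanti (Nat.zero_le (b - a)))
      simp only
      omega
  refine ⟨⟨_, ?_⟩, fun a b => hmem a b⟩
  rintro ⟨a, b⟩ ⟨a', b'⟩ ⟨ha, hb⟩ hab
  simp only at ha hb
  have hab := (hmem a b).1 hab
  refine (hmem a' b').2 ?_
  have e1 := hlip (a - a') (b - a)
  have e2 : H ((b - a) + (a - a')) ≤ H (b' - a') := hanti (by omega)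
  omega

section Word

variable (L : Fin n → Fin r × ℕ)

/-- The number of occurrences of the letter `x` at the places before `k`. -/
def occ (k : ℕ) (x : Fin r × ℕ) : ℕ := (Finset.univ.filter fun j : Fin n => j.1 < k ∧ L j = x).card

open Classical in
/-- `1` if the letter `(s, d + 1)` occurs in the word, and before the first `(s, d)`, and `0`
otherwise. -/
noncomputable def upFirst (s : Fin r) (d : ℕ) : ℕ :=
  if ∃ j, L j = (s, d + 1) ∧ ∀ i < j, L i ≠ (s, d) then 1 else 0

/-- The row of the first box on the diagonal `d` of the component `s`. Between neighbouring
diagonals it changes by one if and only if the upper diagonal comes first. -/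
noncomputable def rowStart (s : Fin r) (d : ℕ) : ℕ :=
  ∑ e ∈ Finset.Ico d (Finset.univ.sup fun j => (L j).2), upFirst L s e

variable {L}

lemma occ_zero (x : Fin r × ℕ) : occ L 0 x = 0 := by simp [occ]

lemma occ_mono {k l : ℕ} (h : k ≤ l) (x : Fin r × ℕ) : occ L k x ≤ occ L l x :=
  Finset.card_le_card fun j hj => by
    simp only [Finset.mem_filter] at hj ⊢
    exact ⟨hj.1, hj.2.1.trans_le h, hj.2.2⟩

lemma occ_succ_self (j : Fin n) : occ L (j.1 + 1) (L j) = occ L j.1 (L j) + 1 := by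
  have : (Finset.univ.filter fun i : Fin n => i.1 < j.1 + 1 ∧ L i = L j) =
      insert j (Finset.univ.filter fun i : Fin n => i.1 < j.1 ∧ L i = L j) := by
    ext i
    simp only [Finset.mem_filter, Finset.mem_univ, true_and, Finset.mem_insert]
    constructor
    · rintro ⟨h1, h2⟩
      rcases Nat.lt_succ_iff_lt_or_eq.1 h1 with h | h
      · exact Or.inr ⟨h, h2⟩
      · exact Or.inl (Fin.ext h)
    · rintro (rfl | ⟨h1, h2⟩)
      · exact ⟨by omega, rfl⟩
      · exact ⟨by omega, h2⟩
  rw [occ, this, Finset.card_insert_of_notMem (by simp)]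
  rfl

lemma occ_succ_of_ne {j : Fin n} {x : Fin r × ℕ} (h : L j ≠ x) :
    occ L (j.1 + 1) x = occ L j.1 x := by
  rw [occ, occ]
  congr 1
  ext i
  simp only [Finset.mem_filter, Finset.mem_univ, true_and]
  refine ⟨fun ⟨h1, h2⟩ => ⟨?_, h2⟩, fun ⟨h1, h2⟩ => ⟨by omega, h2⟩⟩
  rcases Nat.lt_succ_iff_lt_or_eq.1 h1 with h' | h'
  · exact h'
  · exact absurd (by rw [← h2, Fin.ext h']) h

lemma occ_lt {j : Fin n} {k : ℕ} (h : j.1 < k) : occ L j.1 (L j) < occ L k (L j) := by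
  have := occ_mono (L := L) (show j.1 + 1 ≤ k from h) (L j)
  rw [occ_succ_self] at this
  omega

lemma exists_occ_eq {k m : ℕ} {x : Fin r × ℕ} (hk : k ≤ n) (h : m < occ L k x) :
    ∃ j : Fin n, L j = x ∧ occ L j.1 x = m := by
  induction k with
  | zero => rw [occ_zero] at h; omega
  | succ k ih =>
    by_cases hx : L ⟨k, hk⟩ = x
    · by_cases hm : occ L k x = m
      · exact ⟨⟨k, hk⟩, hx, hm⟩
      · have := occ_succ_self (L := L) ⟨k, hk⟩
        rw [hx] at this
        simp only at this
        exact ih (by omega) (by omega)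
    · have := occ_succ_of_ne hx
      simp only at this
      exact ih (by omega) (by omega)

lemma rowStart_eq (s : Fin r) (d : ℕ) : rowStart L s d = upFirst L s d + rowStart L s (d + 1) := by
  by_cases h : d < Finset.univ.sup fun j => (L j).2
  · rw [rowStart, Finset.sum_eq_sum_Ico_succ_bot h]
    rfl
  · rw [rowStart, rowStart, Finset.Ico_eq_empty (by omega), Finset.Ico_eq_empty (by omega),
      upFirst, if_neg]
    · rfl
    · rintro ⟨j, hj, -⟩
      have := Finset.le_sup (f := fun j => (L j).2) (Finset.mem_univ j)
      simp only [hj] at this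
      omega

variable (hL : ∀ j k, j < k → L j = L k →
  (∃ l, j < l ∧ l < k ∧ (L l).1 = (L j).1 ∧ (L l).2 = (L j).2 + 1) ∧
    ∃ l, j < l ∧ l < k ∧ (L l).1 = (L j).1 ∧ (L j).2 = (L l).2 + 1)

include hL

/-- The letters `(s, d)` and `(s, d + 1)` alternate. The two cases tell which of them has to come
next. -/
lemma occ_alternate (s : Fin r) (d k : ℕ) (hk : k ≤ n) :
    (occ L k (s, d) + upFirst L s d = occ L k (s, d + 1) + 1 ∧
        ∀ j : Fin n, k ≤ j.1 → L j = (s, d) → ∃ i : Fin n, k ≤ i.1 ∧ i < j ∧ L i = (s, d + 1)) ∨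
      (occ L k (s, d) + upFirst L s d = occ L k (s, d + 1) ∧
        ∀ j : Fin n, k ≤ j.1 → L j = (s, d + 1) → ∃ i : Fin n, k ≤ i.1 ∧ i < j ∧ L i = (s, d)) := by
  have hxy : ((s, d) : Fin r × ℕ) ≠ (s, d + 1) := by simp
  induction k with
  | zero =>
    simp only [occ_zero, upFirst, Nat.zero_le, true_and, true_implies]
    split_ifs with h
    · obtain ⟨j₀, h1, h2⟩ := h
      refine Or.inl ⟨rfl, fun j hj => ⟨j₀, ?_, h1⟩⟩
      rcases lt_trichotomy j₀ j with h | h | h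
      · exact h
      · rw [← h, h1] at hj
        exact absurd hj.symm hxy
      · exact absurd hj (h2 j h)
    · refine Or.inr ⟨rfl, fun j hj => ?_⟩
      by_contra! hc
      exact h ⟨j, hj, hc⟩
  | succ k ih =>
    set j₀ : Fin n := ⟨k, hk⟩ with hj₀
    -- a place `≥ k` that does not carry the letter of `j₀` is `≥ k + 1`
    have hshift : ∀ {x : Fin r × ℕ}, L j₀ ≠ x → ∀ i : Fin n, k ≤ i.1 → L i = x → k + 1 ≤ i.1 := by
      intro x hx i hi' hix
      rcases eq_or_lt_of_le hi' with h | h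
      · exact absurd (by rw [← hix, show i = j₀ from Fin.ext h.symm]) hx
      · exact h
    by_cases hx : L j₀ = (s, d)
    · have c1 := occ_succ_self (L := L) j₀
      have c2 := occ_succ_of_ne (L := L) (j := j₀) (x := (s, d + 1)) (by rw [hx]; exact hxy)
      rw [hx] at c1
      simp only [hj₀] at c1 c2
      rcases ih (by omega) with ⟨-, h2⟩ | ⟨h1, -⟩
      · obtain ⟨i, h3, h4, -⟩ := h2 j₀ le_rfl hx
        exact absurd h3 (not_le.2 h4)
      · refine Or.inl ⟨by omega, fun j hj hjx => ?_⟩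
        obtain ⟨⟨l, e1, e2, e3, e4⟩, -⟩ := hL j₀ j hj (hx.trans hjx.symm)
        rw [hx] at e3 e4
        exact ⟨l, e1, e2, Prod.ext e3 e4⟩
    · by_cases hy : L j₀ = (s, d + 1)
      · have c1 := occ_succ_self (L := L) j₀
        have c2 := occ_succ_of_ne (L := L) (j := j₀) (x := (s, d)) (by rw [hy]; exact hxy.symm)
        rw [hy] at c1
        simp only [hj₀] at c1 c2
        rcases ih (by omega) with ⟨h1, -⟩ | ⟨-, h2⟩
        · refine Or.inr ⟨by omega, fun j hj hjx => ?_⟩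
          obtain ⟨-, ⟨l, e1, e2, e3, e4⟩⟩ := hL j₀ j hj (hy.trans hjx.symm)
          rw [hy] at e3 e4
          exact ⟨l, e1, e2, Prod.ext e3 (by simp only at e4; omega)⟩
        · obtain ⟨i, h3, h4, -⟩ := h2 j₀ le_rfl hy
          exact absurd h3 (not_le.2 h4)
      · have c1 := occ_succ_of_ne (L := L) hx
        have c2 := occ_succ_of_ne (L := L) hy
        simp only [hj₀] at c1 c2
        rcases ih (by omega) with ⟨h1, h2⟩ | ⟨h1, h2⟩
        · refine Or.inl ⟨by omega, fun j hj hjx => ?_⟩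
          obtain ⟨i, h3, h4, h5⟩ := h2 j (by omega) hjx
          exact ⟨i, hshift hy i h3 h5, h4, h5⟩
        · refine Or.inr ⟨by omega, fun j hj hjx => ?_⟩
          obtain ⟨i, h3, h4, h5⟩ := h2 j (by omega) hjx
          exact ⟨i, hshift hx i h3 h5, h4, h5⟩

/-- Before an occurrence of `(s, d)`, the case of `occ_alternate` is the one in which `(s, d)` comes
next. -/
lemma occ_of_eq_lower {s : Fin r} {d : ℕ} {j : Fin n} (h : L j = (s, d)) :
    occ L j.1 (s, d) + upFirst L s d = occ L j.1 (s, d + 1) := by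
  rcases occ_alternate hL s d j.1 j.2.le with ⟨-, h2⟩ | ⟨h1, -⟩
  · obtain ⟨i, h3, h4, -⟩ := h2 j le_rfl h
    exact absurd h3 (not_le.2 h4)
  · exact h1

/-- Before an occurrence of `(s, d + 1)`, the case of `occ_alternate` is the one in which
`(s, d + 1)` comes next. -/
lemma occ_of_eq_upper {s : Fin r} {d : ℕ} {j : Fin n} (h : L j = (s, d + 1)) :
    occ L j.1 (s, d) + upFirst L s d = occ L j.1 (s, d + 1) + 1 := by
  rcases occ_alternate hL s d j.1 j.2.le with ⟨h1, -⟩ | ⟨-, h2⟩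
  · exact h1
  · obtain ⟨i, h3, h4, -⟩ := h2 j le_rfl h
    exact absurd h3 (not_le.2 h4)

/-- A word of diagonals, for each component, in which two equal letters are separated by both
neighbouring letters, comes from a standard tableau of a skew shape. On the diagonal `d` of the
component `s` the diagram `μ` has height `rowStart s d`, and the occurrences of the letter `(s, d)`
become the next boxes of this diagonal. -/
theorem exists_skewShape_of_word (hpos : ∀ j, 1 ≤ (L j).2) :
    ∃ (S : SkewShape r n) (T : S.Box ≃ Fin n), S.IsStandard T ∧
      ∀ j, (T.symm j).p = (L j).1 ∧ (T.symm j).diag = (L j).2 := by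
  have hupper : ∀ s : Fin r, ∃ N, ∀ d, N ≤ d → rowStart L s d + occ L n (s, d) = 0 := by
    intro s
    refine ⟨(Finset.univ.sup fun j => (L j).2) + 1, fun d hd => ?_⟩
    rw [rowStart, Finset.Ico_eq_empty (by omega), Finset.sum_empty, zero_add, occ,
      Finset.card_eq_zero, Finset.filter_eq_empty_iff]
    rintro j - ⟨-, hj⟩
    have := Finset.le_sup (f := fun j => (L j).2) (Finset.mem_univ j)
    simp only [hj] at this
    omega
  have hmu : ∀ s : Fin r, ∃ Y : YoungDiagram, ∀ a b, (a, b) ∈ Y ↔ a < rowStart L s (b - a) := by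
    intro s
    obtain ⟨N, hN⟩ := hupper s
    refine exists_youngDiagram_of_profile (fun d => ?_) (fun d => ?_) (N := N) fun d hd => ?_
    · rw [rowStart_eq s d]
      omega
    · rw [rowStart_eq s d, upFirst]
      split_ifs <;> omega
    · have := hN d hd
      omega
  have hlam : ∀ s : Fin r, ∃ Y : YoungDiagram, ∀ a b,
      (a, b) ∈ Y ↔ a < rowStart L s (b - a) + occ L n (s, b - a) := by
    intro s
    obtain ⟨N, hN⟩ := hupper s
    refine exists_youngDiagram_of_profile (H := fun d => rowStart L s d + occ L n (s, d))
      (fun d => ?_) (fun d => ?_) (N := N) fun d hd => hN d hd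
    · have := rowStart_eq (L := L) s d
      rcases occ_alternate hL s d n le_rfl with ⟨h, -⟩ | ⟨h, -⟩ <;> omega
    · have := rowStart_eq (L := L) s d
      rcases occ_alternate hL s d n le_rfl with ⟨h, -⟩ | ⟨h, -⟩ <;> omega
  choose mu hmu using hmu
  choose lam hlam using hlam
  -- the row of the box with the number `j`
  let row : Fin n → ℕ := fun j => rowStart L (L j).1 (L j).2 + occ L j.1 (L j)
  have hmem : ∀ j, (row j, row j + (L j).2) ∈ lam (L j).1 ∧
      (row j, row j + (L j).2) ∉ mu (L j).1 := by
    intro j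
    rw [hlam, hmu, Nat.add_sub_cancel_left]
    have := occ_lt (L := L) j.2
    refine ⟨Nat.add_lt_add_left this _, not_lt.2 (Nat.le_add_right _ _)⟩
  have hinj : ∀ j k, (L j).1 = (L k).1 → row j = row k → row j + (L j).2 = row k + (L k).2 →
      j = k := by
    intro j k hp hr hc
    have hjk : L j = L k := Prod.ext hp (by omega)
    simp only [row, hjk] at hr
    rcases lt_trichotomy j k with h | h | h
    · have := occ_lt (L := L) (j := j) (k := k.1) h
      rw [hjk] at this
      omega
    · exact h
    · have := occ_lt (L := L) (j := k) (k := j.1) h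
      omega
  have hsurj : ∀ s a b, (a, b) ∈ lam s → (a, b) ∉ mu s →
      ∃ j, (L j).1 = s ∧ row j = a ∧ row j + (L j).2 = b := by
    intro s a b h1 h2
    rw [hlam] at h1
    rw [hmu, not_lt] at h2
    obtain ⟨j, hj, hocc⟩ := exists_occ_eq (L := L) (m := a - rowStart L s (b - a)) le_rfl
      (show _ < occ L n (s, b - a) by omega)
    have hb : 1 ≤ b - a := by
      have := hpos j
      rwa [hj] at this
    have hrow : row j = a := by
      simp only [row, hj, hocc]
      omega
    exact ⟨j, by rw [hj], hrow, by rw [hrow, hj]; simp only; omega⟩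
  have hcard : ∑ s, ((lam s).cells \ (mu s).cells).card = n := by
    rw [← Finset.card_sigma]
    refine (Finset.card_bij (s := (Finset.univ : Finset (Fin n)))
      (fun j _ => (⟨(L j).1, (row j, row j + (L j).2)⟩ : Σ _ : Fin r, ℕ × ℕ))
      ?_ ?_ ?_).symm.trans (Finset.card_fin n)
    · intro j _
      rw [Finset.mem_sigma, Finset.mem_sdiff]
      exact ⟨Finset.mem_univ _, hmem j⟩
    · intro j _ k _ h
      have h1 := congrArg (fun x => x.1) h
      have h2 := congrArg (fun x => x.2.1) h
      have h3 := congrArg (fun x => x.2.2) h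
      exact hinj j k h1 h2 h3
    · rintro ⟨s, a, b⟩ h
      rw [Finset.mem_sigma, Finset.mem_sdiff] at h
      obtain ⟨j, rfl, rfl, rfl⟩ := hsurj s a b h.2.1 h.2.2
      exact ⟨j, Finset.mem_univ _, rfl⟩
  let S : SkewShape r n :=
    { lam := lam
      mu := mu
      mu_le_lam := fun s => by
        rintro ⟨a, b⟩ h
        have h' := (hmu s a b).1 h
        exact (hlam s a b).2 (by omega)
      card_boxes := hcard }
  let f : Fin n → S.Box := fun j => ⟨((L j).1, (row j, row j + (L j).2)), hmem j⟩
  have hf : Function.Bijective f := by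
    constructor
    · intro j k h
      exact hinj j k (congrArg Box.p h) (congrArg Box.row h) (congrArg Box.col h)
    · rintro ⟨⟨s, a, b⟩, h1, h2⟩
      obtain ⟨j, rfl, rfl, rfl⟩ := hsurj s a b h1 h2
      exact ⟨j, rfl⟩
  let e : Fin n ≃ S.Box := Equiv.ofBijective f hf
  have hdiag : ∀ j, (f j).diag = (L j).2 := fun j => by
    change ((row j + (L j).2 : ℕ) : ℤ) - (row j : ℕ) = (L j).2
    push_cast
    ring
  refine ⟨S, e.symm, ?_, fun j => ⟨rfl, hdiag j⟩⟩
  have key : ∀ b : S.Box, ∃ j, b = f j ∧ e.symm b = j := fun b =>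
    ⟨e.symm b, (e.apply_symm_apply b).symm, rfl⟩
  refine isStandard_of_adjacent (fun b b' hb => ?_) (fun b b' hb => ?_)
  · obtain ⟨j, rfl, ej⟩ := key b
    obtain ⟨k, rfl, ek⟩ := key b'
    rw [ej, ek]
    obtain ⟨hp, hr, hc⟩ := hb
    change (L j).1 = (L k).1 at hp
    change row k = row j at hr
    change row k + (L k).2 = row j + (L j).2 + 1 at hc
    have hk : L k = ((L j).1, (L j).2 + 1) := Prod.ext hp.symm (by simp only; omega)
    have hR := rowStart_eq (L := L) (L j).1 (L j).2
    have h1 := occ_of_eq_lower hL (s := (L j).1) (d := (L j).2) (j := j) rfl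
    have hrk : row k = rowStart L (L j).1 ((L j).2 + 1) + occ L k.1 ((L j).1, (L j).2 + 1) := by
      simp only [row, hk]
    have hrj : row j = rowStart L (L j).1 (L j).2 + occ L j.1 ((L j).1, (L j).2) := rfl
    by_contra hlt
    have hlt : k.1 ≤ j.1 := not_lt.1 hlt
    have hne : k.1 ≠ j.1 := fun e => by
      have := congrArg (fun i => (L i).2) (Fin.ext e : k = j)
      simp only [hk] at this
      omega
    have h2 := occ_lt (L := L) (j := k) (k := j.1) (by omega)
    rw [hk] at h2
    omega
  · obtain ⟨j, rfl, ej⟩ := key b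
    obtain ⟨k, rfl, ek⟩ := key b'
    rw [ej, ek]
    obtain ⟨hp, hr, hc⟩ := hb
    change (L j).1 = (L k).1 at hp
    change row k = row j + 1 at hr
    change row k + (L k).2 = row j + (L j).2 at hc
    have hj : L j = ((L k).1, (L k).2 + 1) := Prod.ext hp (by simp only; omega)
    have hR := rowStart_eq (L := L) (L k).1 (L k).2
    have h1 := occ_of_eq_upper hL hj
    have hrj : row j = rowStart L (L k).1 ((L k).2 + 1) + occ L j.1 ((L k).1, (L k).2 + 1) := by
      simp only [row, hj]
    have hrk : row k = rowStart L (L k).1 (L k).2 + occ L k.1 ((L k).1, (L k).2) := rfl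
    by_contra hlt
    have hlt : k.1 ≤ j.1 := not_lt.1 hlt
    have hne : k.1 ≠ j.1 := fun e => by
      have := congrArg (fun i => (L i).2) (Fin.ext e : k = j)
      simp only [hj] at this
      omega
    have h2 : occ L k.1 ((L k).1, (L k).2) < occ L j.1 ((L k).1, (L k).2) := occ_lt (by omega)
    omega

end Word

/-! ### Placed shapes from contents -/

/-- Contents can be replaced by diagonals: within a class modulo `ℤ` the differences are kept, and
different classes are moved apart by at least two. -/
lemma exists_diagonals (c : Fin n → ℂ) :
    ∃ δ : Fin n → ℕ, (∀ j, 1 ≤ δ j) ∧ (∀ j k, c k = c j + 1 ↔ δ k = δ j + 1) ∧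
      (∀ j k, c k = c j ↔ δ k = δ j) ∧
      ∀ j k (z : ℤ), c k - c j = z → (δ k : ℤ) - δ j = z := by
  let st : Setoid (Fin n) :=
    { r := fun j k => ∃ z : ℤ, c k - c j = z
      iseqv :=
        { refl := fun j => ⟨0, by simp⟩
          symm := fun {j k} ⟨z, hz⟩ => ⟨-z, by rw [Int.cast_neg, ← hz]; ring⟩
          trans := fun {j k l} ⟨z, hz⟩ ⟨z', hz'⟩ =>
            ⟨z + z', by rw [Int.cast_add, ← hz, ← hz']; ring⟩ } }
  -- `rep j` represents the class of `j` modulo `ℤ`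
  let rep : Fin n → Fin n := fun j => (Quotient.mk st j).out
  have hrep : ∀ j, ∃ z : ℤ, c j - c (rep j) = z := fun j => Quotient.mk_out (s := st) j
  choose z hz using hrep
  have hrep_eq : ∀ j k (y : ℤ), c k - c j = y → rep j = rep k := fun j k y h =>
    congrArg Quotient.out (Quotient.sound (s := st) ⟨y, h⟩)
  obtain ⟨m, hm⟩ : ∃ m : ℕ, ∀ j, (z j).natAbs ≤ m :=
    ⟨Finset.univ.sup fun j => (z j).natAbs, fun j =>
      Finset.le_sup (f := fun j => (z j).natAbs) (Finset.mem_univ j)⟩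
  let δ : Fin n → ℕ := fun j => (z j + m + 1 + (2 * m + 2) * (rep j).1).toNat
  have hδ : ∀ j, (δ j : ℤ) = z j + m + 1 + (2 * m + 2) * (rep j).1 ∧ 1 ≤ δ j := by
    intro j
    have h1 := hm j
    have h2 : (0 : ℤ) ≤ (2 * m + 2) * (rep j).1 := by positivity
    simp only [δ]
    omega
  have hdiff : ∀ j k (y : ℤ), c k - c j = y → (δ k : ℤ) - δ j = y := by
    intro j k y h
    have hr := hrep_eq j k y h
    have : ((z k - z j : ℤ) : ℂ) = y := by
      rw [Int.cast_sub, ← hz, ← hz, ← h, hr]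
      ring
    rw [(hδ j).1, (hδ k).1, hr, ← Int.cast_injective this]
    ring
  -- diagonals that differ by at most one belong to contents of the same class
  have hclose : ∀ j k (y : ℤ), |y| ≤ 1 → (δ k : ℤ) - δ j = y → c k - c j = y := by
    intro j k y hy h
    have h1 := hm j
    have h2 := hm k
    rw [abs_le] at hy
    have hr : rep j = rep k := by
      by_contra hne
      have hne' : (rep j).1 ≠ (rep k).1 := fun e => hne (Fin.ext e)
      rw [(hδ j).1, (hδ k).1] at h
      have h3 : (2 * (m : ℤ) + 2) * ((rep k).1 - (rep j).1) = y - z k + z j := by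
        linear_combination h
      rcases lt_or_gt_of_ne hne' with hlt | hlt
      · have : (2 * (m : ℤ) + 2) * 1 ≤ (2 * (m : ℤ) + 2) * ((rep k).1 - (rep j).1) :=
          mul_le_mul_of_nonneg_left (by omega) (by positivity)
        omega
      · have : (2 * (m : ℤ) + 2) * ((rep k).1 - (rep j).1) ≤ (2 * (m : ℤ) + 2) * (-1) :=
          mul_le_mul_of_nonneg_left (by omega) (by positivity)
        omega
    have h4 : z k - z j = y := by
      rw [(hδ j).1, (hδ k).1, hr] at h
      linear_combination h
    rw [← h4, Int.cast_sub, ← hz, ← hz, hr]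
    ring
  refine ⟨δ, fun j => (hδ j).2, fun j k => ⟨fun h => ?_, fun h => ?_⟩,
    fun j k => ⟨fun h => ?_, fun h => ?_⟩, hdiff⟩
  · have := hdiff j k 1 (by rw [h]; push_cast; ring)
    omega
  · have := hclose j k 1 (by simp) (by rw [h]; push_cast; ring)
    rw [Int.cast_one] at this
    linear_combination this
  · have := hdiff j k 0 (by rw [h]; push_cast; ring)
    omega
  · have := hclose j k 0 (by simp) (by rw [h]; ring)
    rw [Int.cast_zero] at this
    linear_combination this

/-- A word of component indices and contents in which two equal letters are separated by letters of
both neighbouring contents is the weight of a standard tableau of a placed shape. -/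
theorem exists_placedShape_of_contents {D : Set ℂ} (p : Fin n → Fin r) (c : Fin n → ℂ)
    (hc : ∀ j, c j ∈ D)
    (h : ∀ j k, j < k → p j = p k → c j = c k →
      (∃ l, j < l ∧ l < k ∧ p l = p j ∧ c l = c j + 1) ∧
        ∃ l, j < l ∧ l < k ∧ p l = p j ∧ c j = c l + 1) :
    ∃ (P : PlacedShape r n D) (T : P.Box ≃ Fin n), P.IsStandard T ∧
      ∀ j, (T.symm j).p = p j ∧ P.c (T.symm j) = c j := by
  obtain ⟨δ, hpos, hadj, hsame, hdiff⟩ := exists_diagonals c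
  obtain ⟨S, T, hT, hS⟩ := exists_skewShape_of_word (L := fun j => (p j, δ j))
    (fun j k hjk e => by
      obtain ⟨e1, e2⟩ := Prod.mk.inj e
      obtain ⟨⟨l, a1, a2, a3, a4⟩, ⟨l', b1, b2, b3, b4⟩⟩ :=
        h j k hjk e1 ((hsame k j).2 e2)
      exact ⟨⟨l, a1, a2, a3, (hadj _ _).1 a4⟩, ⟨l', b1, b2, b3, (hadj _ _).1 b4⟩⟩) hpos
  have hd : ∀ b : S.Box, b.diag = δ (T b) := fun b => by
    have := (hS (T b)).2
    rwa [Equiv.symm_apply_apply] at this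
  let P : PlacedShape r n D :=
    { S with
      c := fun b => c (T b)
      c_mem := fun b => hc _
      c_mono := fun b b' hb k hk => by
        have := hdiff _ _ k hk
        rw [← hd, ← hd] at this
        rcases hb.2 with h | h <;> omega
      c_adjacent := fun b b' _ => by
        rw [hadj, hd b, hd b']
        omega
      c_same := fun b b' _ => by
        rw [hsame, hd b, hd b']
        omega }
  exact ⟨P, T, hT, fun j => ⟨(hS j).1, congrArg c (T.apply_symm_apply j)⟩⟩

end YokonumaHecke

namespace YokonumaHecke

variable {r n : ℕ}

/-! ### Classification of the irreducible calibrated modules -/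

open PlacedShape SkewShape

section Classification

variable {q ζ : ℂ} {M : Type*} [AddCommGroup M] [Module ℂ M] [Module (YHat r n q) M]
  [IsScalarTower ℂ (YHat r n q) M] {D : Set ℂ}

/-- A weight of an irreducible calibrated module is the weight of a standard tableau. -/
lemma IsWeightBasis.exists_word_eq {κ : Type*} {b : Module.Basis κ ℂ M}
    {A : κ → Fin n → Fin r × ℂ} (hA : IsWeightBasis q ζ b A)
    (hreg : HasRegularWeights (r := r) (n := n) q ζ M) (hM : IsSimpleModule (YHat r n q) M)
    (hn : 0 < n) (hq : q ≠ 0) (hq4 : q + q⁻¹ ≠ 0) (hr : 0 < r) (hζ : IsPrimitiveRoot ζ r)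
    (hD : IsContentDomain q D) (k : κ) :
    ∃ (P : PlacedShape r n D) (T : P.Box ≃ Fin n), P.IsStandard T ∧ P.word q T = A k := by
  have hex : ∀ j, ∃ x ∈ D, qpow q x = (A k j).2 := fun j => hD.2.surjOn (hA.snd_ne_zero k j)
  choose c hcD hc using hex
  obtain ⟨P, T, hT, h⟩ := exists_placedShape_of_contents (fun j => (A k j).1) c hcD
    (fun i j hij hp hcc => by
      obtain ⟨⟨l, h1, h2, h3, h4⟩, ⟨l', h1', h2', h3', h4'⟩⟩ :=
        hreg.exists_neighbours hM hA hn hq hq4 hr hζ (hA.isWeightVector k) (b.ne_zero k) hij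
          (Prod.ext hp (by rw [← hc, ← hc, hcc]))
      rw [← hc, ← hc, qpow_eq_mul_iff hq hD (hcD _) (hcD _)] at h4 h4'
      exact ⟨⟨l, h1, h2, h3, h4⟩, ⟨l', h1', h2', h3', h4'⟩⟩)
  refine ⟨P, T, hT, funext fun j => Prod.ext (h j).1 ?_⟩
  rw [← hc, ← (h j).2]
  rfl

/-- The rescaled intertwiners carry a weight vector whose weight is that of a standard tableau to
vectors that satisfy the formulas for the vectors `w_T`. -/
lemma HasRegularWeights.exists_tableau_family
    (hreg : HasRegularWeights (r := r) (n := n) q ζ M) (hM : IsSimpleModule (YHat r n q) M)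
    {κ : Type*} {b : Module.Basis κ ℂ M} {A : κ → Fin n → Fin r × ℂ} (hA : IsWeightBasis q ζ b A)
    (hn : 0 < n) (hq : q ≠ 0) (hr : 0 < r) (hζ : IsPrimitiveRoot ζ r) (hD : IsContentDomain q D)
    {P : PlacedShape r n D} {T₀ : P.Box ≃ Fin n} {m : M}
    (hm : IsWeightVector q ζ (P.word q T₀) m) :
    ∃ v : (P.Box ≃ Fin n) → M, v T₀ = m ∧ (∀ T, IsWeightVector q ζ (P.word q T) (v T)) ∧
      ∀ T, P.IsStandard T → ∀ i,
        (P.IsStandard (swapLabel T i) → YokonumaHecke.intertwiner q i (P.word q T) (v T) =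
          swapCoeff q (P.word q T (lo i)) (P.word q T (hi i)) • v (swapLabel T i)) ∧
        (¬ P.IsStandard (swapLabel T i) →
          YokonumaHecke.intertwiner q i (P.word q T) (v T) = 0) := by
  -- only steps between standard tableaux matter below, and there the inverse is a genuine one
  obtain ⟨u, hu1, hu, hstep⟩ := hreg.exists_family hr hζ (fun x y => (swapCoeff q x y)⁻¹) hm
  have hword : ∀ T : P.Box ≃ Fin n, P.word q T₀ ∘ ⇑(T.symm.trans T₀) = P.word q T := fun T =>
    funext fun j => by simp [word]
  have hv : ∀ T : P.Box ≃ Fin n, IsWeightVector q ζ (P.word q T) (u (T.symm.trans T₀)) :=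
    fun T => by
      rw [← hword T]
      exact hu _
  -- the formula for an exchange that increases the length of the permutation
  have hasc : ∀ (T : P.Box ≃ Fin n) (i : Fin (n - 1)), P.IsStandard T →
      P.IsStandard (swapLabel T i) → T₀ (T.symm (lo i)) < T₀ (T.symm (hi i)) →
      YokonumaHecke.intertwiner q i (P.word q T) (u (T.symm.trans T₀)) =
        swapCoeff q (P.word q T (lo i)) (P.word q T (hi i)) •
          u ((swapLabel T i).symm.trans T₀) := by
    intro T i hT hTi hlt
    have h1 := hstep (T.symm.trans T₀) i hlt
    have h2 : T.symm.trans T₀ * adjSwap i = (swapLabel T i).symm.trans T₀ :=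
      Equiv.ext fun _ => rfl
    have h3 := congrFun (hword T)
    simp only [Function.comp_apply] at h3
    rw [h2, hword, h3, h3] at h1
    have h4 := left_ne_zero_of_mul ((swapLabel_isStandard_iff hq hD hT i).1 hTi)
    rw [h1, smul_smul, mul_inv_cancel₀ h4, one_smul]
  refine ⟨fun T => u (T.symm.trans T₀), (congrArg u T₀.symm_trans_self).trans hu1, hv,
    fun T hT i => ⟨fun hTi => ?_, fun hTi => ?_⟩⟩
  · rcases lt_or_gt_of_ne (fun e => lo_ne_hi i (T.symm.injective (T₀.injective e))) with hlt | hgt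
    · exact hasc T i hT hTi hlt
    · -- the formula for the converse exchange is known, and `τ_i²` is a scalar
      have h1 := hasc (swapLabel T i) i hTi (by rwa [swapLabel_swapLabel]) (by
        simpa only [coe_swapLabel_symm, swapWord_lo, swapWord_hi] using hgt)
      have h2 := hreg.intertwiner_intertwiner hq hr hζ (hv (swapLabel T i)) i
      have h4 := right_ne_zero_of_mul ((swapLabel_isStandard_iff hq hD hT i).1 hTi)
      rw [h1, word_swapLabel, swapWord_swapWord, swapLabel_swapLabel, intertwiner_smul,
        swapWord_lo, swapWord_hi, mul_smul] at h2
      exact smul_right_injective M h4 h2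
  · refine hreg.intertwiner_eq_zero hM hA hn hq hr hζ (hv T) ?_
    by_contra h
    exact hTi ((swapLabel_isStandard_iff hq hD hT i).2 h)

/-- Vectors that satisfy the formulas for the `w_T` define a homomorphism, which is an isomorphism
by Schur's lemma if it is not zero. -/
lemma PlacedShape.IsTableauAction.nonempty_equiv_of_family (hM : IsSimpleModule (YHat r n q) M)
    {P : PlacedShape r n D} {ρ : YHat r n q →ₐ[ℂ] Module.End ℂ P.Space}
    (hρ : P.IsTableauAction q ζ ρ) (hρM : IsSimpleModule (YHat r n q) (RepModule ρ)) (hn : 0 < n)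
    {v : (P.Box ≃ Fin n) → M} (hv : ∀ T, IsWeightVector q ζ (P.word q T) (v T))
    {T₀ : P.Std} (h0 : v T₀.1 ≠ 0)
    (hτ : ∀ T, P.IsStandard T → ∀ i,
      (P.IsStandard (swapLabel T i) → YokonumaHecke.intertwiner q i (P.word q T) (v T) =
        swapCoeff q (P.word q T (lo i)) (P.word q T (hi i)) • v (swapLabel T i)) ∧
      (¬ P.IsStandard (swapLabel T i) →
        YokonumaHecke.intertwiner q i (P.word q T) (v T) = 0)) :
    Nonempty (M ≃ₗ[YHat r n q] RepModule ρ) := by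
  let f : P.Space →ₗ[ℂ] M := Finsupp.linearCombination ℂ fun T : P.Std => v T.1
  have hf : ∀ T, P.IsStandard T → f (P.w T) = v T := fun T hT => linearCombination_w _ ⟨T, hT⟩
  have hext : ∀ a : YHat r n q, (∀ T, P.IsStandard T → f (ρ a (P.w T)) = a • v T) →
      ∀ x : P.Space, f (ρ a x) = a • f x := fun a h x => by
    have : f ∘ₗ ρ a = Algebra.lsmul ℂ ℂ M a ∘ₗ f := hom_ext_w fun T hT => by
      rw [LinearMap.comp_apply, LinearMap.comp_apply, h T hT, hf T hT, Algebra.lsmul_coe]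
    exact congrArg (fun g : P.Space →ₗ[ℂ] M => g x) this
  let f' : RepModule ρ →ₗ[ℂ] M := f
  have hsmul := map_smul_of_generators (r := r) (n := n) (q := q) f'
    (fun j => hext (YHat.t r n q j) fun T hT => by
      rw [hρ.t_apply ⟨T, hT⟩ j, map_smul, hf T hT, (hv T j).1]
      rfl)
    (fun i => hext (YHat.g r n q i) fun T hT => by
      obtain ⟨h1, h2⟩ := hτ T hT i
      rw [hρ.g_apply hT, map_add, map_smul, map_smul, hf T hT]
      by_cases hTi : P.IsStandard (swapLabel T i)
      · rw [hf _ hTi, ← h1 hTi, YokonumaHecke.intertwiner, add_sub_cancel]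
      · have := h2 hTi
        rw [YokonumaHecke.intertwiner, sub_eq_zero] at this
        rw [w_of_not hTi, map_zero, smul_zero, add_zero, this])
    (hext (YHat.ofGen r n q Gen.X₁) fun T hT => by
      rw [hρ.X₁_apply hn hT, map_smul, hf T hT, ← YHat.X_zero hn, (hv T _).2])
  let F : RepModule ρ →ₗ[YHat r n q] M :=
    { toFun := f
      map_add' := f.map_add
      map_smul' := hsmul }
  have hF : F ≠ 0 := fun h => h0 (by
    rw [← hf T₀.1 T₀.2]
    exact congrArg (fun g : RepModule ρ →ₗ[YHat r n q] M => g (P.w T₀.1)) h)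
  exact ⟨(LinearEquiv.ofBijective F (F.bijective_or_eq_zero.resolve_right hF)).symm⟩

/-- Every irreducible calibrated module is given by a placed shape. -/
theorem IsCalibrated.exists_placedShape (hcal : IsCalibrated r n q ζ M)
    (hM : IsSimpleModule (YHat r n q) M) (hn : 0 < n) (hq : q ≠ 0) (hQ : q - q⁻¹ ≠ 0)
    (hq4 : q + q⁻¹ ≠ 0) (hr : 0 < r) (hζ : IsPrimitiveRoot ζ r) (hD : IsContentDomain q D) :
    ∃ (P : PlacedShape r n D) (ρ : YHat r n q →ₐ[ℂ] Module.End ℂ P.Space),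
      P.IsTableauAction q ζ ρ ∧ Nonempty (M ≃ₗ[YHat r n q] RepModule ρ) := by
  obtain ⟨b, A, hA⟩ := hcal.exists_weightBasis
  have hreg := hA.hasRegularWeights hr hζ hQ
  have : Nontrivial M := IsSimpleModule.nontrivial (YHat r n q) M
  obtain ⟨x, hx⟩ := exists_ne (0 : M)
  obtain ⟨k, -⟩ := exists_repr_ne_zero (b := b) hx
  obtain ⟨P, T₀, hT₀, hword⟩ := hA.exists_word_eq hreg hM hn hq hq4 hr hζ hD k
  obtain ⟨ρ, hρ⟩ := exists_isTableauAction hr hn hq hζ hD P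
  obtain ⟨v, hv₀, hv, hτ⟩ := hreg.exists_tableau_family hM hA hn hq hr hζ hD
    (hword ▸ hA.isWeightVector k)
  exact ⟨P, ρ, hρ, hρ.nonempty_equiv_of_family hM (hρ.isSimpleModule hq hζ hD) hn hv
    (T₀ := ⟨T₀, hT₀⟩) (by rw [hv₀]; exact b.ne_zero k) hτ⟩

end Classification

end YokonumaHecke

open YokonumaHecke in
theorem theorem3p1 (r n : ℕ) (hr : 0 < r) (hn : 0 < n)
    (q : ℂ) (hq0 : q ≠ 0) (hq : ∀ k : ℕ, 0 < k → q ^ k ≠ 1)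
    (ζ : ℂ) (hζ : IsPrimitiveRoot ζ r) (D : Set ℂ) (hD : IsContentDomain q D) :
    -- the formulas define an action, and only one
    (∀ P : PlacedShape r n D,
      ∃! ρ : YHat r n q →ₐ[ℂ] Module.End ℂ P.Space, P.IsTableauAction q ζ ρ) ∧
    -- the resulting module is irreducible and calibrated
    (∀ (P : PlacedShape r n D) (ρ : YHat r n q →ₐ[ℂ] Module.End ℂ P.Space),
      P.IsTableauAction q ζ ρ →
        IsSimpleModule (YHat r n q) (RepModule ρ) ∧ IsCalibrated r n q ζ (RepModule ρ)) ∧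
    -- different placed shapes give non-isomorphic modules
    (∀ (P P' : PlacedShape r n D) (ρ : YHat r n q →ₐ[ℂ] Module.End ℂ P.Space)
      (ρ' : YHat r n q →ₐ[ℂ] Module.End ℂ P'.Space),
      P.IsTableauAction q ζ ρ → P'.IsTableauAction q ζ ρ' →
        (Nonempty (RepModule ρ ≃ₗ[YHat r n q] RepModule ρ') ↔ P.Equivalent P')) ∧
    -- every irreducible calibrated module arises in this way
    (∀ (M : Type*) [AddCommGroup M] [Module ℂ M] [Module (YHat r n q) M]
      [IsScalarTower ℂ (YHat r n q) M],
      IsSimpleModule (YHat r n q) M → IsCalibrated r n q ζ M →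
        ∃ (P : PlacedShape r n D) (ρ : YHat r n q →ₐ[ℂ] Module.End ℂ P.Space),
          P.IsTableauAction q ζ ρ ∧ Nonempty (M ≃ₗ[YHat r n q] RepModule ρ)) := by
  have h2 := hq 2 two_pos
  have h4 := hq 4 four_pos
  have hinv : q * q⁻¹ = 1 := mul_inv_cancel₀ hq0
  have hQ : q - q⁻¹ ≠ 0 := fun h => h2 (by linear_combination q * h + hinv)
  have hQ' : q + q⁻¹ ≠ 0 := fun h =>
    h4 (by linear_combination (q ^ 2 - 1) * q * h - (q ^ 2 - 1) * hinv)
  refine ⟨fun P => ?_, fun P ρ hρ => ⟨hρ.isSimpleModule hq0 hζ hD, hρ.isCalibrated⟩,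
    fun P P' ρ ρ' hρ hρ' => hρ.nonempty_equiv_iff hn hζ hD hρ',
    fun M _ _ _ _ hM hcal => hcal.exists_placedShape hM hn hq0 hQ hQ' hr hζ hD⟩
  obtain ⟨ρ, hρ⟩ := PlacedShape.exists_isTableauAction hr hn hq0 hζ hD P
  exact ⟨ρ, hρ, fun ρ' hρ' => hρ'.unique hn hρ⟩
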